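/- All spaces are real and $\mathbb N=\{1,2,\dots\}$. For $s>1$ put $s'=s/(s-1)$. Let $1<p<2<r<\infty$ with $r'<p$, and let $(k_n)_{n\ge1}\subseteq\mathbb N$ satisfy, for all $n\ge 1$, $$1+2\sum_{i=1}^{n-1} i^{r/2}k_i^{r/2}\ \le\ \frac{k_n^{1-p/2}}{n^{p/2}}\qquad\text{and}\qquad \Bigl(\frac{n+1}{n}\Bigr)^{r/2}\Bigl(\frac{k_n}{k_{n+1}}\Bigr)^{(1/p-1/p')r/2}\le\frac12 .$$ Put $\alpha_n=\sqrt n\,k_n^{(1/p'-1/p)/2}$. Let $(t_i)$ be the basic sequence such that for all finitely non-zero real arrays $(a^i_j)_{1\le j\le k_i,\ i\ge1}$ $$\Bigl\|\sum_{i}\sum_{j=1}^{k_i}a^i_j\,t_{k_1+\dots+k_{i-1}+j}\Bigr\|=\max\Bigl\{\Bigl(\sum_{i,j}|a^i_j|^r\Bigr)^{1/r},\ \Bigl(\sum_i \alpha_i^r\Bigl(\sum_{j=1}^{k_i}|a^i_j|^p\Bigr)^{r/p}\Bigr)^{1/r}\Bigr\},$$ and let $E$ be the completion of the space of finitely non-zero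 real sequences, with unit vectors $(e_i)$, under the norm $$\Bigl\|\sum b_ie_i\Bigr\|=\sup\Bigl\{\Bigl\|\sum b_i t_{\sigma(i)}\Bigr\| : \sigma\text{ a permutation of }\mathbb N\Bigr\}.$$ Let $J(e_i)$ be the completion of the space of finitely non-zero real sequences, with unit vectors $(u_i)$, under the norm $$\Bigl\|\sum a_iu_i\Bigr\|=\sup\Bigl\{\Bigl\|\sum_{i=1}^{m}\Bigl(\sum_{j=q(i)}^{q(i+1)-1}a_j\Bigr)e_{q(i)}\Bigr\| : m\in\mathbb N,\ 1=q(1)<q(2)<\dots<q(m+1)\Bigr\}.$$ A sequence $(x_i)$ dominates $(y_i)$ if there is a constant $C$ with $\|\sum a_iy_i\|\le C\|\sum a_ix_i\|$ for all finitely non-zero real $(a_i)$; two sequences are equivalent if each dominates the other. A Banach space $X$ has Property (w) if every bounded linear operator from $X$ into its dual $X'$ is weakly compact. Then $E$ is reflexive, and $(e_i)$ is a normalized basis of $E$ which is symmetric (equivalent to each of its permutations) and subsymmetric (unconditional and equivalent to each of its subsequences). Moreover, with $(e_i')$ the sequence of functionals biorthogonal to $(e_i)$: (i) $E$ satisfies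 an upper $p$-estimate: there is a constant $C$ such that $\|\sum_{i=1}^n x_i\|\le C(\sum_{i=1}^n\|x_i\|^p)^{1/p}$ for all $n$ and all $x_1,\dots,x_n\in E$ that are pairwise disjoint with respect to the coordinates of $(e_i)$; (ii) $(e_i')$ does not dominate $(e_i)$; (iii) the unit vector basis of $\ell^p$ does not dominate $(e_i')$. Both $J(e_i)$ and its dual $J(e_i)'$ have Property (w), but neither has a weakly sequentially complete dual; that is, neither $J(e_i)'$ nor $J(e_i)''$ is weakly sequentially complete. -/

import Mathlib

open scoped Topology

noncomputable section

/-! ### Completions of the space of finitely non-zero real sequences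

Sequences are indexed from `0`: index `i : ℕ` below plays the part of the index `i + 1` in the
usual convention `ℕ = {1, 2, …}`. The space of finitely non-zero real sequences is `ℕ →₀ ℝ`. -/

/-- The space of finitely non-zero real sequences, carrying the (semi)norm `N`. -/
def C00 (_N : Seminorm ℝ (ℕ →₀ ℝ)) : Type := ℕ →₀ ℝ

namespace C00

variable (N : Seminorm ℝ (ℕ →₀ ℝ))

instance : AddCommGroup (C00 N) := inferInstanceAs (AddCommGroup (ℕ →₀ ℝ))

instance : Module ℝ (C00 N) := inferInstanceAs (Module ℝ (ℕ →₀ ℝ))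

instance : SeminormedAddCommGroup (C00 N) :=
  AddGroupSeminorm.toSeminormedAddCommGroup (E := C00 N) N.toAddGroupSeminorm

instance : NormedSpace ℝ (C00 N) where
  norm_smul_le c a := le_of_eq (map_smul_eq_mul N c a)

/-- A finitely non-zero sequence regarded as an element of the normed space. -/
def of : (ℕ →₀ ℝ) ≃ₗ[ℝ] C00 N := LinearEquiv.refl ℝ (ℕ →₀ ℝ)

lemma norm_of (a : ℕ →₀ ℝ) : ‖of N a‖ = N a := rfl

end C00

/-- The completion of the space of finitely non-zero sequences with respect to `N`. -/
abbrev C00Completion (N : Seminorm ℝ (ℕ →₀ ℝ)) : Type := UniformSpace.Completion (C00 N)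

/-- The `i`-th unit vector, as an element of the completion. -/
def C00Completion.unit (N : Seminorm ℝ (ℕ →₀ ℝ)) (i : ℕ) : C00Completion N :=
  (C00.of N (Finsupp.single i (1 : ℝ)) : UniformSpace.Completion (C00 N))

/-! ### Geometry of Banach spaces -/

/-- `(x i)` dominates `(y i)`: `‖∑ a i • y i‖ ≤ C * ‖∑ a i • x i‖` for all finitely non-zero real
sequences `a`. -/
def Dominates {X Y : Type*} [AddCommGroup X] [Module ℝ X] [Norm X]
    [AddCommGroup Y] [Module ℝ Y] [Norm Y] (x : ℕ → X) (y : ℕ → Y) : Prop :=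
  ∃ C : ℝ, ∀ a : ℕ →₀ ℝ, ‖a.sum fun i c => c • y i‖ ≤ C * ‖a.sum fun i c => c • x i‖

/-- Two sequences are equivalent if each dominates the other. -/
def EquivSeq {X Y : Type*} [AddCommGroup X] [Module ℝ X] [Norm X]
    [AddCommGroup Y] [Module ℝ Y] [Norm Y] (x : ℕ → X) (y : ℕ → Y) : Prop :=
  Dominates x y ∧ Dominates y x

/-- The unit vector basis of `ℓ^p`. -/
def lpUnit (p : ℝ) (i : ℕ) : lp (fun _ : ℕ => ℝ) (ENNReal.ofReal p) :=
  lp.single (ENNReal.ofReal p) i (1 : ℝ)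

section Banach

variable {X Y : Type*} [NormedAddCommGroup X] [NormedSpace ℝ X]
  [NormedAddCommGroup Y] [NormedSpace ℝ Y]

/-- The basis `b` is unconditional: the expansion of every vector converges unconditionally
(`HasSum` is convergence along the net of all finite sets of indices). -/
def IsUnconditionalBasis (b : SchauderBasis ℝ X) : Prop :=
  ∀ x : X, HasSum (fun i => b.coord i x • b i) x

/-- A basis is subsymmetric if it is unconditional and equivalent to each of its subsequences. -/
def IsSubsymmetricBasis (b : SchauderBasis ℝ X) : Prop :=
  IsUnconditionalBasis b ∧ ∀ n : ℕ → ℕ, StrictMono n → EquivSeq (fun i => b (n i)) (fun i => b i)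

/-- A basis is symmetric if it is equivalent to each of its permutations. -/
def IsSymmetricBasis (b : SchauderBasis ℝ X) : Prop :=
  ∀ σ : Equiv.Perm ℕ, EquivSeq (fun i => b (σ i)) (fun i => b i)

/-- Upper `p`-estimate with respect to the lattice structure given by the basis `b`; two vectors
are disjoint if no coordinate is non-zero at both of them. -/
def UpperEstimate (b : SchauderBasis ℝ X) (p : ℝ) : Prop :=
  ∃ C : ℝ, ∀ (n : ℕ) (x : Fin n → X),
    (∀ i j, i ≠ j → ∀ m, b.coord m (x i) = 0 ∨ b.coord m (x j) = 0) →
      ‖∑ i, x i‖ ≤ C * (∑ i, ‖x i‖ ^ p) ^ (1 / p)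

/-- The canonical embedding into the bidual is onto. -/
def IsReflexiveSpace (X : Type*) [NormedAddCommGroup X] [NormedSpace ℝ X] : Prop :=
  Function.Surjective (NormedSpace.inclusionInDoubleDual ℝ X)

/-- The image of the closed unit ball is relatively compact in the weak topology. -/
def IsWeaklyCompactOperator (T : X →L[ℝ] Y) : Prop :=
  IsCompact (closure (toWeakSpace ℝ Y '' (T '' Metric.closedBall (0 : X) 1)))

/-- Property (w): every bounded linear operator from `X` into its dual is weakly compact. -/
def PropertyW (X : Type*) [NormedAddCommGroup X] [NormedSpace ℝ X] : Prop :=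
  ∀ T : X →L[ℝ] StrongDual ℝ X, IsWeaklyCompactOperator T

/-- Every weakly Cauchy sequence converges weakly. -/
def WeaklySequentiallyComplete (X : Type*) [NormedAddCommGroup X] [NormedSpace ℝ X] : Prop :=
  ∀ x : ℕ → X, (∀ f : StrongDual ℝ X, CauchySeq fun n => f (x n)) →
    ∃ y : X, ∀ f : StrongDual ℝ X, Filter.Tendsto (fun n => f (x n)) Filter.atTop (𝓝 (f y))

end Banach

/-! ### James type spaces -/

section James

variable {X : Type*} [NormedAddCommGroup X] [NormedSpace ℝ X]

/-- The representative `∑_{i < n} (∑_{q i ≤ j < q (i+1)} a j) • e (q i)` of `∑ a j u j`. -/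
def jamesRep (e : ℕ → X) (n : ℕ) (q : ℕ → ℕ) (a : ℕ →₀ ℝ) : X :=
  ∑ i ∈ Finset.range n, (∑ j ∈ Finset.Ico (q i) (q (i + 1)), a j) • e (q i)

/-- The index set of the representatives: the number of intervals and the strictly increasing
sequence of their left endpoints, beginning with the first index. -/
abbrev JamesIndex : Type := ℕ × {q : ℕ → ℕ // StrictMono q ∧ q 0 = 0}

/-- The James norm of a finitely non-zero sequence: the supremum of the norms of its
representatives. -/
def jamesFun (e : ℕ → X) (a : ℕ →₀ ℝ) : ℝ :=
  ⨆ s : JamesIndex, ‖jamesRep e s.1 s.2.1 a‖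

lemma jamesRep_add (e : ℕ → X) (n : ℕ) (q : ℕ → ℕ) (a b : ℕ →₀ ℝ) :
    jamesRep e n q (a + b) = jamesRep e n q a + jamesRep e n q b := by
  simp only [jamesRep, Finsupp.add_apply, Finset.sum_add_distrib, add_smul]

lemma jamesRep_smul (e : ℕ → X) (n : ℕ) (q : ℕ → ℕ) (c : ℝ) (a : ℕ →₀ ℝ) :
    jamesRep e n q (c • a) = c • jamesRep e n q a := by
  simp only [jamesRep, Finsupp.smul_apply, smul_eq_mul, ← Finset.mul_sum, Finset.smul_sum,
    mul_smul]

lemma jamesRep_bddAbove (e : ℕ → X) (a : ℕ →₀ ℝ) :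
    BddAbove (Set.range fun s : JamesIndex => ‖jamesRep e s.1 s.2.1 a‖) := by
  classical
  obtain ⟨M, hM⟩ : ∃ M, ∀ j, M ≤ j → a j = 0 := by
    obtain ⟨M, hM⟩ := a.support.bddAbove
    refine ⟨M + 1, fun j hj => ?_⟩
    by_contra h0
    have := hM (by simpa using h0 : j ∈ (a.support : Set ℕ))
    omega
  set A : ℝ := ∑ j ∈ a.support, |a j| with hA
  have hA0 : 0 ≤ A := Finset.sum_nonneg fun _ _ => abs_nonneg _
  refine ⟨∑ m ∈ Finset.range M, A * ‖e m‖, ?_⟩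
  rintro _ ⟨⟨n, q, hq, hq0⟩, rfl⟩
  have hs : ∀ u v, |∑ j ∈ Finset.Ico u v, a j| ≤ A := by
    intro u v
    refine (Finset.abs_sum_le_sum_abs _ _).trans ?_
    rw [← Finset.sum_filter_ne_zero]
    refine Finset.sum_le_sum_of_subset_of_nonneg (fun j hj => ?_) fun _ _ _ => abs_nonneg _
    simpa using (Finset.mem_filter.1 hj).2
  calc ‖jamesRep e n q a‖
      ≤ ∑ i ∈ Finset.range n, ‖(∑ j ∈ Finset.Ico (q i) (q (i + 1)), a j) • e (q i)‖ :=
        norm_sum_le _ _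
    _ ≤ ∑ i ∈ Finset.range n, (fun m => if m < M then A * ‖e m‖ else 0) (q i) := by
        refine Finset.sum_le_sum fun i _ => ?_
        dsimp only
        split_ifs with h
        · rw [norm_smul]
          exact mul_le_mul_of_nonneg_right (hs _ _) (norm_nonneg _)
        · have : ∑ j ∈ Finset.Ico (q i) (q (i + 1)), a j = 0 :=
            Finset.sum_eq_zero fun j hj => hM j (by have := (Finset.mem_Ico.1 hj).1; omega)
          simp [this]
    _ = ∑ m ∈ (Finset.range n).image q, (if m < M then A * ‖e m‖ else 0) := by
        rw [Finset.sum_image fun x _ y _ hxy => hq.injective hxy]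
    _ ≤ ∑ m ∈ Finset.range M, A * ‖e m‖ := by
        rw [← Finset.sum_filter]
        refine Finset.sum_le_sum_of_subset_of_nonneg (fun m hm => ?_)
          fun m _ _ => mul_nonneg hA0 (norm_nonneg _)
        simpa using (Finset.mem_filter.1 hm).2

instance : Nonempty JamesIndex := ⟨(0, ⟨id, strictMono_id, rfl⟩)⟩

/-- The James norm as a seminorm on finitely non-zero sequences. -/
def jamesNorm (e : ℕ → X) : Seminorm ℝ (ℕ →₀ ℝ) :=
  Seminorm.of (jamesFun e)
    (fun a b => ciSup_le fun s => by
      rw [jamesRep_add]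
      exact (norm_add_le _ _).trans
        (add_le_add (le_ciSup (jamesRep_bddAbove e a) s) (le_ciSup (jamesRep_bddAbove e b) s)))
    (fun c a => by
      simp only [jamesFun, jamesRep_smul, norm_smul]
      exact (Real.mul_iSup_of_nonneg (norm_nonneg c) _).symm)

/-- The James type space `J(e_i)`. -/
abbrev JamesSpace (e : ℕ → X) : Type := C00Completion (jamesNorm e)

end James

/-! ### The symmetrized space -/

/-- The weights `α_n = √n * k_n ^ ((1/p' - 1/p)/2)` (with `n + 1` in place of `n`). -/
def weight (p : ℝ) (k : ℕ → ℕ) (n : ℕ) : ℝ :=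
  √((n : ℝ) + 1) * (k n : ℝ) ^ ((1 / p.conjExponent - 1 / p) / 2)

/-- The standing assumptions on `p`, `r` and `(k_n)`; `k n` stands for the `(n+1)`-st term, and
`p.conjExponent = p / (p - 1)`. -/
structure Admissible (p r : ℝ) (k : ℕ → ℕ) : Prop where
  one_lt_p : 1 < p
  p_lt_two : p < 2
  two_lt_r : 2 < r
  conj_lt : r.conjExponent < p
  growth : ∀ n : ℕ,
    1 + 2 * ∑ i ∈ Finset.range n, ((i : ℝ) + 1) ^ (r / 2) * (k i : ℝ) ^ (r / 2) ≤
      (k n : ℝ) ^ (1 - p / 2) / ((n : ℝ) + 1) ^ (p / 2)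
  ratio : ∀ n : ℕ,
    (((n : ℝ) + 2) / ((n : ℝ) + 1)) ^ (r / 2) *
      ((k n : ℝ) / (k (n + 1) : ℝ)) ^ ((1 / p - 1 / p.conjExponent) * r / 2) ≤ 1 / 2

/-- The `ℓ^r` norm of a finitely non-zero sequence. -/
def lrFun (r : ℝ) (a : ℕ →₀ ℝ) : ℝ := (∑' i, |a i| ^ r) ^ (1 / r)

/-- The `ℓ^p` norm of the `i`-th block of `a`; the blocks are consecutive intervals of `ℕ`, the
`i`-th one having `k i` elements. -/
def blockFun (p : ℝ) (k : ℕ → ℕ) (i : ℕ) (a : ℕ →₀ ℝ) : ℝ :=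
  (∑ j ∈ Finset.range (k i), |a ((∑ m ∈ Finset.range i, k m) + j)| ^ p) ^ (1 / p)

/-- The `ℓ^r` norm of the sequence of weighted `ℓ^p` norms of the blocks of `a`. -/
def mixedFun (p r : ℝ) (k : ℕ → ℕ) (a : ℕ →₀ ℝ) : ℝ :=
  (∑' i, (weight p k i * blockFun p k i a) ^ r) ^ (1 / r)

/-- The norm `‖∑ a i t i‖`. -/
def tFun (p r : ℝ) (k : ℕ → ℕ) (a : ℕ →₀ ℝ) : ℝ :=
  max (lrFun r a) (mixedFun p r k a)

/-- The norm `‖∑ b i e i‖ = sup_σ ‖∑ b i t (σ i)‖`, the supremum over all permutations `σ`. -/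
def symFun (p r : ℝ) (k : ℕ → ℕ) (b : ℕ →₀ ℝ) : ℝ :=
  ⨆ σ : Equiv.Perm ℕ, tFun p r k (b.mapDomain σ)

lemma weight_nonneg (p : ℝ) (k : ℕ → ℕ) (n : ℕ) : 0 ≤ weight p k n := by
  unfold weight; positivity

lemma blockFun_nonneg (p : ℝ) (k : ℕ → ℕ) (i : ℕ) (a : ℕ →₀ ℝ) : 0 ≤ blockFun p k i a := by
  unfold blockFun; positivity

lemma blockFun_add {p : ℝ} (hp : 1 ≤ p) (k : ℕ → ℕ) (i : ℕ) (a b : ℕ →₀ ℝ) :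
    blockFun p k i (a + b) ≤ blockFun p k i a + blockFun p k i b := by
  simpa only [blockFun, Finsupp.add_apply] using Real.Lp_add_le (Finset.range (k i))
    (fun j => a ((∑ m ∈ Finset.range i, k m) + j)) (fun j => b ((∑ m ∈ Finset.range i, k m) + j)) hp

lemma blockFun_smul {p : ℝ} (hp : 1 ≤ p) (k : ℕ → ℕ) (i : ℕ) (c : ℝ) (a : ℕ →₀ ℝ) :
    blockFun p k i (c • a) = |c| * blockFun p k i a := by
  have hp0 : p ≠ 0 := by linarith
  simp only [blockFun, Finsupp.smul_apply, smul_eq_mul, abs_mul]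
  simp_rw [Real.mul_rpow (abs_nonneg c) (abs_nonneg _)]
  rw [← Finset.mul_sum, Real.mul_rpow (by positivity) (by positivity), ← Real.rpow_mul
    (abs_nonneg c), mul_one_div_cancel hp0, Real.rpow_one]

namespace Admissible

variable {p r : ℝ} {k : ℕ → ℕ}

lemma one_le_k (h : Admissible p r k) (n : ℕ) : 1 ≤ k n := by
  by_contra h0
  have hk : k n = 0 := by omega
  have h1 := h.growth n
  have hp := h.p_lt_two
  rw [hk, Nat.cast_zero, Real.zero_rpow (by linarith), zero_div] at h1
  have : 0 ≤ ∑ i ∈ Finset.range n, ((i : ℝ) + 1) ^ (r / 2) * (k i : ℝ) ^ (r / 2) := by positivity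
  linarith

lemma lr_summable (h : Admissible p r k) (a : ℕ →₀ ℝ) : Summable fun i => |a i| ^ r := by
  have := h.two_lt_r
  refine summable_of_ne_finset_zero (s := a.support) fun i hi => ?_
  rw [Finsupp.notMem_support_iff.1 hi, abs_zero, Real.zero_rpow (by linarith)]

lemma mixed_summable (h : Admissible p r k) (a : ℕ →₀ ℝ) :
    Summable fun i => (weight p k i * blockFun p k i a) ^ r := by
  have hr := h.two_lt_r
  have hp := h.one_lt_p
  obtain ⟨M, hM⟩ := a.support.bddAbove
  refine summable_of_ne_finset_zero (s := Finset.range (M + 1)) fun i hi => ?_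
  have hi' : M + 1 ≤ i := by simpa using hi
  have hsum : i ≤ ∑ m ∈ Finset.range i, k m := by
    calc i = ∑ m ∈ Finset.range i, 1 := by simp
      _ ≤ _ := Finset.sum_le_sum fun m _ => h.one_le_k m
  have : blockFun p k i a = 0 := by
    unfold blockFun
    rw [Finset.sum_eq_zero, Real.zero_rpow (by positivity)]
    intro j _
    have h0 : a ((∑ m ∈ Finset.range i, k m) + j) = 0 := by
      by_contra hne
      have := hM (by simpa using hne : _ ∈ (a.support : Set ℕ))
      omega
    rw [h0, abs_zero, Real.zero_rpow (by linarith)]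
  rw [this, mul_zero, Real.zero_rpow (by linarith)]

lemma lrFun_add (h : Admissible p r k) (a b : ℕ →₀ ℝ) :
    lrFun r (a + b) ≤ lrFun r a + lrFun r b := by
  have hr := h.two_lt_r
  have hM := Real.Lp_add_le_tsum_of_nonneg (p := r) (by linarith) (fun i => abs_nonneg (a i))
    (fun i => abs_nonneg (b i)) (h.lr_summable a) (h.lr_summable b)
  refine le_trans ?_ hM.2
  refine Real.rpow_le_rpow (tsum_nonneg fun _ => by positivity) ?_ (by positivity)
  refine (h.lr_summable (a + b)).tsum_le_tsum (fun i => ?_) hM.1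
  exact Real.rpow_le_rpow (abs_nonneg _) (abs_add_le _ _) (by linarith)

lemma mixedFun_add (h : Admissible p r k) (a b : ℕ →₀ ℝ) :
    mixedFun p r k (a + b) ≤ mixedFun p r k a + mixedFun p r k b := by
  have hr := h.two_lt_r
  have hp := h.one_lt_p
  have hw : ∀ (c : ℕ →₀ ℝ) i, 0 ≤ weight p k i * blockFun p k i c := fun c i =>
    mul_nonneg (weight_nonneg p k i) (blockFun_nonneg p k i c)
  have hM := Real.Lp_add_le_tsum_of_nonneg (p := r) (by linarith) (hw a) (hw b)
    (h.mixed_summable a) (h.mixed_summable b)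
  refine le_trans ?_ hM.2
  refine Real.rpow_le_rpow (tsum_nonneg fun i => Real.rpow_nonneg (hw _ i) _) ?_ (by positivity)
  refine (h.mixed_summable (a + b)).tsum_le_tsum (fun i => ?_) hM.1
  refine Real.rpow_le_rpow (hw _ i) ?_ (by linarith)
  rw [← mul_add]
  exact mul_le_mul_of_nonneg_left (blockFun_add hp.le k i a b) (weight_nonneg p k i)

lemma tFun_add (h : Admissible p r k) (a b : ℕ →₀ ℝ) :
    tFun p r k (a + b) ≤ tFun p r k a + tFun p r k b :=
  max_le ((h.lrFun_add a b).trans (add_le_add (le_max_left _ _) (le_max_left _ _)))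
    ((h.mixedFun_add a b).trans (add_le_add (le_max_right _ _) (le_max_right _ _)))

lemma tFun_smul (h : Admissible p r k) (c : ℝ) (a : ℕ →₀ ℝ) :
    tFun p r k (c • a) = ‖c‖ * tFun p r k a := by
  have hr := h.two_lt_r
  have hp := h.one_lt_p
  have hr0 : r ≠ 0 := by linarith
  have h1 : lrFun r (c • a) = ‖c‖ * lrFun r a := by
    simp only [lrFun, Finsupp.smul_apply, smul_eq_mul, abs_mul]
    simp_rw [Real.mul_rpow (abs_nonneg c) (abs_nonneg _)]
    rw [tsum_mul_left, Real.mul_rpow (by positivity) (tsum_nonneg fun _ => by positivity),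
      ← Real.rpow_mul (abs_nonneg c), mul_one_div_cancel hr0, Real.rpow_one, Real.norm_eq_abs]
  have h2 : mixedFun p r k (c • a) = ‖c‖ * mixedFun p r k a := by
    have hw : ∀ i, 0 ≤ weight p k i * blockFun p k i a := fun i =>
      mul_nonneg (weight_nonneg p k i) (blockFun_nonneg p k i a)
    simp only [mixedFun, blockFun_smul hp.le, mul_left_comm _ |c|]
    simp_rw [Real.mul_rpow (abs_nonneg c) (hw _)]
    rw [tsum_mul_left, Real.mul_rpow (by positivity)
      (tsum_nonneg fun i => Real.rpow_nonneg (hw i) _),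
      ← Real.rpow_mul (abs_nonneg c), mul_one_div_cancel hr0, Real.rpow_one, Real.norm_eq_abs]
  rw [tFun, h1, h2, tFun, mul_max_of_nonneg _ _ (norm_nonneg c)]

lemma weight_le_one (h : Admissible p r k) (n : ℕ) : weight p k n ≤ 1 := by
  have hp := h.one_lt_p
  have hp2 := h.p_lt_two
  have hk : (0 : ℝ) < k n := by exact_mod_cast h.one_le_k n
  have hn : (0 : ℝ) < (n : ℝ) + 1 := by positivity
  have hs : 0 ≤ ∑ i ∈ Finset.range n, ((i : ℝ) + 1) ^ (r / 2) * (k i : ℝ) ^ (r / 2) := by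
    positivity
  have h1 : ((n : ℝ) + 1) ^ (p / 2) ≤ (k n : ℝ) ^ (1 - p / 2) := by
    have := h.growth n
    have h2 : 1 ≤ (k n : ℝ) ^ (1 - p / 2) / ((n : ℝ) + 1) ^ (p / 2) := by linarith
    rwa [one_le_div (by positivity)] at h2
  have h3 := Real.rpow_le_rpow (by positivity) h1 (by positivity : 0 ≤ 1 / p)
  rw [← Real.rpow_mul hn.le, ← Real.rpow_mul hk.le] at h3
  have e1 : p / 2 * (1 / p) = 1 / 2 := by field_simp
  have e2 : (1 / p.conjExponent - 1 / p) / 2 = -((1 - p / 2) * (1 / p)) := by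
    have : p - 1 ≠ 0 := by linarith
    unfold Real.conjExponent
    field_simp
    ring
  rw [e1, ← Real.sqrt_eq_rpow] at h3
  rw [weight, e2, Real.rpow_neg hk.le, ← div_eq_mul_inv, div_le_one (by positivity)]
  exact h3

lemma tFun_single (h : Admissible p r k) (i : ℕ) : tFun p r k (Finsupp.single i 1) ≤ 1 := by
  have hr := h.two_lt_r
  have hp := h.one_lt_p
  have hr0 : r ≠ 0 := by linarith
  have hp0 : p ≠ 0 := by linarith
  refine max_le ?_ ?_
  · unfold lrFun
    rw [tsum_eq_single i fun j hj => by
      rw [Finsupp.single_eq_of_ne hj, abs_zero, Real.zero_rpow hr0]]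
    simp
  · have hb : ∀ m, blockFun p k m (Finsupp.single i 1) ≤ 1 := by
      intro m
      refine Real.rpow_le_one (by positivity) ?_ (by positivity)
      by_cases hm : ∃ j ∈ Finset.range (k m), (∑ l ∈ Finset.range m, k l) + j = i
      · obtain ⟨j, hj, hji⟩ := hm
        rw [Finset.sum_eq_single_of_mem j hj fun l _ hl => by
          rw [Finsupp.single_eq_of_ne (by omega), abs_zero, Real.zero_rpow hp0]]
        simp [hji]
      · push Not at hm
        rw [Finset.sum_eq_zero fun j hj => by
          rw [Finsupp.single_eq_of_ne (hm j hj), abs_zero, Real.zero_rpow hp0]]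
        exact zero_le_one
    have hz : ∃ m, ∀ l, l ≠ m → blockFun p k l (Finsupp.single i 1) = 0 := by
      by_contra! hcon
      have hex : ∀ l, blockFun p k l (Finsupp.single i 1) ≠ 0 →
          ∃ j, j < k l ∧ (∑ s ∈ Finset.range l, k s) + j = i := by
        intro l hl
        by_contra! hno
        refine hl ?_
        unfold blockFun
        rw [Finset.sum_eq_zero fun j hj => by
          rw [Finsupp.single_eq_of_ne (hno j (Finset.mem_range.1 hj)), abs_zero,
            Real.zero_rpow hp0], Real.zero_rpow (by positivity)]
      obtain ⟨m₁, -, hm₁⟩ := hcon 0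
      obtain ⟨m₂, hne, hm₂⟩ := hcon m₁
      obtain ⟨j₁, hj₁, e₁⟩ := hex _ hm₁
      obtain ⟨j₂, hj₂, e₂⟩ := hex _ hm₂
      have key : ∀ u v, u < v → (∑ s ∈ Finset.range u, k s) + k u ≤ ∑ s ∈ Finset.range v, k s := by
        intro u v huv
        rw [← Finset.sum_range_succ]
        exact Finset.sum_le_sum_of_subset (Finset.range_mono huv)
      rcases lt_or_gt_of_ne hne with hlt | hlt
      · have := key _ _ hlt; omega
      · have := key _ _ hlt; omega
    obtain ⟨m, hm⟩ := hz
    unfold mixedFun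
    rw [tsum_eq_single m fun l hl => by rw [hm l hl, mul_zero, Real.zero_rpow hr0]]
    have h0 : 0 ≤ weight p k m * blockFun p k m (Finsupp.single i 1) :=
      mul_nonneg (weight_nonneg p k m) (blockFun_nonneg p k m _)
    rw [← Real.rpow_mul h0, mul_one_div_cancel hr0, Real.rpow_one]
    exact mul_le_one₀ (h.weight_le_one m) (blockFun_nonneg p k m _) (hb m)

lemma tFun_le (h : Admissible p r k) (a : ℕ →₀ ℝ) :
    tFun p r k a ≤ a.sum fun _ c => |c| := by
  have hzero : tFun p r k 0 = 0 := by
    have := h.tFun_smul 0 0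
    simpa using this
  have hadd : ∀ s : Finset ℕ, ∀ f : ℕ → (ℕ →₀ ℝ),
      tFun p r k (∑ i ∈ s, f i) ≤ ∑ i ∈ s, tFun p r k (f i) := fun s f =>
    Finset.le_sum_of_subadditive (tFun p r k) hzero.le h.tFun_add s f
  calc tFun p r k a = tFun p r k (∑ i ∈ a.support, a i • Finsupp.single i (1 : ℝ)) := by
        congr 1
        conv_lhs => rw [← a.sum_single]
        simp [Finsupp.sum]
    _ ≤ ∑ i ∈ a.support, tFun p r k (a i • Finsupp.single i (1 : ℝ)) := hadd _ _
    _ ≤ ∑ i ∈ a.support, |a i| := by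
        refine Finset.sum_le_sum fun i _ => ?_
        rw [h.tFun_smul, Real.norm_eq_abs]
        exact mul_le_of_le_one_right (abs_nonneg _) (h.tFun_single i)

lemma sym_bddAbove (h : Admissible p r k) (b : ℕ →₀ ℝ) :
    BddAbove (Set.range fun σ : Equiv.Perm ℕ => tFun p r k (b.mapDomain σ)) := by
  refine ⟨b.sum fun _ c => |c|, ?_⟩
  rintro _ ⟨σ, rfl⟩
  refine (h.tFun_le _).trans (le_of_eq ?_)
  exact Finsupp.sum_mapDomain_index_inj σ.injective

end Admissible

/-- The norm of the symmetrized space, as a seminorm on finitely non-zero sequences. -/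
def symNorm {p r : ℝ} {k : ℕ → ℕ} (h : Admissible p r k) : Seminorm ℝ (ℕ →₀ ℝ) :=
  Seminorm.of (symFun p r k)
    (fun a b => ciSup_le fun σ => by
      rw [Finsupp.mapDomain_add]
      exact (h.tFun_add _ _).trans
        (add_le_add (le_ciSup (h.sym_bddAbove a) σ) (le_ciSup (h.sym_bddAbove b) σ)))
    (fun c a => by
      simp only [symFun, Finsupp.mapDomain_smul, h.tFun_smul]
      exact (Real.mul_iSup_of_nonneg (norm_nonneg c) _).symm)

/-- The Banach space `E`. -/
abbrev SymSpace {p r : ℝ} {k : ℕ → ℕ} (h : Admissible p r k) : Type := C00Completion (symNorm h)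

/-- The unit vectors `e_i` of `E`. -/
def symUnit {p r : ℝ} {k : ℕ → ℕ} (h : Admissible p r k) (i : ℕ) : SymSpace h :=
  C00Completion.unit (symNorm h) i

end

open scoped Topology

noncomputable section

/-! ### Weak compactness of operators into the dual of a quasi-reflexive space -/

theorem exists_strictMono_of_not_cauchySeq {X : Type*} [PseudoMetricSpace X] {S : ℕ → X}
    (h : ¬ CauchySeq S) :
    ∃ ε > 0, ∃ l : ℕ → ℕ, StrictMono l ∧ ∀ k, ε ≤ dist (S (l (k + 1))) (S (l k)) := by
  rw [Metric.cauchySeq_iff'] at h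
  push Not at h
  obtain ⟨ε, hε, h⟩ := h
  choose f hf hfd using h
  have hlt : ∀ n, n < f n := fun n => lt_of_le_of_ne (hf n) fun e => by
    have := hfd n
    rw [← e, dist_self] at this
    linarith
  refine ⟨ε, hε, fun k => f^[k] 0, strictMono_nat_of_lt_succ fun k => ?_, fun k => ?_⟩
  · rw [Function.iterate_succ_apply']
    exact hlt _
  · have := hfd (f^[k] 0)
    rwa [← Function.iterate_succ_apply' f k 0] at this

section Dual

variable {X Y : Type*} [NormedAddCommGroup X] [NormedSpace ℝ X]
  [NormedAddCommGroup Y] [NormedSpace ℝ Y]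

/-- If the second adjoint takes its values in `Y`, then the operator is weakly compact. -/
theorem isWeaklyCompactOperator_of_bidual (T : X →L[ℝ] Y)
    (hT : ∀ F : StrongDual ℝ (StrongDual ℝ X), ∃ y : Y, ∀ g : StrongDual ℝ Y,
      F (g.comp T) = g y) : IsWeaklyCompactOperator T := by
  choose Φ hΦ using hT
  let Ψ : WeakDual ℝ (StrongDual ℝ X) → WeakSpace ℝ Y := fun F =>
    toWeakSpace ℝ Y (Φ (WeakDual.toStrongDual F))
  have hΨ : Continuous Ψ := by
    refine WeakBilin.continuous_of_continuous_eval _ fun g => ?_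
    have : (fun F : WeakDual ℝ (StrongDual ℝ X) => (topDualPairing ℝ Y).flip (Ψ F) g) =
        fun F : WeakDual ℝ (StrongDual ℝ X) => F (g.comp T) := by
      funext F
      exact (hΦ (WeakDual.toStrongDual F) g).symm
    rw [this]
    exact WeakDual.eval_continuous _
  have hK := (WeakDual.isCompact_closedBall (𝕜 := ℝ) (E := StrongDual ℝ X) 0 1).image hΨ
  have : T2Space (WeakSpace ℝ Y) :=
    (NormedSpace.isEmbedding_inclusionInDoubleDualWeak ℝ Y).t2Space
  refine hK.closure_of_subset ?_
  rintro _ ⟨_, ⟨x, hx, rfl⟩, rfl⟩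
  refine ⟨StrongDual.toWeakDual (NormedSpace.inclusionInDoubleDual ℝ X x), ?_, ?_⟩
  · have h1 := NormedSpace.double_dual_bound ℝ X x
    simp only [mem_closedBall_zero_iff] at hx
    simpa using h1.trans hx
  · show toWeakSpace ℝ Y _ = _
    congr 1
    refine (NormedSpace.inclusionInDoubleDualLi (𝕜 := ℝ) (E := Y)).injective ?_
    ext g
    exact (hΦ _ g).symm

/-- `X` has codimension at most one in its bidual, with complement spanned by `θ`. -/
def IsQuasiReflexiveWith (θ : StrongDual ℝ (StrongDual ℝ X)) : Prop :=
  ∀ F : StrongDual ℝ (StrongDual ℝ X), ∃ (x : X) (c : ℝ),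
    F = NormedSpace.inclusionInDoubleDual ℝ X x + c • θ

theorem IsQuasiReflexiveWith.isWeaklyCompactOperator {θ : StrongDual ℝ (StrongDual ℝ X)}
    (hθ : IsQuasiReflexiveWith θ) (T : X →L[ℝ] StrongDual ℝ X)
    (h : θ (θ.comp T) = θ (θ.comp T.flip)) : IsWeaklyCompactOperator T := by
  refine isWeaklyCompactOperator_of_bidual T fun F => ?_
  obtain ⟨x, c, rfl⟩ := hθ F
  refine ⟨T x + c • θ.comp T.flip, fun G => ?_⟩
  obtain ⟨z, d, rfl⟩ := hθ G
  have e : (NormedSpace.inclusionInDoubleDual ℝ X z).comp T = T.flip z := by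
    ext y
    simp
  simp only [add_apply, smul_apply, NormedSpace.dual_def, map_add, map_smul,
    ContinuousLinearMap.add_comp, ContinuousLinearMap.smul_comp, e, h, smul_eq_mul]
  simp
  ring

/-- The dual of a quasi-reflexive space is quasi-reflexive. -/
theorem IsQuasiReflexiveWith.dual {θ : StrongDual ℝ (StrongDual ℝ X)}
    (hθ : IsQuasiReflexiveWith θ) (τ : StrongDual ℝ (StrongDual ℝ (StrongDual ℝ X)))
    (hτ : τ θ ≠ θ (τ.comp (NormedSpace.inclusionInDoubleDual ℝ X))) :
    IsQuasiReflexiveWith τ := by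
  intro F
  set J := NormedSpace.inclusionInDoubleDual ℝ X with hJ
  set c : ℝ := (F θ - θ (F.comp J)) / (τ θ - θ (τ.comp J)) with hc
  refine ⟨F.comp J - c • τ.comp J, c, ?_⟩
  ext G
  obtain ⟨z, d, rfl⟩ := hθ G
  have hne : τ θ - θ (τ.comp J) ≠ 0 := sub_ne_zero.2 hτ
  have hmul : c * (τ θ - θ (τ.comp J)) = F θ - θ (F.comp J) := by
    rw [hc]
    field_simp
  have e1 : F (J z + d • θ) = F.comp J z + d * F θ := by simp
  have e2 : τ (J z + d • θ) = τ.comp J z + d * τ θ := by simp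
  have e3 : ∀ g : StrongDual ℝ X, (J z + d • θ) g = g z + d * θ g := fun g => by simp [hJ]
  rw [e1, add_apply, smul_apply, e2, NormedSpace.dual_def, e3, sub_apply, smul_apply, map_sub,
    map_smul, smul_eq_mul, smul_eq_mul, smul_eq_mul]
  linear_combination (-d) * hmul

/-- Along a suitable subsequence a double sequence is close to its two iterated limits. -/
theorem exists_strictMono_near_iterated_limits {B : ℕ → ℕ → ℝ} {a b : ℕ → ℝ} {α β : ℝ}
    (ha : ∀ n, Filter.Tendsto (fun m => B n m) Filter.atTop (𝓝 (a n)))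
    (hb : ∀ m, Filter.Tendsto (fun n => B n m) Filter.atTop (𝓝 (b m)))
    (hα : Filter.Tendsto a Filter.atTop (𝓝 α)) (hβ : Filter.Tendsto b Filter.atTop (𝓝 β))
    {ε : ℝ} (hε : 0 < ε) :
    ∃ n : ℕ → ℕ, StrictMono n ∧ ∀ i j, i < j →
      |B (n i) (n j) - α| ≤ ε ∧ |B (n j) (n i) - β| ≤ ε := by
  have hε2 : 0 < ε / 2 := by positivity
  have key := exists_seq_of_forall_finset_exists
    (fun n : ℕ => |a n - α| < ε / 2 ∧ |b n - β| < ε / 2)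
    (fun n m => n < m ∧ |B n m - a n| < ε / 2 ∧ |B m n - b n| < ε / 2) (by
      intro s _
      have h1 : ∀ᶠ m in Filter.atTop, |a m - α| < ε / 2 := by
        simpa [Real.dist_eq] using Metric.tendsto_nhds.1 hα _ hε2
      have h2 : ∀ᶠ m in Filter.atTop, |b m - β| < ε / 2 := by
        simpa [Real.dist_eq] using Metric.tendsto_nhds.1 hβ _ hε2
      have h3 : ∀ᶠ m in Filter.atTop, ∀ x ∈ s,
          (x < m ∧ |B x m - a x| < ε / 2 ∧ |B m x - b x| < ε / 2) := by
        rw [Filter.eventually_all_finset]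
        intro x _
        have h4 : ∀ᶠ m in Filter.atTop, |B x m - a x| < ε / 2 := by
          simpa [Real.dist_eq] using Metric.tendsto_nhds.1 (ha x) _ hε2
        have h5 : ∀ᶠ m in Filter.atTop, |B m x - b x| < ε / 2 := by
          simpa [Real.dist_eq] using Metric.tendsto_nhds.1 (hb x) _ hε2
        filter_upwards [Filter.eventually_gt_atTop x, h4, h5] with m h6 h7 h8
        exact ⟨h6, h7, h8⟩
      obtain ⟨m, h6, h7, h8⟩ := (h1.and (h2.and h3)).exists
      exact ⟨m, ⟨h6, h7⟩, h8⟩)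
  obtain ⟨n, hn1, hn2⟩ := key
  refine ⟨n, fun i j hij => (hn2 i j hij).1, fun i j hij => ?_⟩
  obtain ⟨-, h1, h2⟩ := hn2 i j hij
  obtain ⟨h3, h4⟩ := hn1 i
  rw [abs_lt] at h1 h2 h3 h4
  constructor <;> rw [abs_le] <;> constructor <;> linarith

/-- Differences along subsequences of `u` have norms growing more slowly than the square root of
the number of summands. -/
def HasSmallDifferences (u : ℕ → X) : Prop :=
  ∀ η > 0, ∃ N : ℕ, 1 ≤ N ∧ ∀ n : ℕ → ℕ, StrictMono n →
    ‖∑ k ∈ Finset.range N, (u (n (2 * k)) - u (n (2 * k + 1)))‖ ^ 2 ≤ η * N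

theorem HasSmallDifferences.iterated_limits_eq {u : ℕ → X} (hu : HasSmallDifferences u)
    (T : X →L[ℝ] StrongDual ℝ X) {a b : ℕ → ℝ} {α β : ℝ}
    (ha : ∀ n, Filter.Tendsto (fun m => T (u n) (u m)) Filter.atTop (𝓝 (a n)))
    (hb : ∀ m, Filter.Tendsto (fun n => T (u n) (u m)) Filter.atTop (𝓝 (b m)))
    (hα : Filter.Tendsto a Filter.atTop (𝓝 α)) (hβ : Filter.Tendsto b Filter.atTop (𝓝 β)) :
    α = β := by
  have hmain : ∀ η > 0, |α - β| ≤ ‖T‖ * η := by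
    intro η hη
    obtain ⟨N, hN, hφ⟩ := hu η hη
    have hN' : (0 : ℝ) < N := by exact_mod_cast hN
    have hb1 : ∀ ε > 0, N * |α - β| ≤ ‖T‖ * (η * N) + ε := by
      intro ε hε
      set δ : ℝ := ε / (4 * N ^ 2) with hδ
      have hδ0 : 0 < δ := by positivity
      obtain ⟨n, hn, hnB⟩ := exists_strictMono_near_iterated_limits
        (B := fun i j => T (u i) (u j)) ha hb hα hβ hδ0
      obtain ⟨x, hx⟩ : ∃ x, x = ∑ k ∈ Finset.range N,
        (u (n (2 * (2 * k))) - u (n (2 * (2 * k + 1)))) := ⟨_, rfl⟩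
      obtain ⟨y, hy⟩ : ∃ y, y = ∑ k ∈ Finset.range N,
        (u (n (2 * (2 * k) + 1)) - u (n (2 * (2 * k + 1) + 1))) := ⟨_, rfl⟩
      have hx2 : ‖x‖ ^ 2 ≤ η * N := by
        rw [hx]
        exact hφ (fun t => n (2 * t)) fun i j h => hn (by omega)
      have hy2 : ‖y‖ ^ 2 ≤ η * N := by
        rw [hy]
        exact hφ (fun t => n (2 * t + 1)) fun i j h => hn (by omega)
      have hxy : ‖x‖ * ‖y‖ ≤ η * N := by nlinarith [sq_nonneg (‖x‖ - ‖y‖)]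
      have hT : |T x y| ≤ ‖T‖ * (η * N) := by
        calc |T x y| ≤ ‖T‖ * ‖x‖ * ‖y‖ := T.le_opNorm₂ x y
          _ ≤ _ := by
            rw [mul_assoc]
            exact mul_le_mul_of_nonneg_left hxy (norm_nonneg T)
      have hD : ∀ i j, |T (u (n (2 * (2 * i))) - u (n (2 * (2 * i + 1))))
          (u (n (2 * (2 * j) + 1)) - u (n (2 * (2 * j + 1) + 1))) -
          (if i = j then α - β else 0)| ≤ 4 * δ := by
        intro i j
        simp only [map_sub, sub_apply]
        rcases lt_trichotomy i j with hij | rfl | hij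
        · rw [if_neg hij.ne]
          have h1 := (hnB (2 * (2 * i)) (2 * (2 * j) + 1) (by omega)).1
          have h2 := (hnB (2 * (2 * i)) (2 * (2 * j + 1) + 1) (by omega)).1
          have h3 := (hnB (2 * (2 * i + 1)) (2 * (2 * j) + 1) (by omega)).1
          have h4 := (hnB (2 * (2 * i + 1)) (2 * (2 * j + 1) + 1) (by omega)).1
          rw [abs_le] at h1 h2 h3 h4 ⊢
          constructor <;> linarith
        · rw [if_pos rfl]
          have h1 := (hnB (2 * (2 * i)) (2 * (2 * i) + 1) (by omega)).1
          have h2 := (hnB (2 * (2 * i)) (2 * (2 * i + 1) + 1) (by omega)).1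
          have h3 := (hnB (2 * (2 * i) + 1) (2 * (2 * i + 1)) (by omega)).2
          have h4 := (hnB (2 * (2 * i + 1)) (2 * (2 * i + 1) + 1) (by omega)).1
          rw [abs_le] at h1 h2 h3 h4 ⊢
          constructor <;> linarith
        · rw [if_neg hij.ne']
          have h1 := (hnB (2 * (2 * j) + 1) (2 * (2 * i)) (by omega)).2
          have h2 := (hnB (2 * (2 * j + 1) + 1) (2 * (2 * i)) (by omega)).2
          have h3 := (hnB (2 * (2 * j) + 1) (2 * (2 * i + 1)) (by omega)).2
          have h4 := (hnB (2 * (2 * j + 1) + 1) (2 * (2 * i + 1)) (by omega)).2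
          rw [abs_le] at h1 h2 h3 h4 ⊢
          constructor <;> linarith
      have hsum : T x y - N * (α - β) = ∑ i ∈ Finset.range N, ∑ j ∈ Finset.range N,
          (T (u (n (2 * (2 * i))) - u (n (2 * (2 * i + 1))))
          (u (n (2 * (2 * j) + 1)) - u (n (2 * (2 * j + 1) + 1))) -
          (if i = j then α - β else 0)) := by
        have hite : ∑ i ∈ Finset.range N, ∑ j ∈ Finset.range N, (if i = j then α - β else 0) =
            N * (α - β) := by
          rw [Finset.sum_congr rfl fun i hi => by rw [Finset.sum_ite_eq, if_pos hi]]
          rw [Finset.sum_const, Finset.card_range, nsmul_eq_mul]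
        rw [← hite, hx, map_sum T, sum_apply, ← Finset.sum_sub_distrib]
        refine Finset.sum_congr rfl fun i _ => ?_
        rw [hy, map_sum, ← Finset.sum_sub_distrib]
      have hle : |T x y - N * (α - β)| ≤ ε := by
        rw [hsum]
        calc _ ≤ ∑ i ∈ Finset.range N, ∑ j ∈ Finset.range N, 4 * δ := by
              refine (Finset.abs_sum_le_sum_abs _ _).trans (Finset.sum_le_sum fun i _ => ?_)
              exact (Finset.abs_sum_le_sum_abs _ _).trans (Finset.sum_le_sum fun j _ => hD i j)
          _ = ε := by
              simp only [Finset.sum_const, Finset.card_range, nsmul_eq_mul, hδ]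
              field_simp
      calc N * |α - β| = |N * (α - β)| := by rw [abs_mul, Nat.abs_cast]
        _ = |T x y - (T x y - N * (α - β))| := by congr 1; ring
        _ ≤ |T x y| + |T x y - N * (α - β)| := abs_sub _ _
        _ ≤ _ := add_le_add hT hle
    have := le_of_forall_pos_le_add hb1
    have h3 : N * |α - β| ≤ N * (‖T‖ * η) := by linarith
    exact le_of_mul_le_mul_left h3 hN'
  by_contra hne
  have hpos : 0 < |α - β| := abs_pos.2 (sub_ne_zero.2 hne)
  have h1 := hmain (|α - β| / (2 * (‖T‖ + 1))) (by positivity)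
  have h2 : ‖T‖ * (|α - β| / (2 * (‖T‖ + 1))) ≤ |α - β| / 2 := by
    rw [mul_div_assoc', div_le_div_iff₀ (by positivity) (by norm_num)]
    nlinarith [norm_nonneg T]
  linarith

theorem propertyW_of_hasSmallDifferences {θ : StrongDual ℝ (StrongDual ℝ X)}
    (hθ : IsQuasiReflexiveWith θ) {u : ℕ → X}
    (hlim : ∀ f : StrongDual ℝ X, Filter.Tendsto (fun n => f (u n)) Filter.atTop (𝓝 (θ f)))
    (hu : HasSmallDifferences u) : PropertyW X := by
  intro T
  refine hθ.isWeaklyCompactOperator T ?_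
  refine (hu.iterated_limits_eq T (a := fun n => θ (T (u n))) (b := fun n => θ (T.flip (u n)))
    (fun n => hlim _) (fun m => ?_) (hlim (θ.comp T)) (hlim (θ.comp T.flip)))
  simpa using hlim (T.flip (u m))

end Dual

/-! ### The symmetric norm on finitely non-zero sequences -/

/-- An `ℓ^r` norm satisfies an upper `p`-estimate for `p ≤ r`. -/
theorem Lr_tsum_upper_estimate {p r : ℝ} (hp : 0 < p) (hpr : p ≤ r) {F G H : ℕ → ℝ}
    (hF : ∀ i, 0 ≤ F i) (hG : ∀ i, 0 ≤ G i) (hH : ∀ i, 0 ≤ H i)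
    (hFG : ∀ i, H i ^ p ≤ F i ^ p + G i ^ p) (sF : Summable fun i => F i ^ r)
    (sG : Summable fun i => G i ^ r) (sH : Summable fun i => H i ^ r) :
    ((∑' i, H i ^ r) ^ (1 / r)) ^ p ≤
      ((∑' i, F i ^ r) ^ (1 / r)) ^ p + ((∑' i, G i ^ r) ^ (1 / r)) ^ p := by
  have hr : 0 < r := hp.trans_le hpr
  have e : ∀ {x : ℝ}, 0 ≤ x → (x ^ p) ^ (r / p) = x ^ r := fun hx => by
    rw [← Real.rpow_mul hx, mul_div_cancel₀ _ hp.ne']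
  have e' : ∀ {K : ℕ → ℝ}, (∀ i, 0 ≤ K i) → ((∑' i, K i ^ r) ^ (1 / r)) ^ p =
      (∑' i, (K i ^ p) ^ (r / p)) ^ (1 / (r / p)) := fun {K} hK => by
    simp_rw [e (hK _)]
    rw [← Real.rpow_mul (tsum_nonneg fun i => Real.rpow_nonneg (hK i) _)]
    congr 1
    field_simp
  have h1 := Real.Lp_add_le_tsum_of_nonneg (p := r / p) (by rw [le_div_iff₀ hp]; linarith)
    (fun i => Real.rpow_nonneg (hF i) p) (fun i => Real.rpow_nonneg (hG i) p)
    (by simpa only [e (hF _)] using sF) (by simpa only [e (hG _)] using sG)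
  rw [e' hF, e' hG, e' hH]
  refine le_trans ?_ h1.2
  refine Real.rpow_le_rpow (tsum_nonneg fun i => by have := hH i; positivity) ?_ (by positivity)
  refine Summable.tsum_le_tsum (fun i => ?_) (by simpa only [e (hH _)] using sH) h1.1
  exact Real.rpow_le_rpow (Real.rpow_nonneg (hH i) _) (hFG i) (by positivity)

/-- The sum of the first `m` unit vectors. -/
def flat (m : ℕ) : ℕ →₀ ℝ := ∑ i ∈ Finset.range m, Finsupp.single i 1

theorem flat_apply (m i : ℕ) : flat m i = if i < m then 1 else 0 := by
  simp [flat, Finsupp.single_apply]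

theorem support_flat (m : ℕ) : (flat m).support = Finset.range m := by
  ext i
  simp [flat_apply]

namespace Admissible

variable {p r : ℝ} {k : ℕ → ℕ} (h : Admissible p r k)
include h

theorem p_pos : 0 < p := by linarith [h.one_lt_p]

theorem r_pos : 0 < r := by linarith [h.two_lt_r]

theorem p_le_r : p ≤ r := by linarith [h.p_lt_two, h.two_lt_r]

omit h in
theorem weight_mul_blockFun_nonneg (a : ℕ →₀ ℝ) (i : ℕ) :
    0 ≤ weight p k i * blockFun p k i a :=
  mul_nonneg (weight_nonneg p k i) (blockFun_nonneg p k i a)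

theorem lrFun_mono {a b : ℕ →₀ ℝ} (hab : ∀ i, |a i| ≤ |b i|) : lrFun r a ≤ lrFun r b := by
  have := h.r_pos
  refine Real.rpow_le_rpow (tsum_nonneg fun _ => by positivity) ?_ (by positivity)
  exact (h.lr_summable a).tsum_le_tsum
    (fun i => Real.rpow_le_rpow (abs_nonneg _) (hab i) this.le) (h.lr_summable b)

theorem blockFun_mono {a b : ℕ →₀ ℝ} (hab : ∀ i, |a i| ≤ |b i|) (i : ℕ) :
    blockFun p k i a ≤ blockFun p k i b := by
  have := h.p_pos
  refine Real.rpow_le_rpow (by positivity) ?_ (by positivity)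
  exact Finset.sum_le_sum fun j _ => Real.rpow_le_rpow (abs_nonneg _) (hab _) this.le

theorem mixedFun_mono {a b : ℕ →₀ ℝ} (hab : ∀ i, |a i| ≤ |b i|) :
    mixedFun p r k a ≤ mixedFun p r k b := by
  have := h.r_pos
  refine Real.rpow_le_rpow
    (tsum_nonneg fun i => Real.rpow_nonneg (weight_mul_blockFun_nonneg a i) _) ?_ (by positivity)
  refine (h.mixed_summable a).tsum_le_tsum (fun i => ?_) (h.mixed_summable b)
  exact Real.rpow_le_rpow (weight_mul_blockFun_nonneg a i)
    (mul_le_mul_of_nonneg_left (h.blockFun_mono hab i) (weight_nonneg p k i)) this.le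

theorem tFun_mono {a b : ℕ →₀ ℝ} (hab : ∀ i, |a i| ≤ |b i|) : tFun p r k a ≤ tFun p r k b :=
  max_le_max (h.lrFun_mono hab) (h.mixedFun_mono hab)

omit h in
theorem lrFun_nonneg (a : ℕ →₀ ℝ) : 0 ≤ lrFun r a := by
  unfold lrFun
  exact Real.rpow_nonneg (tsum_nonneg fun _ => by positivity) _

omit h in
theorem mixedFun_nonneg (a : ℕ →₀ ℝ) : 0 ≤ mixedFun p r k a :=
  Real.rpow_nonneg (tsum_nonneg fun i => Real.rpow_nonneg (weight_mul_blockFun_nonneg a i) _) _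

omit h in
theorem tFun_nonneg (a : ℕ →₀ ℝ) : 0 ≤ tFun p r k a := (lrFun_nonneg a).trans (le_max_left _ _)

theorem tFun_le_symNorm (σ : Equiv.Perm ℕ) (a : ℕ →₀ ℝ) :
    tFun p r k (a.mapDomain σ) ≤ symNorm h a :=
  le_ciSup (h.sym_bddAbove a) σ

theorem symNorm_le {a : ℕ →₀ ℝ} {C : ℝ} (hC : ∀ σ : Equiv.Perm ℕ, tFun p r k (a.mapDomain σ) ≤ C) :
    symNorm h a ≤ C :=
  ciSup_le hC

theorem symNorm_mapDomain (σ : Equiv.Perm ℕ) (a : ℕ →₀ ℝ) :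
    symNorm h (a.mapDomain σ) = symNorm h a := by
  refine le_antisymm (h.symNorm_le fun τ => ?_) (h.symNorm_le fun τ => ?_)
  · rw [← Finsupp.mapDomain_comp]
    exact h.tFun_le_symNorm (σ.trans τ) a
  · have := h.tFun_le_symNorm (σ.symm.trans τ) (a.mapDomain σ)
    rwa [← Finsupp.mapDomain_comp, show (⇑(σ.symm.trans τ) ∘ ⇑σ) = ⇑τ by ext; simp] at this

theorem symNorm_mono {a b : ℕ →₀ ℝ} (hab : ∀ i, |a i| ≤ |b i|) : symNorm h a ≤ symNorm h b :=
  h.symNorm_le fun σ => (h.tFun_mono fun i => by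
    simpa only [Finsupp.mapDomain_equiv_apply] using hab _).trans (h.tFun_le_symNorm σ b)

/-- The norm only depends on the decreasing rearrangement, in a monotone way. -/
theorem symNorm_le_of_injOn {a b : ℕ →₀ ℝ} (f : ℕ → ℕ) (hf : Set.InjOn f a.support)
    (hab : ∀ i ∈ a.support, |a i| ≤ |b (f i)|) : symNorm h a ≤ symNorm h b := by
  obtain ⟨σ, hσ⟩ := Equiv.Perm.exists_extending_pair (fun x : a.support => (x : ℕ))
    (fun x : a.support => f x) Subtype.val_injective
    (fun x y hxy => Subtype.ext (hf x.2 y.2 hxy))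
  rw [← h.symNorm_mapDomain σ a]
  refine h.symNorm_mono fun i => ?_
  rw [Finsupp.mapDomain_equiv_apply]
  by_cases hi : σ.symm i ∈ a.support
  · have h1 := hσ ⟨_, hi⟩
    simp only [Equiv.apply_symm_apply] at h1
    have := hab _ hi
    rwa [← h1] at this
  · rw [Finsupp.notMem_support_iff.1 hi, abs_zero]
    exact abs_nonneg _

theorem symNorm_mapDomain_of_injective (f : ℕ → ℕ) (hf : Function.Injective f) (a : ℕ →₀ ℝ) :
    symNorm h (a.mapDomain f) = symNorm h a := by
  refine le_antisymm ?_ (h.symNorm_le_of_injOn f hf.injOn fun i _ => by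
    rw [Finsupp.mapDomain_apply hf])
  refine h.symNorm_le_of_injOn (Function.invFun f) ?_ ?_
  · rintro x hx y hy hxy
    have hs := Finsupp.mapDomain_support (f := f) (s := a)
    obtain ⟨x', -, rfl⟩ := Finset.mem_image.1 (hs hx)
    obtain ⟨y', -, rfl⟩ := Finset.mem_image.1 (hs hy)
    rw [Function.leftInverse_invFun hf, Function.leftInverse_invFun hf] at hxy
    rw [hxy]
  · intro x hx
    obtain ⟨x', -, rfl⟩ := Finset.mem_image.1 (Finsupp.mapDomain_support hx)
    rw [Function.leftInverse_invFun hf, Finsupp.mapDomain_apply hf]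

theorem tFun_le_symNorm_self (a : ℕ →₀ ℝ) : tFun p r k a ≤ symNorm h a := by
  simpa using h.tFun_le_symNorm (Equiv.refl ℕ) a

theorem lrFun_rpow (a : ℕ →₀ ℝ) : lrFun r a ^ r = ∑' i, |a i| ^ r := by
  rw [lrFun, ← Real.rpow_mul (tsum_nonneg fun _ => by positivity), one_div_mul_cancel h.r_pos.ne',
    Real.rpow_one]

theorem mixedFun_rpow (a : ℕ →₀ ℝ) :
    mixedFun p r k a ^ r = ∑' i, (weight p k i * blockFun p k i a) ^ r := by
  rw [mixedFun, ← Real.rpow_mul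
    (tsum_nonneg fun i => Real.rpow_nonneg (weight_mul_blockFun_nonneg a i) _),
    one_div_mul_cancel h.r_pos.ne', Real.rpow_one]

theorem lrFun_le_symNorm (a : ℕ →₀ ℝ) : lrFun r a ≤ symNorm h a :=
  (le_max_left _ _).trans (h.tFun_le_symNorm_self a)

theorem abs_apply_le_lrFun (a : ℕ →₀ ℝ) (i : ℕ) : |a i| ≤ lrFun r a := by
  rw [← Real.rpow_le_rpow_iff (abs_nonneg _) (lrFun_nonneg a) h.r_pos, h.lrFun_rpow]
  exact (h.lr_summable a).le_tsum i fun _ _ => by positivity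

theorem abs_apply_le_symNorm (a : ℕ →₀ ℝ) (i : ℕ) : |a i| ≤ symNorm h a :=
  (h.abs_apply_le_lrFun a i).trans (h.lrFun_le_symNorm a)

theorem weight_mul_blockFun_le_symNorm (a : ℕ →₀ ℝ) (i : ℕ) :
    weight p k i * blockFun p k i a ≤ symNorm h a := by
  refine le_trans ?_ ((le_max_right _ _).trans (h.tFun_le_symNorm_self a))
  rw [← Real.rpow_le_rpow_iff (weight_mul_blockFun_nonneg a i) (mixedFun_nonneg a) h.r_pos,
    h.mixedFun_rpow]
  exact (h.mixed_summable a).le_tsum i fun j _ =>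
    Real.rpow_nonneg (weight_mul_blockFun_nonneg a j) _

theorem symNorm_single (i : ℕ) (c : ℝ) : symNorm h (Finsupp.single i c) = |c| := by
  have h1 : symNorm h (Finsupp.single i 1) = 1 := by
    refine le_antisymm (h.symNorm_le fun σ => ?_) ?_
    · rw [Finsupp.mapDomain_single]
      exact h.tFun_single _
    · simpa using h.abs_apply_le_symNorm (Finsupp.single i 1) i
  have : Finsupp.single i c = c • Finsupp.single i (1 : ℝ) := by simp
  rw [this, map_smul_eq_mul, h1, mul_one, Real.norm_eq_abs]

theorem blockFun_rpow (a : ℕ →₀ ℝ) (i : ℕ) : blockFun p k i a ^ p =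
    ∑ j ∈ Finset.range (k i), |a ((∑ m ∈ Finset.range i, k m) + j)| ^ p := by
  rw [blockFun, ← Real.rpow_mul (by positivity), one_div_mul_cancel h.p_pos.ne', Real.rpow_one]

theorem tFun_add_rpow_le {a b : ℕ →₀ ℝ} (hab : ∀ i, a i = 0 ∨ b i = 0) :
    tFun p r k (a + b) ^ p ≤ tFun p r k a ^ p + tFun p r k b ^ p := by
  have hp := h.p_pos
  have hpt : ∀ i, |(a + b) i| ^ p = |a i| ^ p + |b i| ^ p := fun i => by
    rcases hab i with h0 | h0 <;> simp [h0, Real.zero_rpow hp.ne']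
  have h1 : lrFun r (a + b) ^ p ≤ lrFun r a ^ p + lrFun r b ^ p :=
    Lr_tsum_upper_estimate hp h.p_le_r (fun i => abs_nonneg _) (fun i => abs_nonneg _)
      (fun i => abs_nonneg _) (fun i => (hpt i).le) (h.lr_summable a) (h.lr_summable b)
      (h.lr_summable (a + b))
  have h2 : mixedFun p r k (a + b) ^ p ≤ mixedFun p r k a ^ p + mixedFun p r k b ^ p := by
    refine Lr_tsum_upper_estimate hp h.p_le_r (weight_mul_blockFun_nonneg a)
      (weight_mul_blockFun_nonneg b) (weight_mul_blockFun_nonneg (a + b)) (fun i => ?_)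
      (h.mixed_summable a) (h.mixed_summable b) (h.mixed_summable (a + b))
    simp only [Real.mul_rpow (weight_nonneg p k i) (blockFun_nonneg p k i _), h.blockFun_rpow, hpt]
    rw [Finset.sum_add_distrib, mul_add]
  have m : ∀ c : ℕ →₀ ℝ, lrFun r c ^ p ≤ tFun p r k c ^ p ∧ mixedFun p r k c ^ p ≤ tFun p r k c ^ p :=
    fun c => ⟨Real.rpow_le_rpow (lrFun_nonneg c) (le_max_left _ _) hp.le,
      Real.rpow_le_rpow (mixedFun_nonneg c) (le_max_right _ _) hp.le⟩
  rcases max_choice (lrFun r (a + b)) (mixedFun p r k (a + b)) with h3 | h3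
  · rw [tFun, h3]
    exact h1.trans (add_le_add (m a).1 (m b).1)
  · rw [tFun, h3]
    exact h2.trans (add_le_add (m a).2 (m b).2)

theorem symNorm_add_rpow_le {a b : ℕ →₀ ℝ} (hab : ∀ i, a i = 0 ∨ b i = 0) :
    symNorm h (a + b) ^ p ≤ symNorm h a ^ p + symNorm h b ^ p := by
  have hp := h.p_pos
  have h0 : 0 ≤ symNorm h a ^ p + symNorm h b ^ p :=
    add_nonneg (Real.rpow_nonneg (apply_nonneg _ _) _) (Real.rpow_nonneg (apply_nonneg _ _) _)
  rw [← Real.le_rpow_inv_iff_of_pos (apply_nonneg _ _) h0 hp]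
  refine h.symNorm_le fun σ => ?_
  rw [Real.le_rpow_inv_iff_of_pos (tFun_nonneg _) h0 hp, Finsupp.mapDomain_add]
  refine (h.tFun_add_rpow_le fun i => ?_).trans (add_le_add
    (Real.rpow_le_rpow (tFun_nonneg _) (h.tFun_le_symNorm σ a) hp.le)
    (Real.rpow_le_rpow (tFun_nonneg _) (h.tFun_le_symNorm σ b) hp.le))
  simpa only [Finsupp.mapDomain_equiv_apply] using hab _

/-- The upper `p`-estimate for finitely non-zero sequences. -/
theorem symNorm_sum_rpow_le {ι : Type*} (s : Finset ι) (w : ι → ℕ →₀ ℝ)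
    (hw : ∀ i ∈ s, ∀ j ∈ s, i ≠ j → ∀ m, w i m = 0 ∨ w j m = 0) :
    symNorm h (∑ i ∈ s, w i) ^ p ≤ ∑ i ∈ s, symNorm h (w i) ^ p := by
  classical
  induction s using Finset.induction_on with
  | empty => simp [Real.zero_rpow h.p_pos.ne']
  | insert i s hi ih =>
    rw [Finset.sum_insert hi, Finset.sum_insert hi]
    refine (h.symNorm_add_rpow_le fun m => ?_).trans (add_le_add le_rfl (ih fun a ha b hb =>
      hw a (Finset.mem_insert_of_mem ha) b (Finset.mem_insert_of_mem hb)))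
    by_cases h0 : w i m = 0
    · exact Or.inl h0
    · right
      rw [Finsupp.finsetSum_apply]
      refine Finset.sum_eq_zero fun j hj => ?_
      exact (hw i (Finset.mem_insert_self _ _) j (Finset.mem_insert_of_mem hj)
        (fun e => hi (e ▸ hj)) m).resolve_left h0

theorem symNorm_sum_le_rpow {ι : Type*} (s : Finset ι) (w : ι → ℕ →₀ ℝ)
    (hw : ∀ i ∈ s, ∀ j ∈ s, i ≠ j → ∀ m, w i m = 0 ∨ w j m = 0) {C : ℝ} (hC : 0 ≤ C)
    (hwC : ∀ i ∈ s, symNorm h (w i) ≤ C) :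
    symNorm h (∑ i ∈ s, w i) ≤ C * (s.card : ℝ) ^ (1 / p) := by
  have hp := h.p_pos
  have h1 : symNorm h (∑ i ∈ s, w i) ^ p ≤ (s.card : ℝ) * C ^ p := by
    refine (h.symNorm_sum_rpow_le s w hw).trans ?_
    rw [← nsmul_eq_mul]
    exact Finset.sum_le_card_nsmul _ _ _ fun i hi =>
      Real.rpow_le_rpow (apply_nonneg _ _) (hwC i hi) hp.le
  rw [← Real.rpow_le_rpow_iff (apply_nonneg _ _) (by positivity) hp]
  refine h1.trans (le_of_eq ?_)
  rw [Real.mul_rpow hC (by positivity), ← Real.rpow_mul (by positivity), one_div_mul_cancel hp.ne',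
    Real.rpow_one, mul_comm]

/-! #### Flat vectors -/

theorem symNorm_le_flat {a : ℕ →₀ ℝ} {m : ℕ} (ha : ∀ i, |a i| ≤ 1) (hm : a.support.card ≤ m) :
    symNorm h a ≤ symNorm h (flat m) := by
  classical
  refine h.symNorm_le_of_injOn
    (fun i => if hi : i ∈ a.support then (a.support.equivFin ⟨i, hi⟩ : ℕ) else 0) ?_ ?_
  · intro x hx y hy hxy
    rw [Finset.mem_coe] at hx hy
    simp only [dif_pos hx, dif_pos hy] at hxy
    simpa using a.support.equivFin.injective (Fin.ext hxy)
  · intro i hi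
    rw [dif_pos hi, flat_apply, if_pos ((a.support.equivFin ⟨i, hi⟩).2.trans_le hm)]
    simpa using ha i

theorem symNorm_flat_pos {m : ℕ} (hm : 1 ≤ m) : 0 < symNorm h (flat m) := by
  have := h.abs_apply_le_symNorm (flat m) 0
  rw [flat_apply, if_pos (by omega)] at this
  exact lt_of_lt_of_le (by norm_num) this

/-- Averaging over cyclic permutations. -/
theorem sum_abs_mul_symNorm_flat_le (A : Finset ℕ) (c : ℕ →₀ ℝ) :
    (∑ i ∈ A, |c i|) * symNorm h (flat A.card) ≤ A.card * symNorm h c := by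
  classical
  rcases A.eq_empty_or_nonempty with rfl | hA
  · simp
  obtain ⟨m, hm⟩ : ∃ m, A.card = m + 1 := Nat.exists_eq_succ_of_ne_zero hA.card_pos.ne'
  let g : Fin (m + 1) ≃ A := (A.equivFinOfCardEq hm).symm
  let b : Fin (m + 1) → (ℕ →₀ ℝ) := fun t =>
    ∑ i : Fin (m + 1), Finsupp.single (i : ℕ) |c (g (i + t))|
  have hb : ∀ t (j : Fin (m + 1)), b t j = |c (g (j + t))| := by
    intro t j
    simp only [b, Finsupp.finsetSum_apply, Finsupp.single_apply, Fin.val_inj]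
    simp
  have hb0 : ∀ t j, m + 1 ≤ j → b t j = 0 := by
    intro t j hj
    simp only [b, Finsupp.finsetSum_apply]
    exact Finset.sum_eq_zero fun i _ => Finsupp.single_eq_of_ne (by omega)
  have hlt : ∀ t j, j ∈ (b t).support → j < m + 1 := fun t j hj => by
    by_contra hcon
    exact Finsupp.mem_support_iff.1 hj (hb0 t j (by omega))
  have h1 : ∀ t, symNorm h (b t) ≤ symNorm h c := by
    intro t
    refine h.symNorm_le_of_injOn (fun j => g (Fin.ofNat (m + 1) j + t)) ?_ ?_
    · intro x hx y hy hxy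
      have hx := hlt t x hx
      have hy := hlt t y hy
      have e := add_right_cancel (g.injective (Subtype.ext hxy))
      have := congrArg Fin.val e
      simpa [Fin.ofNat, Nat.mod_eq_of_lt hx, Nat.mod_eq_of_lt hy] using this
    · intro j hj
      have hj := hlt t j hj
      have e : ((Fin.ofNat (m + 1) j : Fin (m + 1)) : ℕ) = j := by
        simp [Fin.ofNat, Nat.mod_eq_of_lt hj]
      conv_lhs => rw [← e]
      rw [hb, abs_abs]
  have h2 : ∑ t, b t = (∑ i ∈ A, |c i|) • flat A.card := by
    ext j
    rw [Finsupp.finsetSum_apply, Finsupp.smul_apply, flat_apply, hm]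
    split_ifs with hj
    · rw [smul_eq_mul, mul_one]
      have : ∀ t, b t j = |c (g (⟨j, hj⟩ + t))| := fun t => hb t ⟨j, hj⟩
      simp_rw [this]
      rw [← Finset.sum_coe_sort A, ← Equiv.sum_comp g]
      exact Equiv.sum_comp (Equiv.addLeft (⟨j, hj⟩ : Fin (m + 1))) fun x => |c (g x)|
    · rw [smul_zero]
      exact Finset.sum_eq_zero fun t _ => hb0 t j (by omega)
  have h3 : symNorm h (∑ t, b t) ≤ ∑ t, symNorm h (b t) :=
    Finset.le_sum_of_subadditive (symNorm h) (map_zero _).le (map_add_le_add _) _ _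
  rw [h2, map_smul_eq_mul, Real.norm_of_nonneg (Finset.sum_nonneg fun _ _ => abs_nonneg _)] at h3
  refine h3.trans ((Finset.sum_le_card_nsmul _ _ _ fun t _ => h1 t).trans (le_of_eq ?_))
  rw [nsmul_eq_mul, Finset.card_univ, Fintype.card_fin, hm]

theorem cast_k_pos (n : ℕ) : (0 : ℝ) < k n := by exact_mod_cast h.one_le_k n

theorem conj_exponent_sub : (1 / p.conjExponent - 1 / p) / 2 = 1 / 2 - 1 / p := by
  have hp := h.one_lt_p
  have : p - 1 ≠ 0 := by linarith
  unfold Real.conjExponent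
  field_simp
  ring

theorem sqrt_le_symNorm_flat (n : ℕ) : √((n + 1) * k n) ≤ symNorm h (flat (k n)) := by
  classical
  have hp := h.p_pos
  have hk := h.cast_k_pos n
  set b : ℕ →₀ ℝ := ∑ j ∈ Finset.range (k n),
    Finsupp.single ((∑ m ∈ Finset.range n, k m) + j) (1 : ℝ) with hb
  have hb1 : ∀ j < k n, b ((∑ m ∈ Finset.range n, k m) + j) = 1 := by
    intro j hj
    simp [hb, Finsupp.single_apply, hj]
  have hsup : b.support ⊆ (Finset.range (k n)).image fun j => (∑ m ∈ Finset.range n, k m) + j := by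
    intro i hi
    by_contra hcon
    refine Finsupp.mem_support_iff.1 hi ?_
    rw [hb, Finsupp.finsetSum_apply]
    exact Finset.sum_eq_zero fun j hj => Finsupp.single_eq_of_ne fun e =>
      hcon (Finset.mem_image.2 ⟨j, hj, e.symm⟩)
  have h1 : symNorm h b ≤ symNorm h (flat (k n)) := by
    refine h.symNorm_le_flat (fun i => ?_) ?_
    · by_cases hi : i ∈ b.support
      · obtain ⟨j, hj, rfl⟩ := Finset.mem_image.1 (hsup hi)
        rw [hb1 j (Finset.mem_range.1 hj)]
        simp
      · rw [Finsupp.notMem_support_iff.1 hi]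
        simp
    · exact (Finset.card_le_card hsup).trans (Finset.card_image_le.trans (by simp))
  refine le_trans (le_of_eq ?_) ((h.weight_mul_blockFun_le_symNorm b n).trans h1)
  have h2 : blockFun p k n b = (k n : ℝ) ^ (1 / p) := by
    rw [blockFun, Finset.sum_congr rfl fun j hj => by
      rw [hb1 j (Finset.mem_range.1 hj), abs_one, Real.one_rpow]]
    simp
  rw [h2, weight, h.conj_exponent_sub, mul_assoc, ← Real.rpow_add hk,
    Real.sqrt_mul (by positivity), sub_add_cancel, ← Real.sqrt_eq_rpow]

theorem weight_succ_rpow_le (n : ℕ) : weight p k (n + 1) ^ r ≤ weight p k n ^ r / 2 := by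
  have hk := h.cast_k_pos n
  have hk' := h.cast_k_pos (n + 1)
  have e : ∀ n : ℕ, weight p k n ^ r = ((n : ℝ) + 1) ^ (r / 2) *
      (k n : ℝ) ^ (-((1 / p - 1 / p.conjExponent) * r / 2)) := fun n => by
    rw [weight, Real.mul_rpow (by positivity) (by positivity), Real.sqrt_eq_rpow,
      ← Real.rpow_mul (by positivity), ← Real.rpow_mul (by positivity)]
    congr 2 <;> ring
  have h1 := h.ratio n
  rw [e, e]
  rw [Real.div_rpow (by positivity) (by positivity), Real.div_rpow hk.le hk'.le] at h1
  rw [Real.rpow_neg hk.le, Real.rpow_neg hk'.le]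
  push_cast
  rw [show (n : ℝ) + 1 + 1 = n + 2 by ring]
  have hA : 0 < (k n : ℝ) ^ ((1 / p - 1 / p.conjExponent) * r / 2) := by positivity
  have hB : 0 < (k (n + 1) : ℝ) ^ ((1 / p - 1 / p.conjExponent) * r / 2) := by positivity
  have hC : 0 < ((n : ℝ) + 1) ^ (r / 2) := by positivity
  rw [div_mul_div_comm, div_le_div_iff₀ (by positivity) (by norm_num)] at h1
  rw [← div_eq_mul_inv, ← div_eq_mul_inv, div_div, div_le_div_iff₀ (by positivity) (by positivity)]
  linarith

theorem weight_add_rpow_le (N i : ℕ) :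
    weight p k (N + i) ^ r ≤ weight p k N ^ r * (1 / 2) ^ i := by
  induction i with
  | zero => simp
  | succ i ih =>
    rw [pow_succ, ← add_assoc]
    linarith [h.weight_succ_rpow_le (N + i)]

theorem symNorm_flat_rpow_le (m N : ℕ) : symNorm h (flat m) ^ r ≤ max (m : ℝ)
    (∑ i ∈ Finset.range N, ((i : ℝ) + 1) ^ (r / 2) * (k i : ℝ) ^ (r / 2) +
      2 * weight p k N ^ r * (m : ℝ) ^ (r / p)) := by
  have hp := h.p_pos
  have hr := h.r_pos
  set M := max (m : ℝ) (∑ i ∈ Finset.range N, ((i : ℝ) + 1) ^ (r / 2) * (k i : ℝ) ^ (r / 2) +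
      2 * weight p k N ^ r * (m : ℝ) ^ (r / p)) with hM
  have hM0 : 0 ≤ M := le_max_of_le_left (by positivity)
  rw [← Real.le_rpow_inv_iff_of_pos (apply_nonneg _ _) hM0 hr]
  refine h.symNorm_le fun σ => ?_
  set a := (flat m).mapDomain σ with ha
  have ha01 : ∀ i, a i = 0 ∨ a i = 1 := fun i => by
    rw [ha, Finsupp.mapDomain_equiv_apply, flat_apply]
    split_ifs <;> simp
  have hcard : a.support.card ≤ m := by
    refine (Finset.card_le_card Finsupp.mapDomain_support).trans (Finset.card_image_le.trans ?_)
    rw [support_flat, Finset.card_range]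
  have hle1 : ∀ i, |a i| ≤ 1 := fun i => by rcases ha01 i with e | e <;> simp [e]
  have hsum : ∀ (q : ℝ), 0 < q → ∀ s : Finset ℕ, ∑ i ∈ s, |a i| ^ q ≤ m := by
    intro q hq s
    calc ∑ i ∈ s, |a i| ^ q ≤ ∑ i ∈ s, if i ∈ a.support then (1 : ℝ) else 0 := by
          refine Finset.sum_le_sum fun i _ => ?_
          split_ifs with hi
          · exact Real.rpow_le_one (abs_nonneg _) (hle1 i) hq.le
          · rw [Finsupp.notMem_support_iff.1 hi, abs_zero, Real.zero_rpow hq.ne']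
      _ = ((s.filter (· ∈ a.support)).card : ℝ) := by
          rw [← Finset.sum_filter, Finset.sum_const, nsmul_eq_mul, mul_one]
      _ ≤ m := by
          have h1 : s.filter (· ∈ a.support) ⊆ a.support := fun i hi => (Finset.mem_filter.1 hi).2
          exact_mod_cast (Finset.card_le_card h1).trans hcard
  have hblock1 : ∀ i, blockFun p k i a ≤ (k i : ℝ) ^ (1 / p) := by
    intro i
    refine Real.rpow_le_rpow (by positivity) ?_ (by positivity)
    calc _ ≤ ∑ j ∈ Finset.range (k i), (1 : ℝ) :=
          Finset.sum_le_sum fun j _ => Real.rpow_le_one (abs_nonneg _) (hle1 _) hp.le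
      _ = k i := by simp
  have hblock2 : ∀ i, blockFun p k i a ≤ (m : ℝ) ^ (1 / p) := by
    intro i
    refine Real.rpow_le_rpow (by positivity) ?_ (by positivity)
    have := hsum p hp ((Finset.range (k i)).image fun j => (∑ m ∈ Finset.range i, k m) + j)
    rwa [Finset.sum_image fun x _ y _ hxy => by simpa using hxy] at this
  rw [tFun]
  refine max_le ?_ ?_
  · rw [Real.le_rpow_inv_iff_of_pos (lrFun_nonneg _) hM0 hr, h.lrFun_rpow]
    refine le_max_of_le_left ?_
    exact (h.lr_summable a).tsum_le_of_sum_le fun s => hsum r hr s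
  · rw [Real.le_rpow_inv_iff_of_pos (mixedFun_nonneg _) hM0 hr, h.mixedFun_rpow]
    refine le_max_of_le_right ?_
    rw [← (h.mixed_summable a).sum_add_tsum_nat_add N]
    refine add_le_add (Finset.sum_le_sum fun i _ => ?_) ?_
    · have hk := h.cast_k_pos i
      calc _ ≤ (weight p k i * (k i : ℝ) ^ (1 / p)) ^ r :=
            Real.rpow_le_rpow (weight_mul_blockFun_nonneg a i)
              (mul_le_mul_of_nonneg_left (hblock1 i) (weight_nonneg p k i)) hr.le
        _ = _ := by
            rw [weight, h.conj_exponent_sub, mul_assoc, ← Real.rpow_add hk, sub_add_cancel,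
              Real.mul_rpow (by positivity) (by positivity), Real.sqrt_eq_rpow,
              ← Real.rpow_mul (by positivity), ← Real.rpow_mul (by positivity), one_div_mul_eq_div]
    · have hgeom : Summable fun i : ℕ => weight p k N ^ r * (m : ℝ) ^ (r / p) * (1 / 2 : ℝ) ^ i :=
        summable_geometric_two.mul_left _
      calc _ ≤ ∑' i : ℕ, weight p k N ^ r * (m : ℝ) ^ (r / p) * (1 / 2 : ℝ) ^ i := by
            refine Summable.tsum_le_tsum (fun i => ?_)
              ((summable_nat_add_iff N).2 (h.mixed_summable a)) hgeom
            rw [Real.mul_rpow (weight_nonneg p k _) (blockFun_nonneg p k _ _), mul_right_comm]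
            refine mul_le_mul ?_ ?_ (Real.rpow_nonneg (blockFun_nonneg p k _ _) _) ?_
            · rw [add_comm]
              exact h.weight_add_rpow_le N i
            · have := Real.rpow_le_rpow (blockFun_nonneg p k _ _) (hblock2 (i + N)) hr.le
              rwa [← Real.rpow_mul (by positivity), one_div_mul_eq_div] at this
            · exact mul_nonneg (Real.rpow_nonneg (weight_nonneg p k _) _) (by positivity)
        _ = _ := by
            rw [tsum_mul_left, tsum_geometric_two]
            ring

theorem weight_rpow (N : ℕ) : weight p k N ^ r =
    ((k N : ℝ) ^ (1 - p / 2) / ((N : ℝ) + 1) ^ (p / 2)) ^ (-(r / p)) := by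
  have hk := h.cast_k_pos N
  have hp := h.p_pos
  rw [weight, h.conj_exponent_sub, Real.mul_rpow (by positivity) (by positivity),
    Real.sqrt_eq_rpow, Real.div_rpow (by positivity) (by positivity),
    ← Real.rpow_mul (by positivity), ← Real.rpow_mul (by positivity),
    ← Real.rpow_mul (by positivity), ← Real.rpow_mul (by positivity),
    div_eq_mul_inv ((k N : ℝ) ^ _), ← Real.rpow_neg (by positivity), mul_comm]
  congr 2
  · field_simp
    ring
  · field_simp

theorem growth_lower (n : ℕ) :
    1 + 2 * (n : ℝ) ≤ (k n : ℝ) ^ (1 - p / 2) / ((n : ℝ) + 1) ^ (p / 2) := by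
  refine le_trans ?_ (h.growth n)
  have : ∑ i ∈ Finset.range n, (1 : ℝ) ≤
      ∑ i ∈ Finset.range n, ((i : ℝ) + 1) ^ (r / 2) * (k i : ℝ) ^ (r / 2) := by
    refine Finset.sum_le_sum fun i _ => ?_
    have hr : 0 ≤ r / 2 := by linarith [h.r_pos]
    have h1 : (1 : ℝ) ≤ k i := by exact_mod_cast h.one_le_k i
    exact one_le_mul_of_one_le_of_one_le (Real.one_le_rpow (by linarith [Nat.cast_nonneg (α := ℝ) i]) hr)
      (Real.one_le_rpow h1 hr)
  simp only [Finset.sum_const, Finset.card_range, nsmul_eq_mul, mul_one] at this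
  linarith

theorem exists_symNorm_flat_rpow_le {κ : ℝ} (hκ : 0 < κ) :
    ∃ m : ℕ, 1 ≤ m ∧ symNorm h (flat m) ^ r ≤ κ * (m : ℝ) ^ (r * (1 - 1 / p)) := by
  have hp := h.p_pos
  have hp1 := h.one_lt_p
  have hp2 := h.p_lt_two
  have hr := h.r_pos
  have hr2 := h.two_lt_r
  have hq : 1 < r * (1 - 1 / p) := by
    have h1 := h.conj_lt
    unfold Real.conjExponent at h1
    rw [div_lt_iff₀ (by linarith)] at h1
    rw [show r * (1 - 1 / p) = (r * p - r) / p by field_simp, lt_div_iff₀ hp]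
    nlinarith
  set q := r * (1 - 1 / p) with hqdef
  obtain ⟨L, hL1, hL⟩ : ∃ L : ℝ, 1 ≤ L ∧ 2 * L ^ (-(r / p)) ≤ κ / 2 := by
    have h1 := (tendsto_rpow_neg_atTop (show 0 < r / p by positivity)).eventually
      (ge_mem_nhds (show (0 : ℝ) < κ / 4 by positivity))
    obtain ⟨L, h2, h3⟩ := (h1.and (Filter.eventually_ge_atTop 1)).exists
    exact ⟨L, h3, by linarith⟩
  obtain ⟨m₀, hm₀⟩ : ∃ m₀ : ℝ, ∀ x, m₀ ≤ x → L ≤ κ / 2 * x ^ (q - 1) := by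
    have h1 := (tendsto_rpow_atTop (show 0 < q - 1 by linarith)).eventually_ge_atTop (2 * L / κ)
    obtain ⟨m₀, hm₀⟩ := Filter.eventually_atTop.1 h1
    refine ⟨m₀, fun x hx => ?_⟩
    have := hm₀ x hx
    rw [div_le_iff₀ hκ] at this
    linarith
  obtain ⟨M, hM⟩ := exists_nat_ge (max 1 m₀)
  have hM1 : (1 : ℝ) ≤ M := (le_max_left _ _).trans hM
  obtain ⟨N, hN⟩ := exists_nat_ge (L * (M : ℝ) ^ (2 - p))
  obtain ⟨D, hD⟩ : ∃ D, D = (k N : ℝ) ^ (1 - p / 2) / ((N : ℝ) + 1) ^ (p / 2) := ⟨_, rfl⟩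
  have hDN := h.growth_lower N
  have hgr := h.growth N
  rw [← hD] at hDN hgr
  have hDM : L * (M : ℝ) ^ (2 - p) ≤ D := by linarith [Nat.cast_nonneg (α := ℝ) N]
  have hL0 : 0 < L := by linarith
  have hD0 : 0 < D := lt_of_lt_of_le (by positivity) hDM
  have h2p : 0 < 2 - p := by linarith
  set x := (D / L) ^ (1 / (2 - p)) with hx
  have hx0 : 0 ≤ x := by positivity
  have hxp : x ^ (2 - p) = D / L := by
    rw [hx, ← Real.rpow_mul (by positivity), one_div_mul_cancel h2p.ne', Real.rpow_one]
  have hMx : (M : ℝ) ≤ x := by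
    rw [← Real.rpow_le_rpow_iff (by positivity) hx0 h2p, hxp, le_div_iff₀ hL0]
    linarith
  refine ⟨⌊x⌋₊, ?_, ?_⟩
  · have := Nat.le_floor hMx
    have : 1 ≤ M := by exact_mod_cast hM1
    omega
  have hMm : (M : ℝ) ≤ (⌊x⌋₊ : ℝ) := by exact_mod_cast Nat.le_floor hMx
  have hmx : (⌊x⌋₊ : ℝ) ≤ x := Nat.floor_le hx0
  have hxm : x < (⌊x⌋₊ : ℝ) + 1 := Nat.lt_floor_add_one x
  set m : ℕ := ⌊x⌋₊ with hm
  have hm1 : (1 : ℝ) ≤ m := hM1.trans hMm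
  have hm0 : (0 : ℝ) < m := by linarith
  have hDm : D ≤ 2 * L * m := by
    have h1 : D / L ≤ 2 * m := by
      rw [← hxp]
      calc x ^ (2 - p) ≤ (2 * (m : ℝ)) ^ (2 - p) :=
            Real.rpow_le_rpow hx0 (by linarith) h2p.le
        _ ≤ (2 * (m : ℝ)) ^ (1 : ℝ) := Real.rpow_le_rpow_of_exponent_le (by linarith) (by linarith)
        _ = _ := Real.rpow_one _
    rw [div_le_iff₀ hL0] at h1
    linarith
  have hLm : L * m ≤ κ / 2 * (m : ℝ) ^ q := by
    have h1 := hm₀ m ((le_max_right _ _).trans (hM.trans hMm))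
    calc L * m ≤ κ / 2 * (m : ℝ) ^ (q - 1) * m := mul_le_mul_of_nonneg_right h1 hm0.le
      _ = _ := by rw [Real.rpow_sub_one hm0.ne']; field_simp
  have hmL : L * (m : ℝ) ^ (2 - p) ≤ D := by
    have h1 := Real.rpow_le_rpow hm0.le hmx h2p.le
    rw [hxp, le_div_iff₀ hL0] at h1
    linarith
  have hlast : 2 * weight p k N ^ r * (m : ℝ) ^ (r / p) ≤ κ / 2 * (m : ℝ) ^ q := by
    have h1 : D ^ (-(r / p)) ≤ L ^ (-(r / p)) * (m : ℝ) ^ (q - r / p) := by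
      have h2 := Real.rpow_le_rpow_of_nonpos (by positivity) hmL
        (show -(r / p) ≤ 0 by have : 0 < r / p := by positivity
                              linarith)
      rw [Real.mul_rpow hL0.le (by positivity), ← Real.rpow_mul hm0.le] at h2
      convert h2 using 3
      rw [hqdef]
      field_simp
      ring
    rw [h.weight_rpow, ← hD]
    calc 2 * D ^ (-(r / p)) * (m : ℝ) ^ (r / p)
        ≤ 2 * (L ^ (-(r / p)) * (m : ℝ) ^ (q - r / p)) * (m : ℝ) ^ (r / p) := by gcongr
      _ = 2 * L ^ (-(r / p)) * (m : ℝ) ^ q := by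
          rw [Real.rpow_sub hm0]
          field_simp
      _ ≤ _ := mul_le_mul_of_nonneg_right hL (by positivity)
  have hmq : 0 ≤ κ / 2 * (m : ℝ) ^ q := by positivity
  refine (h.symNorm_flat_rpow_le m N).trans (max_le ?_ ?_)
  · nlinarith
  · nlinarith

/-- The fundamental function of `E` is not bounded below by a multiple of `m ^ (1 / p')`. -/
theorem exists_symNorm_flat_le {η : ℝ} (hη : 0 < η) :
    ∃ m : ℕ, 1 ≤ m ∧ symNorm h (flat m) ≤ η * (m : ℝ) ^ (1 - 1 / p) := by
  have hr := h.r_pos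
  obtain ⟨m, hm1, hm⟩ := h.exists_symNorm_flat_rpow_le (κ := η ^ r) (by positivity)
  refine ⟨m, hm1, ?_⟩
  rw [← Real.rpow_le_rpow_iff (apply_nonneg _ _) (by positivity) hr,
    Real.mul_rpow hη.le (by positivity), ← Real.rpow_mul (by positivity), mul_comm (1 - 1 / p)]
  exact hm

theorem exists_symNorm_flat_sq_le {η : ℝ} (hη : 0 < η) :
    ∃ m : ℕ, 1 ≤ m ∧ symNorm h (flat m) ^ 2 ≤ η * m := by
  have hp := h.p_pos
  obtain ⟨m, hm1, hm⟩ := h.exists_symNorm_flat_le (Real.sqrt_pos.2 hη)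
  refine ⟨m, hm1, ?_⟩
  have hm1' : (1 : ℝ) ≤ m := by exact_mod_cast hm1
  calc symNorm h (flat m) ^ 2 ≤ (√η * (m : ℝ) ^ (1 - 1 / p)) ^ 2 :=
        pow_le_pow_left₀ (apply_nonneg _ _) hm 2
    _ = η * (m : ℝ) ^ ((1 - 1 / p) * 2) := by
        rw [mul_pow, Real.sq_sqrt hη.le, Real.rpow_mul (by positivity), Real.rpow_two]
    _ ≤ η * (m : ℝ) ^ (1 : ℝ) := by
        refine mul_le_mul_of_nonneg_left (Real.rpow_le_rpow_of_exponent_le hm1' ?_) hη.le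
        have : 1 / 2 ≤ 1 / p := one_div_le_one_div_of_le hp h.p_lt_two.le
        linarith
    _ = _ := by rw [Real.rpow_one]

end Admissible

theorem exists_perm_glue (σ τ : Equiv.Perm ℕ) {A B : Finset ℕ} (hAB : Disjoint A B)
    (himg : ∀ x ∈ A, ∀ y ∈ B, σ x ≠ τ y) :
    ∃ ρ : Equiv.Perm ℕ, (∀ x ∈ A, ρ x = σ x) ∧ ∀ y ∈ B, ρ y = τ y := by
  classical
  obtain ⟨ρ, hρ⟩ := Equiv.Perm.exists_extending_pair (fun x : ↥(A ∪ B) => (x : ℕ))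
    (fun x : ↥(A ∪ B) => if (x : ℕ) ∈ A then σ x else τ x) Subtype.val_injective (by
      rintro ⟨x, hx⟩ ⟨y, hy⟩ hxy
      dsimp only at hxy
      rw [Finset.mem_union] at hx hy
      refine Subtype.ext ?_
      split_ifs at hxy with h1 h2 h2
      · exact σ.injective hxy
      · exact absurd hxy (himg x h1 y (hy.resolve_left h2))
      · exact absurd hxy.symm (himg y h2 x (hx.resolve_left h1))
      · exact τ.injective hxy)
  refine ⟨ρ, fun x hx => ?_, fun y hy => ?_⟩
  · have := hρ ⟨x, Finset.mem_union_left _ hx⟩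
    simpa [hx] using this
  · have := hρ ⟨y, Finset.mem_union_right _ hy⟩
    simpa [Finset.disjoint_right.1 hAB hy] using this

/-- Sequences with pairwise disjoint supports. -/
def DisjointlySupported (w : ℕ → ℕ →₀ ℝ) : Prop :=
  ∀ i j, i ≠ j → ∀ m, w i m = 0 ∨ w j m = 0

namespace DisjointlySupported

variable {w : ℕ → ℕ →₀ ℝ} (hw : DisjointlySupported w)
include hw

theorem sum_apply {i K x : ℕ} (hi : i < K) (hx : w i x ≠ 0) :
    (∑ l ∈ Finset.range K, w l) x = w i x := by
  rw [Finsupp.finsetSum_apply]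
  exact Finset.sum_eq_single_of_mem i (Finset.mem_range.2 hi) fun j _ hj =>
    (hw j i hj x).resolve_right hx

theorem sum_apply_of_le {K K' x : ℕ} (hK : K ≤ K') (hx : (∑ l ∈ Finset.range K, w l) x ≠ 0) :
    (∑ l ∈ Finset.range K', w l) x = (∑ l ∈ Finset.range K, w l) x := by
  have hx' := hx
  rw [Finsupp.finsetSum_apply] at hx'
  obtain ⟨i, hi, hix⟩ := Finset.exists_ne_zero_of_sum_ne_zero hx'
  have hi := Finset.mem_range.1 hi
  rw [hw.sum_apply hi hix, hw.sum_apply (hi.trans_le hK) hix]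

theorem sum_or {K l : ℕ} (hl : K ≤ l) (x : ℕ) :
    (∑ l ∈ Finset.range K, w l) x = 0 ∨ w l x = 0 := by
  by_cases h0 : w l x = 0
  · exact Or.inr h0
  · left
    rw [Finsupp.finsetSum_apply]
    exact Finset.sum_eq_zero fun j hj =>
      (hw j l (by have := Finset.mem_range.1 hj; omega) x).resolve_right h0

end DisjointlySupported

namespace Admissible

variable {p r : ℝ} {k : ℕ → ℕ} (h : Admissible p r k)
include h

theorem lrFun_add_rpow {a b : ℕ →₀ ℝ} (hab : ∀ i, a i = 0 ∨ b i = 0) :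
    lrFun r (a + b) ^ r = lrFun r a ^ r + lrFun r b ^ r := by
  rw [h.lrFun_rpow, h.lrFun_rpow, h.lrFun_rpow, ← (h.lr_summable a).tsum_add (h.lr_summable b)]
  refine tsum_congr fun i => ?_
  rcases hab i with h0 | h0 <;> simp [h0, Real.zero_rpow h.r_pos.ne']

theorem lrFun_sum_rpow {w : ℕ → ℕ →₀ ℝ} (hw : DisjointlySupported w) (K : ℕ) :
    lrFun r (∑ l ∈ Finset.range K, w l) ^ r = ∑ l ∈ Finset.range K, lrFun r (w l) ^ r := by
  induction K with
  | zero =>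
    rw [h.lrFun_rpow]
    simp [Real.zero_rpow h.r_pos.ne']
  | succ K ih =>
    rw [Finset.sum_range_succ, Finset.sum_range_succ, h.lrFun_add_rpow (hw.sum_or le_rfl), ih]

theorem exists_lrFun_lt {w : ℕ → ℕ →₀ ℝ} (hw : DisjointlySupported w) {M : ℝ}
    (hM : ∀ K, symNorm h (∑ l ∈ Finset.range K, w l) ≤ M) {δ : ℝ} (hδ : 0 < δ) (K : ℕ) :
    ∃ l, K ≤ l ∧ lrFun r (w l) < δ := by
  by_contra! hcon
  have hr := h.r_pos
  obtain ⟨n, hn⟩ := exists_nat_gt (M ^ r / δ ^ r)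
  rw [div_lt_iff₀ (by positivity)] at hn
  have h1 : lrFun r (∑ l ∈ Finset.range (K + n), w l) ^ r ≤ M ^ r :=
    Real.rpow_le_rpow (lrFun_nonneg _) ((h.lrFun_le_symNorm _).trans (hM _)) hr.le
  rw [h.lrFun_sum_rpow hw, Finset.sum_range_add] at h1
  have h2 : ∑ i ∈ Finset.range n, δ ^ r ≤ ∑ i ∈ Finset.range n, lrFun r (w (K + i)) ^ r :=
    Finset.sum_le_sum fun i _ => Real.rpow_le_rpow hδ.le (hcon _ (by omega)) hr.le
  have h3 : 0 ≤ ∑ i ∈ Finset.range K, lrFun r (w i) ^ r :=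
    Finset.sum_nonneg fun i _ => Real.rpow_nonneg (lrFun_nonneg _) _
  simp only [Finset.sum_const, Finset.card_range, nsmul_eq_mul] at h2
  linarith

theorem blockFun_mono_of_block {a b : ℕ →₀ ℝ} {i : ℕ}
    (hab : ∀ j < k i, |a ((∑ m ∈ Finset.range i, k m) + j)| ≤
      |b ((∑ m ∈ Finset.range i, k m) + j)|) : blockFun p k i a ≤ blockFun p k i b := by
  have := h.p_pos
  refine Real.rpow_le_rpow (by positivity) ?_ (by positivity)
  exact Finset.sum_le_sum fun j hj => Real.rpow_le_rpow (abs_nonneg _)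
    (hab j (Finset.mem_range.1 hj)) this.le

theorem blockFun_le_mul {a : ℕ →₀ ℝ} {δ : ℝ} (ha : ∀ i, |a i| ≤ δ) (i : ℕ) :
    blockFun p k i a ≤ (k i : ℝ) ^ (1 / p) * δ := by
  have hp := h.p_pos
  have hδ : 0 ≤ δ := (abs_nonneg _).trans (ha 0)
  have h1 : blockFun p k i a ≤ ((k i : ℝ) * δ ^ p) ^ (1 / p) := by
    refine Real.rpow_le_rpow (by positivity) ?_ (by positivity)
    refine (Finset.sum_le_card_nsmul _ _ (δ ^ p) fun j _ =>
      Real.rpow_le_rpow (abs_nonneg _) (ha _) hp.le).trans ?_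
    rw [nsmul_eq_mul, Finset.card_range]
  rwa [Real.mul_rpow (by positivity) (by positivity), ← Real.rpow_mul hδ,
    mul_one_div_cancel hp.ne', Real.rpow_one] at h1

/-- One step of the gliding hump: the vector `w l` is placed on blocks behind the `n`-th one. -/
theorem exists_hump_step {w : ℕ → ℕ →₀ ℝ} (hw : DisjointlySupported w) {ε M : ℝ} (hε : 0 < ε)
    (hwε : ∀ l, ε ≤ symNorm h (w l)) (hM : ∀ K, symNorm h (∑ l ∈ Finset.range K, w l) ≤ M)
    (K n : ℕ) (σ : Equiv.Perm ℕ) : ∃ (K' n' : ℕ) (σ' : Equiv.Perm ℕ),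
      ∑ i ∈ Finset.range n, (weight p k i *
        blockFun p k i ((∑ l ∈ Finset.range K, w l).mapDomain σ)) ^ r + (ε / 2) ^ r / 2 ≤
      ∑ i ∈ Finset.range n', (weight p k i *
        blockFun p k i ((∑ l ∈ Finset.range K', w l).mapDomain σ')) ^ r := by
  classical
  have hr := h.r_pos
  have hp := h.p_pos
  set c : ℝ := (ε / 2) ^ r / 2 with hc
  have hc0 : 0 < c := by positivity
  set A : ℝ := ∑ i ∈ Finset.range n, ((k i : ℝ) ^ (1 / p)) ^ r with hA
  have hA0 : 0 ≤ A := Finset.sum_nonneg fun i _ => by positivity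
  set δ : ℝ := (c / (A + 1)) ^ (1 / r) with hδ
  have hδ0 : 0 < δ := by positivity
  have hδr : A * δ ^ r ≤ c := by
    rw [hδ, ← Real.rpow_mul (by positivity), one_div_mul_cancel hr.ne', Real.rpow_one,
      mul_div_assoc', div_le_iff₀ (by positivity)]
    nlinarith
  obtain ⟨l, hKl, hl⟩ := h.exists_lrFun_lt hw hM (lt_min hδ0 (half_pos hε)) K
  have hwl : ∀ i, |w l i| ≤ δ := fun i =>
    (h.abs_apply_le_lrFun _ i).trans (hl.le.trans (min_le_left _ _))
  obtain ⟨τ, hτ⟩ : ∃ τ : Equiv.Perm ℕ, ε / 2 < tFun p r k ((w l).mapDomain τ) := by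
    by_contra! hcon
    linarith [h.symNorm_le hcon, hwε l]
  have hlr : lrFun r ((w l).mapDomain τ) = lrFun r (w l) := by
    unfold lrFun
    congr 1
    simp only [Finsupp.mapDomain_equiv_apply]
    exact Equiv.tsum_eq τ.symm fun i => |w l i| ^ r
  have hmixed : ε / 2 < mixedFun p r k ((w l).mapDomain τ) := by
    refine (lt_max_iff.1 hτ).resolve_left (not_lt.2 ?_)
    rw [hlr]
    exact hl.le.trans (min_le_right _ _)
  set b := (w l).mapDomain τ with hb
  have hsum : 2 * c < ∑' i, (weight p k i * blockFun p k i b) ^ r := by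
    rw [← h.mixedFun_rpow, hc, mul_div_cancel₀ _ (two_ne_zero)]
    exact Real.rpow_lt_rpow (by positivity) hmixed hr
  have hhead : ∑ i ∈ Finset.range n, (weight p k i * blockFun p k i b) ^ r ≤ c := by
    refine le_trans ?_ hδr
    rw [hA, Finset.sum_mul]
    refine Finset.sum_le_sum fun i _ => ?_
    rw [← Real.mul_rpow (by positivity) hδ0.le]
    refine Real.rpow_le_rpow (weight_mul_blockFun_nonneg b i) ?_ hr.le
    calc _ ≤ 1 * ((k i : ℝ) ^ (1 / p) * δ) :=
          mul_le_mul (h.weight_le_one i) (h.blockFun_le_mul (fun j => by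
            rw [hb, Finsupp.mapDomain_equiv_apply]
            exact hwl _) i) (blockFun_nonneg p k i b) zero_le_one
      _ = _ := one_mul _
  obtain ⟨n', hnn', hn'⟩ : ∃ n', n ≤ n' ∧
      2 * c < ∑ i ∈ Finset.range n', (weight p k i * blockFun p k i b) ^ r := by
    have h1 := (h.mixed_summable b).hasSum.tendsto_sum_nat.eventually_const_lt hsum
    obtain ⟨n', h2, h3⟩ := (h1.and (Filter.eventually_ge_atTop n)).exists
    exact ⟨n', h3, h2⟩
  set S := fun K => ∑ l ∈ Finset.range K, w l with hS
  set P : ℕ := ∑ m ∈ Finset.range n, k m with hP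
  obtain ⟨ρ, hρσ, hρτ⟩ := exists_perm_glue σ τ
    (A := (S K).support.filter fun x => σ x < P) (B := (w l).support.filter fun x => P ≤ τ x)
    (by
      rw [Finset.disjoint_left]
      intro x hx hx'
      have h1 := Finsupp.mem_support_iff.1 (Finset.mem_filter.1 hx).1
      have h2 := Finsupp.mem_support_iff.1 (Finset.mem_filter.1 hx').1
      exact (hw.sum_or hKl x).elim h1 h2)
    (by
      intro x hx y hy e
      have h1 := (Finset.mem_filter.1 hx).2
      have h2 := (Finset.mem_filter.1 hy).2
      omega)
  refine ⟨l + 1, n', ρ, ?_⟩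
  rw [← Finset.sum_range_add_sum_Ico _ hnn']
  refine add_le_add (Finset.sum_le_sum fun i hi => ?_) ?_
  · refine Real.rpow_le_rpow (weight_mul_blockFun_nonneg _ i)
      (mul_le_mul_of_nonneg_left (h.blockFun_mono_of_block fun j hj => ?_) (weight_nonneg p k i)) hr.le
    have hpos : (∑ m ∈ Finset.range i, k m) + j < P := by
      have h1 : ∑ m ∈ Finset.range (i + 1), k m ≤ P := Finset.sum_le_sum_of_subset
        (Finset.range_mono (Finset.mem_range.1 hi))
      rw [Finset.sum_range_succ] at h1
      omega
    generalize (∑ m ∈ Finset.range i, k m) + j = x at hpos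
    rw [Finsupp.mapDomain_equiv_apply, Finsupp.mapDomain_equiv_apply]
    by_cases h0 : S K (σ.symm x) = 0
    · rw [show (∑ l ∈ Finset.range K, w l) (σ.symm x) = 0 from h0, abs_zero]
      exact abs_nonneg _
    · have h1 := hρσ (σ.symm x) (Finset.mem_filter.2 ⟨Finsupp.mem_support_iff.2 h0, by simpa using hpos⟩)
      rw [Equiv.apply_symm_apply] at h1
      rw [← (Equiv.symm_apply_eq ρ).2 h1.symm] at h0 ⊢
      rw [hw.sum_apply_of_le (by omega : K ≤ l + 1) h0]
  · have h1 : c ≤ ∑ i ∈ Finset.Ico n n', (weight p k i * blockFun p k i b) ^ r := by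
      rw [← Finset.sum_range_add_sum_Ico _ hnn'] at hn'
      linarith
    refine h1.trans (Finset.sum_le_sum fun i hi => ?_)
    refine Real.rpow_le_rpow (weight_mul_blockFun_nonneg _ i)
      (mul_le_mul_of_nonneg_left (h.blockFun_mono_of_block fun j hj => ?_) (weight_nonneg p k i)) hr.le
    have hpos : P ≤ (∑ m ∈ Finset.range i, k m) + j := by
      have h1 : P ≤ ∑ m ∈ Finset.range i, k m := Finset.sum_le_sum_of_subset
        (Finset.range_mono (Finset.mem_Ico.1 hi).1)
      omega
    generalize (∑ m ∈ Finset.range i, k m) + j = x at hpos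
    rw [hb, Finsupp.mapDomain_equiv_apply, Finsupp.mapDomain_equiv_apply]
    by_cases h0 : w l (τ.symm x) = 0
    · rw [h0, abs_zero]
      exact abs_nonneg _
    · have h1 := hρτ (τ.symm x) (Finset.mem_filter.2 ⟨Finsupp.mem_support_iff.2 h0, by simpa using hpos⟩)
      rw [Equiv.apply_symm_apply] at h1
      rw [← (Equiv.symm_apply_eq ρ).2 h1.symm] at h0 ⊢
      rw [hw.sum_apply (Nat.lt_succ_self l) h0]

/-- Disjointly supported vectors that are bounded away from zero have unbounded partial sums. -/
theorem exists_lt_symNorm_sum {w : ℕ → ℕ →₀ ℝ} (hw : DisjointlySupported w) {ε : ℝ} (hε : 0 < ε)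
    (hwε : ∀ l, ε ≤ symNorm h (w l)) (M : ℝ) : ∃ K, M < symNorm h (∑ l ∈ Finset.range K, w l) := by
  by_contra! hM
  have hr := h.r_pos
  have key : ∀ j : ℕ, ∃ (K n : ℕ) (σ : Equiv.Perm ℕ), j * ((ε / 2) ^ r / 2) ≤
      ∑ i ∈ Finset.range n, (weight p k i *
        blockFun p k i ((∑ l ∈ Finset.range K, w l).mapDomain σ)) ^ r := by
    intro j
    induction j with
    | zero => exact ⟨0, 0, 1, by simp⟩
    | succ j ih =>
      obtain ⟨K, n, σ, hj⟩ := ih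
      obtain ⟨K', n', σ', hj'⟩ := h.exists_hump_step hw hε hwε hM K n σ
      refine ⟨K', n', σ', le_trans ?_ hj'⟩
      push_cast
      linarith
  obtain ⟨j, hj⟩ := exists_nat_gt (M ^ r / ((ε / 2) ^ r / 2))
  rw [div_lt_iff₀ (by positivity)] at hj
  obtain ⟨K, n, σ, hKn⟩ := key j
  set a := (∑ l ∈ Finset.range K, w l).mapDomain σ with ha
  have h1 : ∑ i ∈ Finset.range n, (weight p k i * blockFun p k i a) ^ r ≤ mixedFun p r k a ^ r := by
    rw [h.mixedFun_rpow]
    exact (h.mixed_summable a).sum_le_tsum _ fun i _ =>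
      Real.rpow_nonneg (weight_mul_blockFun_nonneg a i) _
  have h2 : mixedFun p r k a ^ r ≤ M ^ r := Real.rpow_le_rpow (mixedFun_nonneg a)
    ((le_max_right _ _).trans ((h.tFun_le_symNorm σ _).trans (hM K))) hr.le
  linarith

end Admissible

/-! ### Completions in which the unit vectors form a monotone basis -/

/-- The restriction of a sequence to a finite set of indices. -/
def trunc (x : ℕ → ℝ) (s : Finset ℕ) : ℕ →₀ ℝ := ∑ i ∈ s, Finsupp.single i (x i)

theorem trunc_apply (x : ℕ → ℝ) (s : Finset ℕ) (i : ℕ) :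
    trunc x s i = if i ∈ s then x i else 0 := by
  classical
  simp [trunc, Finsupp.single_apply]

theorem trunc_eq_self {a : ℕ →₀ ℝ} {s : Finset ℕ} (h : a.support ⊆ s) : trunc a s = a := by
  ext i
  rw [trunc_apply]
  split_ifs with hi
  · rfl
  · exact (Finsupp.notMem_support_iff.1 fun h' => hi (h h')).symm

theorem trunc_trunc (x : ℕ → ℝ) (s t : Finset ℕ) : trunc (trunc x s) t = trunc x (s ∩ t) := by
  ext i
  simp only [trunc_apply, Finset.mem_inter]
  split_ifs <;> simp_all

theorem trunc_range_sub_trunc_range (x : ℕ → ℝ) {l m : ℕ} (hlm : l ≤ m) :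
    trunc x (Finset.range m) - trunc x (Finset.range l) = trunc x (Finset.Ico l m) := by
  rw [trunc, trunc, trunc, ← Finset.sum_range_add_sum_Ico _ hlm, add_sub_cancel_left]

theorem sum_trunc_Ico (x : ℕ → ℝ) {l : ℕ → ℕ} (hl : Monotone l) (K : ℕ) :
    ∑ k ∈ Finset.range K, trunc x (Finset.Ico (l k) (l (k + 1))) =
      trunc x (Finset.Ico (l 0) (l K)) := by
  induction K with
  | zero => simp [trunc]
  | succ K ih =>
    rw [Finset.sum_range_succ, ih, trunc, trunc, trunc,
      Finset.sum_Ico_consecutive _ (hl (Nat.zero_le K)) (hl (Nat.le_succ K))]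

/-- Successive blocks are disjointly supported. -/
theorem disjointlySupported_of_blocks {w : ℕ → ℕ →₀ ℝ} {l : ℕ → ℕ} (hl : Monotone l)
    (hw : ∀ k i, w k i ≠ 0 → l k ≤ i ∧ i < l (k + 1)) : DisjointlySupported w := by
  intro i j hij m
  by_contra! hcon
  obtain ⟨h1, h2⟩ := hw i m hcon.1
  obtain ⟨h3, h4⟩ := hw j m hcon.2
  rcases lt_or_gt_of_ne hij with hlt | hlt
  · have := hl (show i + 1 ≤ j from hlt)
    omega
  · have := hl (show j + 1 ≤ i from hlt)
    omega

namespace C00Completion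

variable (N : Seminorm ℝ (ℕ →₀ ℝ))

/-- The embedding of the finitely non-zero sequences. -/
def emb : (ℕ →₀ ℝ) →ₗ[ℝ] C00Completion N :=
  (UniformSpace.Completion.toComplL (𝕜 := ℝ) (E := C00 N)).toLinearMap.comp
    (C00.of N).toLinearMap

theorem norm_emb (a : ℕ →₀ ℝ) : ‖emb N a‖ = N a :=
  (UniformSpace.Completion.norm_coe _).trans (C00.norm_of N a)

theorem emb_single (i : ℕ) : emb N (Finsupp.single i 1) = unit N i := rfl

theorem denseRange_emb : DenseRange (emb N) :=
  UniformSpace.Completion.denseRange_coe.comp (C00.of N).surjective.denseRange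
    (UniformSpace.Completion.continuous_coe _)

theorem emb_trunc (x : ℕ → ℝ) (s : Finset ℕ) : emb N (trunc x s) = ∑ i ∈ s, x i • unit N i := by
  rw [trunc, map_sum]
  refine Finset.sum_congr rfl fun i _ => ?_
  rw [← emb_single, ← map_smul, Finsupp.smul_single_one]

theorem emb_eq_sum (a : ℕ →₀ ℝ) : emb N a = a.sum fun i c => c • unit N i := by
  conv_lhs => rw [← trunc_eq_self (Finset.Subset.refl a.support)]
  exact emb_trunc N a a.support

variable {N}

/-- The unit vectors form a bimonotone basis with coordinate functionals of norm at most one. -/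
structure IsBimonotone (N : Seminorm ℝ (ℕ →₀ ℝ)) : Prop where
  abs_apply_le : ∀ (a : ℕ →₀ ℝ) (i : ℕ), |a i| ≤ N a
  trunc_Ico_le : ∀ (a : ℕ →₀ ℝ) (l m : ℕ), N (trunc a (Finset.Ico l m)) ≤ N a

/-- The coordinate functionals. -/
def coord (N : Seminorm ℝ (ℕ →₀ ℝ)) (i : ℕ) : StrongDual ℝ (C00Completion N) :=
  (Finsupp.lapply i : (ℕ →₀ ℝ) →ₗ[ℝ] ℝ).extendOfNorm (emb N)

namespace IsBimonotone

variable (hN : IsBimonotone N)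
include hN

theorem coord_emb (i : ℕ) (a : ℕ →₀ ℝ) : coord N i (emb N a) = a i := by
  refine LinearMap.extendOfNorm_eq (denseRange_emb N) ⟨1, fun a => ?_⟩ a
  rw [norm_emb, one_mul]
  exact hN.abs_apply_le a i

theorem trunc_range_le (a : ℕ →₀ ℝ) (n : ℕ) : N (trunc a (Finset.range n)) ≤ N a := by
  rw [Finset.range_eq_Ico]
  exact hN.trunc_Ico_le a 0 n

theorem coord_unit (i j : ℕ) : coord N i (unit N j) = (Pi.single j (1 : ℝ) : ℕ → ℝ) i := by
  rw [← emb_single, hN.coord_emb, Finsupp.single_eq_pi_single]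

theorem trunc_coord_le {s : Finset ℕ} (hs : ∀ a : ℕ →₀ ℝ, N (trunc a s) ≤ N a)
    (x : C00Completion N) : N (trunc (fun i => coord N i x) s) ≤ ‖x‖ := by
  rw [← norm_emb, emb_trunc]
  refine (denseRange_emb N).induction_on x (isClosed_le (by fun_prop) (by fun_prop)) fun a => ?_
  simp only [hN.coord_emb]
  rw [← emb_trunc, norm_emb, norm_emb]
  exact hs a

theorem tendsto_emb_trunc {ι : Type*} {L : Filter ι} {s : ι → Finset ℕ}
    (hs : Filter.Tendsto s L Filter.atTop) (hsN : ∀ i, ∀ a : ℕ →₀ ℝ, N (trunc a (s i)) ≤ N a)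
    (x : C00Completion N) :
    Filter.Tendsto (fun i => emb N (trunc (fun j => coord N j x) (s i))) L (𝓝 x) := by
  rw [Metric.tendsto_nhds]
  intro ε hε
  obtain ⟨a, ha⟩ := Metric.denseRange_iff.1 (denseRange_emb N) x (ε / 2) (half_pos hε)
  rw [dist_eq_norm] at ha
  filter_upwards [hs.eventually_ge_atTop a.support] with i hi
  have h1 := hN.trunc_coord_le (hsN i) (x - emb N a)
  have h2 : trunc (fun j => coord N j (x - emb N a)) (s i) =
      trunc (fun j => coord N j x) (s i) - a := by
    rw [← trunc_eq_self hi]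
    ext j
    simp only [trunc_apply, Finsupp.sub_apply, map_sub, hN.coord_emb]
    split_ifs <;> simp
  rw [h2, ← norm_emb, map_sub] at h1
  calc dist (emb N (trunc (fun j => coord N j x) (s i))) x
      ≤ dist (emb N (trunc (fun j => coord N j x) (s i))) (emb N a) + dist (emb N a) x :=
        dist_triangle _ _ _
    _ < ε := by
        rw [dist_eq_norm, dist_eq_norm, norm_sub_rev (emb N a) x]
        linarith

theorem tendsto_emb_trunc_range (x : C00Completion N) : Filter.Tendsto
    (fun n => emb N (trunc (fun j => coord N j x) (Finset.range n))) Filter.atTop (𝓝 x) :=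
  hN.tendsto_emb_trunc Filter.tendsto_finset_range (fun n a => hN.trunc_range_le a n) x

/-- The unit vectors as a Schauder basis. -/
def schauderBasis : SchauderBasis ℝ (C00Completion N) where
  basis := unit N
  coord := coord N
  ortho := fun i j => by
    rw [hN.coord_unit]
    congr!
  expansion := fun x => by
    have := hN.tendsto_emb_trunc_range x
    simp only [emb_trunc] at this
    rw [HasSum, SummationFilter.conditional_filter_eq_map_range]
    exact this

/-! #### Bounded completeness -/

omit hN in
theorem exists_blocks_of_not_cauchySeq {x : ℕ → ℝ}
    (hx : ¬ CauchySeq fun n => emb N (trunc x (Finset.range n))) :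
    ∃ ε > 0, ∃ l : ℕ → ℕ, StrictMono l ∧
      ∀ j, ε ≤ N (trunc x (Finset.Ico (l j) (l (j + 1)))) := by
  obtain ⟨ε, hε, l, hl, hlε⟩ := exists_strictMono_of_not_cauchySeq hx
  refine ⟨ε, hε, l, hl, fun j => ?_⟩
  have := hlε j
  rwa [dist_eq_norm, ← map_sub, trunc_range_sub_trunc_range _ (hl.monotone (Nat.le_succ j)),
    norm_emb] at this

omit hN in
/-- The basis is boundedly complete. -/
def _root_.IsBoundedlyComplete (N : Seminorm ℝ (ℕ →₀ ℝ)) : Prop :=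
  ∀ (x : ℕ → ℝ) (M : ℝ), (∀ n, N (trunc x (Finset.range n)) ≤ M) →
    CauchySeq fun n => emb N (trunc x (Finset.range n))

theorem trunc_Ico_le_of_trunc_range_le {x : ℕ → ℝ} {M : ℝ}
    (hx : ∀ n, N (trunc x (Finset.range n)) ≤ M) (l m : ℕ) :
    N (trunc x (Finset.Ico l m)) ≤ M := by
  have h1 := hN.trunc_Ico_le (trunc x (Finset.range m)) l m
  rw [trunc_trunc, Finset.inter_eq_right.2 (fun i hi => by
    have := Finset.mem_Ico.1 hi
    exact Finset.mem_range.2 this.2)] at h1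
  exact h1.trans (hx m)

theorem exists_coord_eq (hbc : IsBoundedlyComplete N) {x : ℕ → ℝ} {M : ℝ}
    (hx : ∀ n, N (trunc x (Finset.range n)) ≤ M) : ∃ y, ∀ i, coord N i y = x i := by
  obtain ⟨y, hy⟩ := cauchySeq_tendsto_of_complete (hbc x M hx)
  refine ⟨y, fun i => ?_⟩
  refine tendsto_nhds_unique (((coord N i).continuous.tendsto y).comp hy) ?_
  refine tendsto_const_nhds.congr' ?_
  filter_upwards [Filter.eventually_gt_atTop i] with n hn
  simp only [Function.comp, hN.coord_emb, trunc_apply, Finset.mem_range, if_pos hn]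

/-- The expansion of a functional with respect to the coordinate functionals. -/
def _root_.C00Completion.dualSum (f : StrongDual ℝ (C00Completion N)) (s : Finset ℕ) :
    StrongDual ℝ (C00Completion N) := ∑ i ∈ s, f (unit N i) • coord N i

omit hN in
theorem dualSum_apply (f : StrongDual ℝ (C00Completion N)) (s : Finset ℕ) (x : C00Completion N) :
    dualSum f s x = f (emb N (trunc (fun i => coord N i x) s)) := by
  rw [dualSum, emb_trunc, map_sum, sum_apply]
  refine Finset.sum_congr rfl fun i _ => ?_
  rw [smul_apply, map_smul, smul_eq_mul, smul_eq_mul, mul_comm]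

/-- If the basis is boundedly complete, then every element of the bidual agrees with an element of
the space on the coordinate functionals. -/
theorem exists_coord_eq_bidual (hbc : IsBoundedlyComplete N)
    (F : StrongDual ℝ (StrongDual ℝ (C00Completion N))) :
    ∃ y, ∀ i, coord N i y = F (coord N i) := by
  refine hN.exists_coord_eq hbc (M := ‖F‖) fun n => ?_
  obtain ⟨g, hg1, hg⟩ := exists_dual_vector'' ℝ (emb N (trunc (fun i => F (coord N i))
    (Finset.range n)))
  have h1 : ‖dualSum g (Finset.range n)‖ ≤ 1 := by
    refine ContinuousLinearMap.opNorm_le_bound _ zero_le_one fun x => ?_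
    rw [dualSum_apply]
    refine (g.le_opNorm _).trans ?_
    rw [norm_emb]
    exact mul_le_mul hg1 (hN.trunc_coord_le (fun a => hN.trunc_range_le a n) x) (apply_nonneg _ _)
      zero_le_one
  have h2 : F (dualSum g (Finset.range n)) =
      N (trunc (fun i => F (coord N i)) (Finset.range n)) := by
    rw [norm_emb] at hg
    refine Eq.trans ?_ hg
    rw [emb_trunc, dualSum, map_sum, map_sum]
    refine Finset.sum_congr rfl fun i _ => ?_
    rw [map_smul, map_smul, smul_eq_mul, smul_eq_mul, mul_comm]
  rw [← h2]
  calc F (dualSum g (Finset.range n)) ≤ ‖F (dualSum g (Finset.range n))‖ := Real.le_norm_self _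
    _ ≤ ‖F‖ * ‖dualSum g (Finset.range n)‖ := F.le_opNorm _
    _ ≤ ‖F‖ * 1 := mul_le_mul_of_nonneg_left h1 (norm_nonneg F)
    _ = ‖F‖ := mul_one _

/-! #### Expansions of functionals -/

theorem tendsto_dualSum {f : StrongDual ℝ (C00Completion N)}
    (hf : CauchySeq fun n => dualSum f (Finset.range n)) :
    Filter.Tendsto (fun n => dualSum f (Finset.range n)) Filter.atTop (𝓝 f) := by
  obtain ⟨g, hg⟩ := cauchySeq_tendsto_of_complete hf
  have : g = f := by
    ext x
    refine tendsto_nhds_unique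
      (((ContinuousLinearMap.apply ℝ ℝ x).continuous.tendsto g).comp hg) ?_
    refine ((f.continuous.tendsto x).comp (hN.tendsto_emb_trunc_range x)).congr fun n => ?_
    exact (dualSum_apply f _ x).symm
  rwa [this] at hg

theorem bidual_apply_eq {F : StrongDual ℝ (StrongDual ℝ (C00Completion N))}
    {y : C00Completion N} (hy : ∀ i, coord N i y = F (coord N i))
    {f : StrongDual ℝ (C00Completion N)}
    (hf : CauchySeq fun n => dualSum f (Finset.range n)) : F f = f y := by
  have h1 := hN.tendsto_dualSum hf
  refine tendsto_nhds_unique ((F.continuous.tendsto f).comp h1) ?_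
  refine (((ContinuousLinearMap.apply ℝ ℝ y).continuous.tendsto f).comp h1).congr fun n => ?_
  simp [dualSum, hy]

theorem exists_blocks_of_not_cauchySeq_dualSum {f : StrongDual ℝ (C00Completion N)}
    (hf : ¬ CauchySeq fun n => dualSum f (Finset.range n)) :
    ∃ ε > 0, ∃ (l : ℕ → ℕ) (y : ℕ → ℕ →₀ ℝ), StrictMono l ∧ (∀ j, N (y j) ≤ 1) ∧
      (∀ j i, y j i ≠ 0 → l j ≤ i ∧ i < l (j + 1)) ∧ ∀ j, ε ≤ f (emb N (y j)) := by
  obtain ⟨ε, hε, l, hl, hlε⟩ := exists_strictMono_of_not_cauchySeq hf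
  have hex : ∀ j, ∃ y : ℕ →₀ ℝ, N y ≤ 1 ∧ (∀ i, y i ≠ 0 → l j ≤ i ∧ i < l (j + 1)) ∧
      ε / 2 ≤ f (emb N y) := by
    intro j
    have h1 := hlε j
    have h2 : dualSum f (Finset.range (l (j + 1))) - dualSum f (Finset.range (l j)) =
        dualSum f (Finset.Ico (l j) (l (j + 1))) := by
      rw [dualSum, dualSum, dualSum,
        ← Finset.sum_range_add_sum_Ico _ (hl.monotone (Nat.le_succ j)), add_sub_cancel_left]
    rw [dist_eq_norm, h2] at h1
    obtain ⟨x, hx1, hx2⟩ := ContinuousLinearMap.exists_lt_apply_of_lt_opNorm _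
      (lt_of_lt_of_le (half_lt_self hε) h1)
    rw [dualSum_apply] at hx2
    set a := trunc (fun i => coord N i x) (Finset.Ico (l j) (l (j + 1))) with ha
    have ha1 : N a ≤ 1 :=
      (hN.trunc_coord_le (fun b => hN.trunc_Ico_le b _ _) x).trans hx1.le
    have ha2 : ∀ i, a i ≠ 0 → l j ≤ i ∧ i < l (j + 1) := by
      intro i hi
      rw [ha, trunc_apply] at hi
      by_contra hcon
      exact hi (if_neg fun h => hcon (Finset.mem_Ico.1 h))
    rw [Real.norm_eq_abs] at hx2
    rcases lt_abs.1 hx2 with h3 | h3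
    · exact ⟨a, ha1, ha2, h3.le⟩
    · exact ⟨-a, by rwa [map_neg_eq_map], fun i hi => ha2 i (by simpa using hi),
        by rw [map_neg, map_neg]; exact h3.le⟩
  choose y hy1 hy2 hy3 using hex
  exact ⟨ε / 2, half_pos hε, l, y, hl, hy1, hy2, hy3⟩

end IsBimonotone

end C00Completion

/-! ### The space `E` -/

theorem sum_flat {Y : Type*} [AddCommGroup Y] [Module ℝ Y] (m : ℕ) (y : ℕ → Y) :
    ((flat m).sum fun i c => c • y i) = ∑ i ∈ Finset.range m, y i := by
  rw [Finsupp.sum, support_flat]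
  refine Finset.sum_congr rfl fun i hi => ?_
  rw [flat_apply, if_pos (Finset.mem_range.1 hi), one_smul]

namespace Admissible

open C00Completion

variable {p r : ℝ} {k : ℕ → ℕ} (h : Admissible p r k)
include h

theorem symNorm_trunc_le (a : ℕ →₀ ℝ) (s : Finset ℕ) : symNorm h (trunc a s) ≤ symNorm h a := by
  refine h.symNorm_mono fun i => ?_
  rw [trunc_apply]
  split_ifs
  · exact le_rfl
  · rw [abs_zero]
    exact abs_nonneg _

theorem isBimonotone_symNorm : IsBimonotone (symNorm h) where
  abs_apply_le := h.abs_apply_le_symNorm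
  trunc_Ico_le := fun a _ _ => h.symNorm_trunc_le a _

theorem isBoundedlyComplete_symNorm : IsBoundedlyComplete (symNorm h) := by
  intro x M hM
  by_contra hx
  obtain ⟨ε, hε, l, hl, hlε⟩ := IsBimonotone.exists_blocks_of_not_cauchySeq hx
  obtain ⟨K, hK⟩ := h.exists_lt_symNorm_sum (disjointlySupported_of_blocks hl.monotone
    (w := fun j => trunc x (Finset.Ico (l j) (l (j + 1)))) fun j i hi => by
      rw [trunc_apply] at hi
      by_contra hcon
      exact hi (if_neg fun h => hcon (Finset.mem_Ico.1 h))) hε hlε M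
  rw [sum_trunc_Ico x hl.monotone] at hK
  exact absurd (h.isBimonotone_symNorm.trunc_Ico_le_of_trunc_range_le hM _ _) (not_le.2 hK)

/-- A power with exponent less than one grows more slowly than linearly. -/
theorem exists_mul_rpow_lt {C ε : ℝ} (hε : 0 < ε) : ∃ n : ℕ, C * (n : ℝ) ^ (1 / p) < ε * n := by
  have hp := h.one_lt_p
  have h1 : 0 < 1 - 1 / p := by
    have : 1 / p < 1 := by
      rw [div_lt_one (by linarith)]
      exact hp
    linarith
  have h2 := ((tendsto_rpow_atTop h1).comp tendsto_natCast_atTop_atTop).eventually_gt_atTop (C / ε)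
  obtain ⟨n, h3, h4⟩ := (h2.and (Filter.eventually_ge_atTop 1)).exists
  refine ⟨n, ?_⟩
  have hn : (0 : ℝ) < n := by exact_mod_cast h4
  simp only [Function.comp] at h3
  rw [div_lt_iff₀ hε, Real.rpow_sub hn, Real.rpow_one, div_mul_eq_mul_div,
    lt_div_iff₀ (by positivity)] at h3
  linarith

theorem cauchySeq_dualSum_symNorm (f : StrongDual ℝ (SymSpace h)) :
    CauchySeq fun n => dualSum f (Finset.range n) := by
  by_contra hf
  obtain ⟨ε, hε, l, y, hl, hy1, hyl, hyε⟩ :=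
    h.isBimonotone_symNorm.exists_blocks_of_not_cauchySeq_dualSum hf
  have hdis := disjointlySupported_of_blocks hl.monotone hyl
  obtain ⟨n, hn⟩ := h.exists_mul_rpow_lt (C := ‖f‖) hε
  have h1 := h.symNorm_sum_le_rpow (Finset.range n) y (fun i _ j _ hij => hdis i j hij) zero_le_one
    fun i _ => hy1 i
  rw [Finset.card_range, one_mul] at h1
  have h2 : n * ε ≤ f (emb _ (∑ j ∈ Finset.range n, y j)) := by
    rw [map_sum, map_sum, ← nsmul_eq_mul]
    simpa using Finset.card_nsmul_le_sum (Finset.range n) (fun j => f (emb _ (y j))) ε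
      fun j _ => hyε j
  have h3 : f (emb _ (∑ j ∈ Finset.range n, y j)) ≤ ‖f‖ * (n : ℝ) ^ (1 / p) := by
    refine (Real.le_norm_self _).trans ((f.le_opNorm _).trans ?_)
    rw [norm_emb]
    exact mul_le_mul_of_nonneg_left h1 (norm_nonneg f)
  linarith

theorem isReflexiveSpace_symSpace : IsReflexiveSpace (SymSpace h) := by
  intro F
  obtain ⟨y, hy⟩ := h.isBimonotone_symNorm.exists_coord_eq_bidual h.isBoundedlyComplete_symNorm F
  refine ⟨y, ?_⟩
  ext f
  rw [NormedSpace.dual_def]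
  exact (h.isBimonotone_symNorm.bidual_apply_eq hy (h.cauchySeq_dualSum_symNorm f)).symm

/-- The unit vector basis of `E`. -/
def symBasis : SchauderBasis ℝ (SymSpace h) := h.isBimonotone_symNorm.schauderBasis

theorem symBasis_apply (i : ℕ) : h.symBasis i = symUnit h i := rfl

theorem symBasis_coord (i : ℕ) : h.symBasis.coord i = coord (symNorm h) i := rfl

theorem norm_symUnit (i : ℕ) : ‖symUnit h i‖ = 1 := by
  rw [symUnit, ← emb_single, norm_emb, h.symNorm_single, abs_one]

theorem norm_sum_symUnit (f : ℕ → ℕ) (hf : Function.Injective f) (a : ℕ →₀ ℝ) :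
    ‖a.sum fun i c => c • symUnit h (f i)‖ = symNorm h a := by
  rw [← h.symNorm_mapDomain_of_injective f hf a, ← norm_emb, emb_eq_sum,
    Finsupp.sum_mapDomain_index (by simp) fun _ _ _ => add_smul _ _ _]
  rfl

theorem equivSeq_symUnit (f : ℕ → ℕ) (hf : Function.Injective f) :
    EquivSeq (fun i => h.symBasis (f i)) fun i => h.symBasis i := by
  refine ⟨⟨1, fun a => ?_⟩, ⟨1, fun a => ?_⟩⟩ <;>
  · simp only [symBasis_apply]
    rw [h.norm_sum_symUnit f hf, h.norm_sum_symUnit (fun i => i) Function.injective_id, one_mul]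

theorem isSymmetricBasis_symBasis : IsSymmetricBasis h.symBasis :=
  fun σ => h.equivSeq_symUnit σ σ.injective

theorem isSubsymmetricBasis_symBasis : IsSubsymmetricBasis h.symBasis := by
  refine ⟨fun x => ?_, fun n hn => h.equivSeq_symUnit n hn.injective⟩
  have := h.isBimonotone_symNorm.tendsto_emb_trunc (L := Filter.atTop) (s := fun s => s)
    Filter.tendsto_id (fun s a => h.symNorm_trunc_le a s) x
  simp only [emb_trunc] at this
  rw [HasSum, SummationFilter.unconditional_filter]
  exact this

theorem upperEstimate_symBasis : UpperEstimate h.symBasis p := by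
  have hp := h.p_pos
  refine ⟨1, fun n x hx => ?_⟩
  rw [one_mul]
  have hN := h.isBimonotone_symNorm
  have hlim : Filter.Tendsto (fun m => ∑ i, emb _ (trunc (fun j => coord (symNorm h) j (x i))
      (Finset.range m))) Filter.atTop (𝓝 (∑ i, x i)) :=
    tendsto_finsetSum _ fun i _ => hN.tendsto_emb_trunc_range (x i)
  refine le_of_tendsto hlim.norm (Filter.Eventually.of_forall fun m => ?_)
  have h0 : (0 : ℝ) ≤ ∑ i, ‖x i‖ ^ p := Finset.sum_nonneg fun i _ => by positivity
  rw [← map_sum, norm_emb, one_div, Real.le_rpow_inv_iff_of_pos (apply_nonneg _ _) h0 hp]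
  refine (h.symNorm_sum_rpow_le _ _ fun i _ j _ hij l => ?_).trans (Finset.sum_le_sum fun i _ =>
    Real.rpow_le_rpow (apply_nonneg _ _)
      (hN.trunc_coord_le (fun a => hN.trunc_range_le a m) (x i)) hp.le)
  simp only [trunc_apply]
  rcases hx i j hij l with h1 | h1 <;> rw [symBasis_coord] at h1
  · left
    simp [h1]
  · right
    simp [h1]

theorem norm_sum_coord_mul_le (m : ℕ) :
    ‖∑ i ∈ Finset.range m, coord (symNorm h) i‖ * symNorm h (flat m) ≤ m := by
  rcases Nat.eq_zero_or_pos m with rfl | hm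
  · simp
  have hpos := h.symNorm_flat_pos hm
  have hN := h.isBimonotone_symNorm
  rw [← le_div_iff₀ hpos]
  refine ContinuousLinearMap.opNorm_le_bound _ (by positivity) fun x => ?_
  have h1 := h.sum_abs_mul_symNorm_flat_le (Finset.range m)
    (trunc (fun i => coord (symNorm h) i x) (Finset.range m))
  rw [Finset.card_range] at h1
  have h2 := hN.trunc_coord_le (fun a => hN.trunc_range_le a m) x
  rw [div_mul_eq_mul_div, le_div_iff₀ hpos]
  refine le_trans (mul_le_mul_of_nonneg_right ?_ hpos.le)
    (h1.trans (mul_le_mul_of_nonneg_left h2 (Nat.cast_nonneg m)))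
  rw [sum_apply, Real.norm_eq_abs]
  refine (Finset.abs_sum_le_sum_abs _ _).trans (Finset.sum_le_sum fun i hi => ?_)
  rw [trunc_apply, if_pos hi]

theorem le_norm_sum_coord_mul (m : ℕ) :
    (m : ℝ) ≤ ‖∑ i ∈ Finset.range m, coord (symNorm h) i‖ * symNorm h (flat m) := by
  have h1 : (∑ i ∈ Finset.range m, coord (symNorm h) i) (emb _ (flat m)) = m := by
    rw [sum_apply, Finset.sum_congr rfl fun i hi => by
      rw [h.isBimonotone_symNorm.coord_emb, flat_apply, if_pos (Finset.mem_range.1 hi)]]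
    simp
  have h2 := (∑ i ∈ Finset.range m, coord (symNorm h) i).le_opNorm (emb _ (flat m))
  rwa [h1, norm_emb, Real.norm_of_nonneg (Nat.cast_nonneg m)] at h2

theorem not_dominates_coord_symBasis :
    ¬ Dominates (fun i => h.symBasis.coord i) (fun i => h.symBasis i) := by
  rintro ⟨C, hC⟩
  obtain ⟨n, hn⟩ := exists_nat_gt C
  have h1 := hC (flat (k n))
  rw [sum_flat, sum_flat] at h1
  simp only [symBasis_apply, symBasis_coord] at h1
  have h2 : ‖∑ i ∈ Finset.range (k n), symUnit h i‖ = symNorm h (flat (k n)) := by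
    rw [← sum_flat]
    exact h.norm_sum_symUnit (fun i => i) Function.injective_id _
  rw [h2] at h1
  have hpos := h.symNorm_flat_pos (h.one_le_k n)
  have hk := h.cast_k_pos n
  have h3 := h.norm_sum_coord_mul_le (k n)
  have h4 := h.sqrt_le_symNorm_flat n
  rw [Real.sqrt_le_left hpos.le] at h4
  set A := ‖∑ i ∈ Finset.range (k n), coord (symNorm h) i‖
  have hA : 0 ≤ A := norm_nonneg _
  have hC0 : 0 < C := by
    by_contra hcon
    nlinarith
  have h5 : symNorm h (flat (k n)) ^ 2 ≤ C * k n := by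
    calc symNorm h (flat (k n)) ^ 2 ≤ C * A * symNorm h (flat (k n)) := by
          rw [sq]
          exact mul_le_mul_of_nonneg_right h1 hpos.le
      _ ≤ C * k n := by
          rw [mul_assoc]
          exact mul_le_mul_of_nonneg_left h3 hC0.le
  have h6 := le_of_mul_le_mul_right (h4.trans h5) hk
  linarith

theorem norm_sum_lpUnit (m : ℕ) : ‖∑ i ∈ Finset.range m, lpUnit p i‖ = (m : ℝ) ^ (1 / p) := by
  have hp := h.p_pos
  have e : (ENNReal.ofReal p).toReal = p := ENNReal.toReal_ofReal hp.le
  have h1 := lp.norm_sum_single (p := ENNReal.ofReal p) (E := fun _ : ℕ => ℝ) (by rw [e]; exact hp)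
    (fun _ => (1 : ℝ)) (Finset.range m)
  rw [e] at h1
  have h2 : ‖∑ i ∈ Finset.range m, lpUnit p i‖ ^ p = m := by
    refine h1.trans ?_
    simp
  rw [← h2, ← Real.rpow_mul (lp.norm_nonneg' _), mul_one_div_cancel hp.ne', Real.rpow_one]

theorem not_dominates_lpUnit_coord :
    ¬ Dominates (lpUnit p) (fun i => h.symBasis.coord i) := by
  rintro ⟨C, hC⟩
  have hC1 : 0 < |C| + 1 := by positivity
  obtain ⟨m, hm, hle⟩ := h.exists_symNorm_flat_le (η := 1 / (|C| + 1)) (by positivity)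
  have hm0 : (0 : ℝ) < m := by exact_mod_cast hm
  have h1 := hC (flat m)
  rw [sum_flat, sum_flat, h.norm_sum_lpUnit] at h1
  simp only [symBasis_coord] at h1
  have hpos := h.symNorm_flat_pos hm
  have h2 : (m : ℝ) ≤ |C| * (m : ℝ) ^ (1 / p) * (1 / (|C| + 1) * (m : ℝ) ^ (1 - 1 / p)) := by
    refine (h.le_norm_sum_coord_mul m).trans (mul_le_mul (h1.trans ?_) hle hpos.le (by positivity))
    exact mul_le_mul_of_nonneg_right (le_abs_self C) (by positivity)
  have h3 : |C| * (m : ℝ) ^ (1 / p) * (1 / (|C| + 1) * (m : ℝ) ^ (1 - 1 / p)) =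
      |C| / (|C| + 1) * m := by
    have : (m : ℝ) ^ (1 / p) * (m : ℝ) ^ (1 - 1 / p) = m := by
      rw [← Real.rpow_add hm0, add_sub_cancel, Real.rpow_one]
    calc _ = |C| / (|C| + 1) * ((m : ℝ) ^ (1 / p) * (m : ℝ) ^ (1 - 1 / p)) := by ring
      _ = _ := by rw [this]
  rw [h3] at h2
  have h4 : |C| / (|C| + 1) < 1 := by
    rw [div_lt_one hC1]
    linarith
  nlinarith

end Admissible

/-! ### The James norm on finitely non-zero sequences -/

theorem sum_single_apply_of_unique {ι : Type*} {s : Finset ι} {f : ι → ℕ} {g : ι → ℝ} {i : ι}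
    (hi : i ∈ s) (hg : ∀ j ∈ s, j ≠ i → f j = f i → g j = 0) :
    (∑ j ∈ s, Finsupp.single (f j) (g j)) (f i) = g i := by
  rw [Finsupp.finsetSum_apply, Finset.sum_eq_single_of_mem i hi, Finsupp.single_eq_same]
  intro j hj hji
  by_cases hf : f j = f i
  · rw [hg j hj hji hf, Finsupp.single_zero, Finsupp.zero_apply]
  · exact Finsupp.single_eq_of_ne (Ne.symm hf)

theorem exists_of_sum_single_apply_ne_zero {ι : Type*} {s : Finset ι} {f : ι → ℕ} {g : ι → ℝ}
    {t : ℕ} (ht : (∑ j ∈ s, Finsupp.single (f j) (g j)) t ≠ 0) :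
    ∃ i ∈ s, t = f i ∧ g i ≠ 0 := by
  rw [Finsupp.finsetSum_apply] at ht
  obtain ⟨i, hi, hne⟩ := Finset.exists_ne_zero_of_sum_ne_zero ht
  rw [Finsupp.single_apply] at hne
  split_ifs at hne with h0
  · exact ⟨i, hi, h0.symm, hne⟩
  · exact absurd rfl hne

/-- The sum of a sequence over an interval. -/
def isum (a : ℕ →₀ ℝ) (l m : ℕ) : ℝ := ∑ j ∈ Finset.Ico l m, a j

theorem isum_of_le (a : ℕ →₀ ℝ) {l m : ℕ} (hlm : m ≤ l) : isum a l m = 0 := by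
  rw [isum, Finset.Ico_eq_empty_of_le hlm, Finset.sum_empty]

theorem isum_sum {ι : Type*} (s : Finset ι) (z : ι → ℕ →₀ ℝ) (l m : ℕ) :
    isum (∑ i ∈ s, z i) l m = ∑ i ∈ s, isum (z i) l m := by
  simp only [isum, Finsupp.finsetSum_apply]
  exact Finset.sum_comm

theorem isum_single (i : ℕ) (c : ℝ) (l m : ℕ) :
    isum (Finsupp.single i c) l m = if l ≤ i ∧ i < m then c else 0 := by
  simp [isum, Finsupp.single_apply]

theorem exists_of_isum_ne_zero {a : ℕ →₀ ℝ} {l m : ℕ} (h : isum a l m ≠ 0) :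
    ∃ j, l ≤ j ∧ j < m ∧ a j ≠ 0 := by
  obtain ⟨j, hj, hne⟩ := Finset.exists_ne_zero_of_sum_ne_zero h
  exact ⟨j, (Finset.mem_Ico.1 hj).1, (Finset.mem_Ico.1 hj).2, hne⟩

theorem isum_trunc (x : ℕ → ℝ) (L M l m : ℕ) :
    isum (trunc x (Finset.Ico L M)) l m = ∑ j ∈ Finset.Ico (max l L) (min m M), x j := by
  rw [← Finset.Ico_inter_Ico, isum]
  simp only [trunc_apply]
  rw [Finset.sum_ite_mem]

theorem isum_eq_of_subset {a : ℕ →₀ ℝ} {L M l m : ℕ} (ha : ∀ i, a i ≠ 0 → L ≤ i ∧ i < M)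
    (hl : l ≤ L) (hm : M ≤ m) : isum a l m = isum a L M := by
  refine (Finset.sum_subset (Finset.Ico_subset_Ico hl hm) fun i _ hi => ?_).symm
  by_contra hne
  exact hi (Finset.mem_Ico.2 (ha i hne))

/-- The coefficients of a representative. -/
def repVec (n : ℕ) (q : ℕ → ℕ) (a : ℕ →₀ ℝ) : ℕ →₀ ℝ :=
  ∑ i ∈ Finset.range n, Finsupp.single (q i) (isum a (q i) (q (i + 1)))

theorem repVec_apply {n i : ℕ} {q : ℕ → ℕ} (hq : StrictMono q) (hi : i < n) (a : ℕ →₀ ℝ) :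
    repVec n q a (q i) = isum a (q i) (q (i + 1)) :=
  sum_single_apply_of_unique (f := q) (g := fun i => isum a (q i) (q (i + 1)))
    (Finset.mem_range.2 hi) fun _ _ hji hf => absurd (hq.injective hf) hji

theorem repVec_sum {ι : Type*} (s : Finset ι) (n : ℕ) (q : ℕ → ℕ) (z : ι → ℕ →₀ ℝ) :
    repVec n q (∑ i ∈ s, z i) = ∑ i ∈ s, repVec n q (z i) := by
  simp only [repVec, isum_sum, Finsupp.single_finsetSum]
  exact Finset.sum_comm

/-- Disjoint intervals are part of a partition. -/
theorem exists_partition {ι : Type*} (s : Finset ι) (l m : ι → ℕ) (hlm : ∀ i ∈ s, l i < m i)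
    (hdis : ∀ i ∈ s, ∀ j ∈ s, i ≠ j → m i ≤ l j ∨ m j ≤ l i) :
    ∃ (n : ℕ) (q : ℕ → ℕ), StrictMono q ∧ q 0 = 0 ∧
      ∀ i ∈ s, ∃ c < n, q c = l i ∧ q (c + 1) = m i := by
  classical
  set D : Finset ℕ := insert 0 (s.image l ∪ s.image m) with hD
  set B : ℕ := D.sup id with hB
  have hDB : ∀ t ∈ D, t ≤ B := fun t ht => Finset.le_sup (f := id) ht
  let Q : ℕ → Prop := fun t => t ∈ D ∨ B < t
  have hinf : {t | Q t}.Infinite := by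
    refine Set.infinite_of_not_bddAbove ?_
    rintro ⟨b, hb⟩
    have := hb (show Q (max b B + 1) from Or.inr (by have := le_max_right b B; omega))
    have := le_max_left b B
    omega
  have hl : ∀ i ∈ s, l i ∈ D := fun i hi => Finset.mem_insert_of_mem
    (Finset.mem_union_left _ (Finset.mem_image_of_mem _ hi))
  have hm : ∀ i ∈ s, m i ∈ D := fun i hi => Finset.mem_insert_of_mem
    (Finset.mem_union_right _ (Finset.mem_image_of_mem _ hi))
  refine ⟨B + 1, Nat.nth Q, Nat.nth_strictMono hinf, ?_, fun i hi => ⟨Nat.count Q (l i), ?_, ?_, ?_⟩⟩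
  · have := Nat.nth_count (p := Q) (n := 0) (Or.inl (Finset.mem_insert_self _ _))
    simpa using this
  · have := (Nat.count_le (p := Q) (n := l i)).trans (hDB _ (hl i hi))
    omega
  · exact Nat.nth_count (p := Q) (Or.inl (hl i hi))
  · have hc : Nat.count Q (m i) = Nat.count Q (l i) + 1 := by
      rw [Nat.count_eq_card_filter_range, Nat.count_eq_card_filter_range,
        ← Finset.card_insert_of_notMem (a := l i) (by simp)]
      congr 1
      ext t
      simp only [Finset.mem_filter, Finset.mem_range, Finset.mem_insert]
      have hi1 := hlm i hi
      constructor
      · rintro ⟨ht, hQ⟩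
        rcases lt_trichotomy t (l i) with h1 | h1 | h1
        · exact Or.inr ⟨h1, hQ⟩
        · exact Or.inl h1
        · exfalso
          have hmB := hDB _ (hm i hi)
          rcases hQ with hQ | hQ
          · rw [hD, Finset.mem_insert, Finset.mem_union, Finset.mem_image, Finset.mem_image] at hQ
            rcases hQ with h0 | ⟨j, hj, rfl⟩ | ⟨j, hj, rfl⟩
            · omega
            · have hji : i ≠ j := by rintro rfl; omega
              have := hdis i hi j hj hji
              have := hlm j hj
              omega
            · have hji : i ≠ j := by rintro rfl; omega
              have := hdis i hi j hj hji
              have := hlm j hj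
              omega
          · omega
      · rintro (rfl | ⟨h1, h2⟩)
        · exact ⟨hi1, Or.inl (hl i hi)⟩
        · exact ⟨h1.trans hi1, h2⟩
    rw [← hc]
    exact Nat.nth_count (p := Q) (Or.inl (hm i hi))

/-- An alternating sum of an antitone sequence. -/
theorem alternating_sum_mem {b : ℕ → ℝ} (hb : Antitone b) (N : ℕ) :
    0 ≤ ∑ j ∈ Finset.range N, (b (2 * j) - b (2 * j + 1)) ∧
      ∑ j ∈ Finset.range N, (b (2 * j) - b (2 * j + 1)) ≤ b 0 - b (2 * N) := by
  induction N with
  | zero => simp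
  | succ N ih =>
    rw [Finset.sum_range_succ, mul_add, mul_one]
    have h1 := hb (show 2 * N ≤ 2 * N + 1 by omega)
    have h2 := hb (show 2 * N + 1 ≤ 2 * N + 2 by omega)
    constructor <;> linarith [ih.1, ih.2]

/-- Differences of consecutive unit vectors along a subsequence. -/
def diffVec (n : ℕ → ℕ) (N : ℕ) : ℕ →₀ ℝ :=
  ∑ j ∈ Finset.range N, (Finsupp.single (n (2 * j)) 1 - Finsupp.single (n (2 * j + 1)) 1)

theorem abs_isum_diffVec_le {n : ℕ → ℕ} (hn : StrictMono n) (N : ℕ) {u v : ℕ} (huv : u ≤ v) :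
    |isum (diffVec n N) u v| ≤ 1 := by
  set b : ℕ → ℕ → ℝ := fun v t => if n t < v then 1 else 0 with hb
  have hbA : ∀ v, Antitone (b v) := fun v s t hst => by
    have := hn.monotone hst
    simp only [hb]
    split_ifs <;> first | omega | norm_num
  have hb01 : ∀ v t, 0 ≤ b v t ∧ b v t ≤ 1 := fun v t => by
    simp only [hb]
    split_ifs <;> norm_num
  have hs : ∀ t, isum (Finsupp.single (n t) 1) u v = b v t - b u t := fun t => by
    rw [isum_single]
    simp only [hb]
    split_ifs <;> first | omega | norm_num
  have hd : ∀ s t, isum (Finsupp.single (n s) 1 - Finsupp.single (n t) 1) u v =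
      (b v s - b u s) - (b v t - b u t) := fun s t => by
    rw [← hs, ← hs]
    simp only [isum, Finsupp.sub_apply, Finset.sum_sub_distrib]
  have h1 : isum (diffVec n N) u v = ∑ j ∈ Finset.range N, (b v (2 * j) - b v (2 * j + 1)) -
      ∑ j ∈ Finset.range N, (b u (2 * j) - b u (2 * j + 1)) := by
    rw [diffVec, isum_sum, ← Finset.sum_sub_distrib]
    refine Finset.sum_congr rfl fun j _ => ?_
    rw [hd]
    ring
  have h2 := alternating_sum_mem (hbA v) N
  have h3 := alternating_sum_mem (hbA u) N
  have h4 := hb01 v 0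
  have h5 := hb01 v (2 * N)
  have h6 := hb01 u 0
  have h7 := hb01 u (2 * N)
  rw [h1, abs_le]
  constructor <;> linarith

theorem exists_of_diffVec_ne_zero {n : ℕ → ℕ} {N s : ℕ} (h : diffVec n N s ≠ 0) :
    ∃ j < 2 * N, s = n j := by
  rw [diffVec, Finsupp.finsetSum_apply] at h
  obtain ⟨j, hj, hne⟩ := Finset.exists_ne_zero_of_sum_ne_zero h
  have hj := Finset.mem_range.1 hj
  rw [Finsupp.sub_apply, Finsupp.single_apply, Finsupp.single_apply] at hne
  by_cases h1 : n (2 * j) = s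
  · exact ⟨2 * j, by omega, h1.symm⟩
  · by_cases h2 : n (2 * j + 1) = s
    · exact ⟨2 * j + 1, by omega, h2.symm⟩
    · rw [if_neg h1, if_neg h2, sub_zero] at hne
      exact absurd rfl hne

namespace Admissible

open C00Completion

variable {p r : ℝ} {k : ℕ → ℕ} (h : Admissible p r k)
include h

theorem norm_jamesRep (n : ℕ) (q : ℕ → ℕ) (a : ℕ →₀ ℝ) :
    ‖jamesRep (symUnit h) n q a‖ = symNorm h (repVec n q a) := by
  rw [← norm_emb, repVec, map_sum, jamesRep]
  congr 1
  refine Finset.sum_congr rfl fun i _ => ?_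
  rw [symUnit, ← emb_single, ← map_smul, Finsupp.smul_single_one, isum]

theorem symNorm_repVec_le {n : ℕ} {q : ℕ → ℕ} (hq : StrictMono q) (hq0 : q 0 = 0) (a : ℕ →₀ ℝ) :
    symNorm h (repVec n q a) ≤ jamesNorm (symUnit h) a := by
  rw [← h.norm_jamesRep]
  exact le_ciSup (jamesRep_bddAbove (symUnit h) a) (⟨n, q, hq, hq0⟩ : JamesIndex)

theorem jamesNorm_le {a : ℕ →₀ ℝ} {C : ℝ}
    (hC : ∀ n q, StrictMono q → q 0 = 0 → symNorm h (repVec n q a) ≤ C) : jamesNorm (symUnit h) a ≤ C :=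
  ciSup_le fun s => by
    rw [h.norm_jamesRep]
    exact hC _ _ s.2.2.1 s.2.2.2

/-- The sums over disjoint intervals are controlled by the James norm. -/
theorem symNorm_isum_le {ι : Type*} (s : Finset ι) (l m : ι → ℕ)
    (hdis : ∀ i ∈ s, ∀ j ∈ s, i ≠ j → m i ≤ l j ∨ m j ≤ l i) (a : ℕ →₀ ℝ) :
    symNorm h (∑ i ∈ s, Finsupp.single (l i) (isum a (l i) (m i))) ≤
      jamesNorm (symUnit h) a := by
  classical
  obtain ⟨n, q, hq, hq0, hc⟩ := exists_partition (s.filter fun i => l i < m i) l m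
    (fun i hi => (Finset.mem_filter.1 hi).2) fun i hi j hj =>
      hdis i (Finset.mem_filter.1 hi).1 j (Finset.mem_filter.1 hj).1
  refine le_trans (h.symNorm_mono fun t => ?_) (h.symNorm_repVec_le hq hq0 (n := n) a)
  by_cases h0 : (∑ i ∈ s, Finsupp.single (l i) (isum a (l i) (m i))) t = 0
  · rw [h0, abs_zero]
    exact abs_nonneg _
  · obtain ⟨i, hi, rfl, hne⟩ := exists_of_sum_single_apply_ne_zero h0
    have hlt : ∀ j, isum a (l j) (m j) ≠ 0 → l j < m j := fun j hj => by
      by_contra hcon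
      exact hj (isum_of_le a (not_lt.1 hcon))
    obtain ⟨c, hcn, hc1, hc2⟩ := hc i (Finset.mem_filter.2 ⟨hi, hlt i hne⟩)
    rw [sum_single_apply_of_unique (g := fun i => isum a (l i) (m i)) hi]
    · have := repVec_apply hq hcn a
      rw [hc1, hc2] at this
      rw [this]
    · intro j hj hji hjl
      by_contra hne'
      have h1 := hlt i hne
      have h2 := hlt j hne'
      have := hdis i hi j hj hji.symm
      omega

theorem abs_isum_le (a : ℕ →₀ ℝ) (l m : ℕ) : |isum a l m| ≤ jamesNorm (symUnit h) a := by
  have := h.symNorm_isum_le {()} (fun _ => l) (fun _ => m) (by simp) a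
  rwa [Finset.sum_singleton, h.symNorm_single] at this

theorem jamesNorm_single_le (i : ℕ) (c : ℝ) :
    jamesNorm (symUnit h) (Finsupp.single i c) ≤ |c| := by
  refine h.jamesNorm_le fun n q hq _ => ?_
  rw [← h.symNorm_single 0 c]
  refine h.symNorm_le_of_injOn (fun _ => 0) ?_ ?_
  · intro x hx y hy _
    obtain ⟨i₁, -, rfl, h1⟩ := exists_of_sum_single_apply_ne_zero (Finsupp.mem_support_iff.1 hx)
    obtain ⟨i₂, -, rfl, h2⟩ := exists_of_sum_single_apply_ne_zero (Finsupp.mem_support_iff.1 hy)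
    rw [isum_single] at h1 h2
    have h1 := (ite_ne_right_iff.1 h1).1
    have h2 := (ite_ne_right_iff.1 h2).1
    rcases lt_trichotomy i₁ i₂ with hlt | rfl | hlt
    · have := hq.monotone (show i₁ + 1 ≤ i₂ from hlt)
      omega
    · rfl
    · have := hq.monotone (show i₂ + 1 ≤ i₁ from hlt)
      omega
  · intro x hx
    obtain ⟨j, hj, rfl, -⟩ := exists_of_sum_single_apply_ne_zero (Finsupp.mem_support_iff.1 hx)
    rw [repVec_apply hq (Finset.mem_range.1 hj), isum_single, Finsupp.single_eq_same]
    split_ifs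
    · exact le_rfl
    · rw [abs_zero]
      exact abs_nonneg _

/-- A representative of a truncated sequence, with the intervals moved into the truncation. -/
theorem symNorm_repVec_trunc_le {n : ℕ} {q : ℕ → ℕ} (hq : StrictMono q) (x : ℕ → ℝ) (L M : ℕ) :
    symNorm h (repVec n q (trunc x (Finset.Ico L M))) ≤
      symNorm h (∑ i ∈ Finset.range n, Finsupp.single (max (q i) L)
        (∑ j ∈ Finset.Ico (max (q i) L) (min (q (i + 1)) M), x j)) := by
  have hsep : ∀ i j, i < j →
      ∑ j ∈ Finset.Ico (max (q i) L) (min (q (i + 1)) M), x j ≠ 0 → max (q i) L < max (q j) L := by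
    intro i j hij hne
    have h1 : max (q i) L < min (q (i + 1)) M := by
      by_contra hcon
      rw [Finset.Ico_eq_empty_of_le (not_lt.1 hcon)] at hne
      exact hne rfl
    have h2 := hq.monotone (show i + 1 ≤ j from hij)
    have h3 := min_le_left (q (i + 1)) M
    have h4 := le_max_left (q j) L
    omega
  refine h.symNorm_le_of_injOn (fun t => max t L) ?_ ?_
  · intro y hy z hz hyz
    obtain ⟨i₁, -, rfl, h1⟩ := exists_of_sum_single_apply_ne_zero (Finsupp.mem_support_iff.1 hy)
    obtain ⟨i₂, -, rfl, h2⟩ := exists_of_sum_single_apply_ne_zero (Finsupp.mem_support_iff.1 hz)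
    rw [isum_trunc] at h1 h2
    dsimp only at hyz
    rcases lt_trichotomy i₁ i₂ with hlt | rfl | hlt
    · have := hsep _ _ hlt h1
      omega
    · rfl
    · have := hsep _ _ hlt h2
      omega
  · intro y hy
    obtain ⟨i, hi, rfl, hne⟩ := exists_of_sum_single_apply_ne_zero (Finsupp.mem_support_iff.1 hy)
    rw [repVec_apply hq (Finset.mem_range.1 hi)]
    rw [isum_trunc] at hne ⊢
    rw [sum_single_apply_of_unique (f := fun i => max (q i) L) (g := fun i =>
      ∑ j ∈ Finset.Ico (max (q i) L) (min (q (i + 1)) M), x j) hi]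
    intro j _ hji hmax
    by_contra hne'
    rcases lt_or_gt_of_ne hji with hlt | hlt
    · have := hsep _ _ hlt hne'
      omega
    · have := hsep _ _ hlt hne
      omega

theorem isBimonotone_jamesNorm : IsBimonotone (jamesNorm (symUnit h)) where
  abs_apply_le := fun a i => by simpa [isum] using h.abs_isum_le a i (i + 1)
  trunc_Ico_le := fun a L M => by
    refine h.jamesNorm_le fun n q hq _ => ?_
    refine (h.symNorm_repVec_trunc_le hq a L M).trans ?_
    refine h.symNorm_isum_le (Finset.range n) (fun i => max (q i) L)
      (fun i => min (q (i + 1)) M) (fun i _ j _ hij => ?_) a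
    rcases lt_or_gt_of_ne hij with hlt | hlt
    · have := hq.monotone (show i + 1 ≤ j from hlt)
      omega
    · have := hq.monotone (show j + 1 ≤ i from hlt)
      omega

theorem isBoundedlyComplete_jamesNorm : IsBoundedlyComplete (jamesNorm (symUnit h)) := by
  intro x M hM
  by_contra hx
  obtain ⟨ε, hε, l, hl, hlε⟩ := IsBimonotone.exists_blocks_of_not_cauchySeq hx
  have hex : ∀ j, ∃ (n : ℕ) (q : ℕ → ℕ), StrictMono q ∧
      ε / 2 ≤ symNorm h (repVec n q (trunc x (Finset.Ico (l j) (l (j + 1))))) := by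
    intro j
    by_contra! hcon
    have := h.jamesNorm_le fun n q hq _ => (hcon n q hq).le
    linarith [hlε j]
  choose n q hq hqε using hex
  set w : ℕ → ℕ →₀ ℝ := fun j => ∑ i ∈ Finset.range (n j), Finsupp.single (max (q j i) (l j))
    (∑ t ∈ Finset.Ico (max (q j i) (l j)) (min (q j (i + 1)) (l (j + 1))), x t) with hw
  have hblocks : ∀ j i, w j i ≠ 0 → l j ≤ i ∧ i < l (j + 1) := by
    intro j t ht
    obtain ⟨i, -, rfl, hne⟩ := exists_of_sum_single_apply_ne_zero ht
    have : max (q j i) (l j) < min (q j (i + 1)) (l (j + 1)) := by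
      by_contra hcon
      rw [Finset.Ico_eq_empty_of_le (not_lt.1 hcon)] at hne
      exact hne rfl
    exact ⟨le_max_right _ _, this.trans_le (min_le_right _ _)⟩
  obtain ⟨K, hK⟩ := h.exists_lt_symNorm_sum (disjointlySupported_of_blocks hl.monotone hblocks)
    (half_pos hε) (fun j => (hqε j).trans (h.symNorm_repVec_trunc_le (hq j) x _ _)) M
  refine absurd hK (not_lt.2 (le_trans (le_of_eq ?_) ((h.symNorm_isum_le
    ((Finset.range K).sigma fun j => Finset.range (n j)) (fun s => max (q s.1 s.2) (l s.1))
    (fun s => min (q s.1 (s.2 + 1)) (l (s.1 + 1))) ?_ (trunc x (Finset.range (l K)))).trans (hM _))))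
  · rw [Finset.sum_sigma]
    congr 1
    refine Finset.sum_congr rfl fun j hj => Finset.sum_congr rfl fun i _ => ?_
    congr 1
    refine Finset.sum_congr rfl fun t ht => ?_
    have h1 : t < min (q j (i + 1)) (l (j + 1)) := (Finset.mem_Ico.1 ht).2
    have h2 := hl.monotone (show j + 1 ≤ K from Finset.mem_range.1 hj)
    rw [trunc_apply, if_pos (Finset.mem_range.2 (by omega))]
  · rintro ⟨j, i⟩ - ⟨j', i'⟩ - hne
    dsimp only
    rcases lt_trichotomy j j' with hlt | rfl | hlt
    · have := hl.monotone (show j + 1 ≤ j' from hlt)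
      omega
    · rcases lt_trichotomy i i' with hlt | rfl | hlt
      · have := (hq j).monotone (show i + 1 ≤ i' from hlt)
        omega
      · exact absurd rfl hne
      · have := (hq j).monotone (show i' + 1 ≤ i from hlt)
        omega
    · have := hl.monotone (show j' + 1 ≤ j from hlt)
      omega

/-- Successive blocks with sum zero satisfy an upper `p`-estimate in the James norm. -/
theorem jamesNorm_sum_blocks_le {z : ℕ → ℕ →₀ ℝ} {l : ℕ → ℕ} (hl : Monotone l)
    (hz : ∀ j i, z j i ≠ 0 → l j ≤ i ∧ i < l (j + 1)) (hz0 : ∀ j, isum (z j) (l j) (l (j + 1)) = 0)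
    {C : ℝ} (hC : 0 ≤ C) (hzC : ∀ j, jamesNorm (symUnit h) (z j) ≤ C) (n : ℕ) :
    jamesNorm (symUnit h) (∑ j ∈ Finset.range n, z j) ≤ 2 * C * (n : ℝ) ^ (1 / p) := by
  classical
  refine h.jamesNorm_le fun N q hq hq0 => ?_
  have hq0N : ∀ j, symNorm h (repVec N q (z j)) ≤ C := fun j =>
    (h.symNorm_repVec_le hq hq0 _).trans (hzC j)
  set wA : ℕ → ℕ →₀ ℝ := fun j => (repVec N q (z j)).filter fun t => l j < t with hwA
  set wB : ℕ → ℕ →₀ ℝ := fun j => (repVec N q (z j)).filter fun t => ¬ l j < t with hwB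
  have hsum : repVec N q (∑ j ∈ Finset.range n, z j) =
      ∑ j ∈ Finset.range n, wA j + ∑ j ∈ Finset.range n, wB j := by
    rw [repVec_sum, ← Finset.sum_add_distrib]
    exact Finset.sum_congr rfl fun j _ => (Finsupp.filter_add_filter_not _ _).symm
  have hmem : ∀ j t, repVec N q (z j) t ≠ 0 → ∃ i, t = q i ∧ t < l (j + 1) ∧ l j < q (i + 1) ∧
      (t ≤ l j → q (i + 1) < l (j + 1)) := by
    intro j t ht
    obtain ⟨i, -, rfl, hne⟩ := exists_of_sum_single_apply_ne_zero ht
    obtain ⟨s, hs1, hs2, hs3⟩ := exists_of_isum_ne_zero hne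
    obtain ⟨hs4, hs5⟩ := hz j s hs3
    refine ⟨i, rfl, by omega, by omega, fun hle => ?_⟩
    by_contra hcon
    rw [isum_eq_of_subset (hz j) hle (not_lt.1 hcon)] at hne
    exact hne (hz0 j)
  have hA : DisjointlySupported wA := by
    refine disjointlySupported_of_blocks hl fun j t ht => ?_
    have h1 := Finsupp.mem_support_iff.2 ht
    rw [hwA, Finsupp.support_filter, Finset.mem_filter, Finsupp.mem_support_iff] at h1
    obtain ⟨i, -, h2, -⟩ := hmem j t h1.1
    exact ⟨h1.2.le, h2⟩
  have hB' : ∀ j t, wB j t ≠ 0 → ∃ i, t = q i ∧ l j < q (i + 1) ∧ q (i + 1) < l (j + 1) := by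
    intro j t ht
    have h1 := Finsupp.mem_support_iff.2 ht
    rw [hwB, Finsupp.support_filter, Finset.mem_filter, Finsupp.mem_support_iff] at h1
    obtain ⟨i, h2, -, h3, h4⟩ := hmem j t h1.1
    exact ⟨i, h2, h3, h4 (not_lt.1 h1.2)⟩
  have hB : DisjointlySupported wB := by
    intro j j' hjj' t
    by_contra! hcon
    obtain ⟨i, rfl, h1, h2⟩ := hB' j t hcon.1
    obtain ⟨i', h0, h3, h4⟩ := hB' j' _ hcon.2
    obtain rfl := hq.injective h0
    rcases lt_or_gt_of_ne hjj' with hlt | hlt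
    · have := hl (show j + 1 ≤ j' from hlt)
      omega
    · have := hl (show j' + 1 ≤ j from hlt)
      omega
  have hfil : ∀ (P : ℕ → Prop) [DecidablePred P] (a : ℕ →₀ ℝ), symNorm h (a.filter P) ≤ symNorm h a := by
    intro P _ a
    refine h.symNorm_mono fun t => ?_
    rw [Finsupp.filter_apply]
    split_ifs
    · exact le_rfl
    · rw [abs_zero]
      exact abs_nonneg _
  have h1 := h.symNorm_sum_le_rpow (Finset.range n) wA (fun i _ j _ hij => hA i j hij) hC
    fun j _ => (hfil _ _).trans (hq0N j)
  have h2 := h.symNorm_sum_le_rpow (Finset.range n) wB (fun i _ j _ hij => hB i j hij) hC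
    fun j _ => (hfil _ _).trans (hq0N j)
  rw [Finset.card_range] at h1 h2
  rw [hsum]
  linarith [map_add_le_add (symNorm h) (∑ j ∈ Finset.range n, wA j) (∑ j ∈ Finset.range n, wB j)]

theorem symNorm_flat_two_mul_le (N : ℕ) : symNorm h (flat (2 * N)) ≤ 2 * symNorm h (flat N) := by
  have h1 : flat (2 * N) = flat N + trunc 1 (Finset.Ico N (2 * N)) := by
    rw [flat, ← Finset.sum_range_add_sum_Ico _ (show N ≤ 2 * N by omega)]
    rfl
  have h2 : symNorm h (trunc 1 (Finset.Ico N (2 * N))) ≤ symNorm h (flat N) := by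
    refine h.symNorm_le_flat (fun i => ?_) ?_
    · rw [trunc_apply]
      split_ifs <;> simp
    · refine (Finset.card_le_card (t := Finset.Ico N (2 * N)) fun i hi => ?_).trans (by simp; omega)
      by_contra hcon
      exact Finsupp.mem_support_iff.1 hi (by rw [trunc_apply, if_neg hcon])
  rw [h1]
  linarith [map_add_le_add (symNorm h) (flat N) (trunc 1 (Finset.Ico N (2 * N)))]

theorem jamesNorm_diffVec_le {n : ℕ → ℕ} (hn : StrictMono n) (N : ℕ) :
    jamesNorm (symUnit h) (diffVec n N) ≤ 2 * symNorm h (flat N) := by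
  refine h.jamesNorm_le fun M q hq _ => ?_
  refine le_trans (h.symNorm_le_flat (fun t => ?_) ?_) (h.symNorm_flat_two_mul_le N)
  · by_cases h0 : repVec M q (diffVec n N) t = 0
    · rw [h0, abs_zero]
      exact zero_le_one
    · obtain ⟨i, hi, rfl, -⟩ := exists_of_sum_single_apply_ne_zero h0
      rw [repVec_apply hq (Finset.mem_range.1 hi)]
      exact abs_isum_diffVec_le hn N (hq.monotone (Nat.le_succ i))
  · have hex : ∀ t, repVec M q (diffVec n N) t ≠ 0 →
        ∃ j, j < 2 * N ∧ ∃ i, t = q i ∧ q i ≤ n j ∧ n j < q (i + 1) := by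
      intro t ht
      obtain ⟨i, -, rfl, hne⟩ := exists_of_sum_single_apply_ne_zero ht
      obtain ⟨s, hs1, hs2, hs3⟩ := exists_of_isum_ne_zero hne
      obtain ⟨j, hj, rfl⟩ := exists_of_diffVec_ne_zero hs3
      exact ⟨j, hj, i, rfl, hs1, hs2⟩
    choose! f hf1 hf2 using hex
    rw [← Finset.card_range (2 * N)]
    refine Finset.card_le_card_of_injOn f (fun t ht => ?_) fun t ht t' ht' htt => ?_
    · exact Finset.mem_coe.2 (Finset.mem_range.2 (hf1 t (Finsupp.mem_support_iff.1 ht)))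
    · obtain ⟨i, rfl, h1, h2⟩ := hf2 t (Finsupp.mem_support_iff.1 ht)
      obtain ⟨i', rfl, h3, h4⟩ := hf2 t' (Finsupp.mem_support_iff.1 ht')
      rw [htt] at h1 h2
      rcases lt_trichotomy i i' with hlt | rfl | hlt
      · have := hq.monotone (show i + 1 ≤ i' from hlt)
        omega
      · rfl
      · have := hq.monotone (show i' + 1 ≤ i from hlt)
        omega

end Admissible

/-! ### The space `J` and its duals -/

/-- The weak-star limit of a weakly Cauchy sequence in the bidual. -/
theorem exists_bidual_of_weakly_cauchy {X : Type*} [NormedAddCommGroup X] [NormedSpace ℝ X]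
    {u : ℕ → X} (hu : ∀ f : StrongDual ℝ X, CauchySeq fun n => f (u n)) :
    ∃ θ : StrongDual ℝ (StrongDual ℝ X), ∀ f : StrongDual ℝ X,
      Filter.Tendsto (fun n => f (u n)) Filter.atTop (𝓝 (θ f)) := by
  choose θ hθ using fun f => cauchySeq_tendsto_of_complete (hu f)
  refine ⟨continuousLinearMapOfTendsto (l := Filter.atTop) (fun n => NormedSpace.inclusionInDoubleDual ℝ X (u n))
    (f := θ) (tendsto_pi_nhds.2 fun f => ?_), fun f => hθ f⟩
  simpa only [NormedSpace.dual_def] using hθ f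

namespace Admissible

open C00Completion

variable {p r : ℝ} {k : ℕ → ℕ} (h : Admissible p r k)
include h

/-- The James space over `E` contains no successive sum-zero blocks of `ℓ¹` type. -/
theorem not_forall_le_apply_blocks (f : StrongDual ℝ (JamesSpace (symUnit h)))
    {z : ℕ → ℕ →₀ ℝ} {l : ℕ → ℕ} (hl : Monotone l)
    (hz : ∀ j i, z j i ≠ 0 → l j ≤ i ∧ i < l (j + 1)) (hz0 : ∀ j, isum (z j) (l j) (l (j + 1)) = 0)
    (hz2 : ∀ j, jamesNorm (symUnit h) (z j) ≤ 2) {ε : ℝ} (hε : 0 < ε) :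
    ¬ ∀ j, ε ≤ f (emb _ (z j)) := by
  intro hzε
  obtain ⟨n, hn⟩ := h.exists_mul_rpow_lt (C := ‖f‖ * (2 * 2)) hε
  have h1 := h.jamesNorm_sum_blocks_le hl hz hz0 zero_le_two hz2 n
  have h2 : n * ε ≤ f (emb _ (∑ j ∈ Finset.range n, z j)) := by
    rw [map_sum, map_sum, ← nsmul_eq_mul]
    simpa using Finset.card_nsmul_le_sum (Finset.range n) (fun j => f (emb _ (z j))) ε
      fun j _ => hzε j
  have h3 : f (emb _ (∑ j ∈ Finset.range n, z j)) ≤ ‖f‖ * (2 * 2 * (n : ℝ) ^ (1 / p)) := by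
    refine (Real.le_norm_self _).trans ((f.le_opNorm _).trans ?_)
    rw [norm_emb]
    exact mul_le_mul_of_nonneg_left h1 (norm_nonneg f)
  linarith

theorem cauchySeq_apply_unit (f : StrongDual ℝ (JamesSpace (symUnit h))) :
    CauchySeq fun n => f (unit (jamesNorm (symUnit h)) n) := by
  by_contra hf
  obtain ⟨ε, hε, l, hl, hlε⟩ := exists_strictMono_of_not_cauchySeq hf
  set d : ℕ → ℕ →₀ ℝ := fun j =>
    Finsupp.single (l (2 * j + 1)) 1 - Finsupp.single (l (2 * j)) 1 with hd
  have hfd : ∀ j, ε ≤ |f (emb _ (d j))| := fun j => by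
    have := hlε (2 * j)
    rwa [Real.dist_eq, ← map_sub, ← emb_single, ← emb_single, ← map_sub] at this
  set z : ℕ → ℕ →₀ ℝ := fun j => (SignType.sign (f (emb _ (d j))) : ℝ) • d j with hz
  have hlt : ∀ j, l (2 * j) < l (2 * j + 1) ∧ l (2 * j + 1) < l (2 * (j + 1)) := fun j =>
    ⟨hl (by omega), hl (by omega)⟩
  refine h.not_forall_le_apply_blocks f (z := z) (l := fun j => l (2 * j))
    (fun i j hij => hl.monotone (by omega)) (fun j i hi => ?_) (fun j => ?_) (fun j => ?_) hε
    fun j => ?_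
  · have h1 : d j i ≠ 0 := fun h0 => hi (by
      simp only [hz]
      rw [Finsupp.smul_apply, h0, smul_zero])
    simp only [hd, Finsupp.sub_apply, Finsupp.single_apply] at h1
    have := hlt j
    split_ifs at h1 <;> first | omega | simp at h1
  · have h1 : isum (d j) (l (2 * j)) (l (2 * (j + 1))) = 0 := by
      have h2 : ∀ i, isum (Finsupp.single (l i) 1) (l (2 * j)) (l (2 * (j + 1))) =
          if l (2 * j) ≤ l i ∧ l i < l (2 * (j + 1)) then 1 else 0 := fun i => isum_single _ _ _ _
      have h3 : isum (d j) (l (2 * j)) (l (2 * (j + 1))) =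
          isum (Finsupp.single (l (2 * j + 1)) 1) (l (2 * j)) (l (2 * (j + 1))) -
          isum (Finsupp.single (l (2 * j)) 1) (l (2 * j)) (l (2 * (j + 1))) := by
        simp only [isum, hd, Finsupp.sub_apply, Finset.sum_sub_distrib]
      have := hlt j
      rw [h3, h2, h2, if_pos (by omega), if_pos (by omega), sub_self]
    have h4 : isum (z j) (l (2 * j)) (l (2 * (j + 1))) = (SignType.sign (f (emb _ (d j))) : ℝ) *
        isum (d j) (l (2 * j)) (l (2 * (j + 1))) := by
      simp only [isum, hz, Finsupp.smul_apply, smul_eq_mul, Finset.mul_sum]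
    rw [h4, h1, mul_zero]
  · have h1 : jamesNorm (symUnit h) (d j) ≤ 2 := by
      have h2 := map_sub_le_add (jamesNorm (symUnit h)) (Finsupp.single (l (2 * j + 1)) 1)
        (Finsupp.single (l (2 * j)) 1)
      have h3 := h.jamesNorm_single_le (l (2 * j + 1)) 1
      have h4 := h.jamesNorm_single_le (l (2 * j)) 1
      rw [abs_one] at h3 h4
      simp only [hd]
      linarith
    simp only [hz]
    rw [map_smul_eq_mul]
    have h5 : ‖(SignType.sign (f (emb _ (d j))) : ℝ)‖ ≤ 1 := by
      rcases SignType.trichotomy (SignType.sign (f (emb _ (d j)))) with e | e | e <;> simp [e]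
    have h6 : 0 ≤ jamesNorm (symUnit h) (d j) := apply_nonneg _ _
    nlinarith
  · simp only [hz]
    rw [map_smul, map_smul, smul_eq_mul, sign_mul_self]
    exact hfd j

/-- The functional that sums the coordinates. -/
def sumFun : StrongDual ℝ (JamesSpace (symUnit h)) :=
  (Finsupp.linearCombination ℝ fun _ : ℕ => (1 : ℝ)).extendOfNorm (emb (jamesNorm (symUnit h)))

theorem sumFun_emb (a : ℕ →₀ ℝ) : h.sumFun (emb _ a) = Finsupp.linearCombination ℝ
    (fun _ : ℕ => (1 : ℝ)) a := by
  refine LinearMap.extendOfNorm_eq (denseRange_emb _) ⟨1, fun a => ?_⟩ a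
  rw [norm_emb, one_mul]
  obtain ⟨B, hB⟩ := a.support.bddAbove
  convert h.abs_isum_le a 0 (B + 1)
  rw [Real.norm_eq_abs, Finsupp.linearCombination_apply, Finsupp.sum, isum]
  congr 1
  simp only [smul_eq_mul, mul_one]
  refine Finset.sum_subset (fun i hi => ?_) fun i _ hi => Finsupp.notMem_support_iff.1 hi
  have := hB hi
  exact Finset.mem_Ico.2 ⟨Nat.zero_le _, by omega⟩

theorem sumFun_unit (i : ℕ) : h.sumFun (unit _ i) = 1 := by
  rw [← emb_single, h.sumFun_emb]
  simp

theorem cauchySeq_dualSum_jamesNorm {f : StrongDual ℝ (JamesSpace (symUnit h))}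
    (hf : Filter.Tendsto (fun n => f (unit _ n)) Filter.atTop (𝓝 0)) :
    CauchySeq fun n => dualSum f (Finset.range n) := by
  by_contra hcon
  obtain ⟨ε, hε, l, y, hl, hy1, hyl, hyε⟩ :=
    h.isBimonotone_jamesNorm.exists_blocks_of_not_cauchySeq_dualSum hcon
  obtain ⟨B, hB⟩ : ∃ B, ∀ n ≥ B, |f (unit _ n)| < ε / 2 := by
    simpa using Metric.tendsto_atTop.1 hf (ε / 2) (half_pos hε)
  set s : ℕ → ℝ := fun j => isum (y j) (l j) (l (j + 1)) with hs
  have hs1 : ∀ j, |s j| ≤ 1 := fun j => (h.abs_isum_le _ _ _).trans (hy1 j)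
  set z : ℕ → ℕ →₀ ℝ := fun j => y j - Finsupp.single (l (j + 1) - 1) (s j) with hz
  have hlt : ∀ j, l j < l (j + 1) := fun j => hl (Nat.lt_succ_self j)
  refine h.not_forall_le_apply_blocks f (z := fun j => z (B + j)) (l := fun j => l (B + j))
    (fun i j hij => hl.monotone (by omega)) (fun j i hi => ?_) (fun j => ?_) (fun j => ?_)
    (half_pos hε) fun j => ?_
  · rw [← add_assoc]
    generalize B + j = j at hi
    have := hlt j
    by_cases h0 : l (j + 1) - 1 = i
    · omega
    · simp only [hz, Finsupp.sub_apply, Finsupp.single_apply, if_neg h0, sub_zero] at hi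
      exact hyl j i hi
  · rw [← add_assoc]
    generalize B + j = j
    have := hlt j
    have h1 : isum (z j) (l j) (l (j + 1)) = s j -
        isum (Finsupp.single (l (j + 1) - 1) (s j)) (l j) (l (j + 1)) := by
      simp only [isum, hz, hs, Finsupp.sub_apply, Finset.sum_sub_distrib]
    rw [h1, isum_single, if_pos (by omega), sub_self]
  · generalize B + j = j
    have h2 := map_sub_le_add (jamesNorm (symUnit h)) (y j)
      (Finsupp.single (l (j + 1) - 1) (s j))
    have h3 := h.jamesNorm_single_le (l (j + 1) - 1) (s j)
    simp only [hz]
    linarith [hs1 j, hy1 j]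
  · have h1 : |f (unit _ (l (B + j + 1) - 1))| < ε / 2 := hB _ (by
      have := hl.le_apply (x := B + j + 1)
      omega)
    have h2 : f (emb _ (z (B + j))) = f (emb _ (y (B + j))) -
        s (B + j) * f (unit _ (l (B + j + 1) - 1)) := by
      have h3 : z (B + j) = y (B + j) - s (B + j) • Finsupp.single (l (B + j + 1) - 1) 1 := by
        simp only [hz, Finsupp.smul_single_one]
      rw [h3, map_sub, map_sub, map_smul, map_smul, emb_single, smul_eq_mul]
    have h4 : |s (B + j) * f (unit _ (l (B + j + 1) - 1))| ≤ ε / 2 := by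
      rw [abs_mul]
      calc _ ≤ 1 * (ε / 2) := mul_le_mul (hs1 _) h1.le (abs_nonneg _) zero_le_one
        _ = _ := one_mul _
    rw [h2]
    linarith [hyε (B + j), le_abs_self (s (B + j) * f (unit _ (l (B + j + 1) - 1)))]

theorem exists_theta : ∃ θ : StrongDual ℝ (StrongDual ℝ (JamesSpace (symUnit h))), ∀ f,
    Filter.Tendsto (fun n => f (unit (jamesNorm (symUnit h)) n)) Filter.atTop (𝓝 (θ f)) :=
  exists_bidual_of_weakly_cauchy h.cauchySeq_apply_unit

/-- The weak-star limit of the unit vectors of `J`. -/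
def theta : StrongDual ℝ (StrongDual ℝ (JamesSpace (symUnit h))) := h.exists_theta.choose

theorem tendsto_theta (f : StrongDual ℝ (JamesSpace (symUnit h))) :
    Filter.Tendsto (fun n => f (unit (jamesNorm (symUnit h)) n)) Filter.atTop (𝓝 (h.theta f)) :=
  h.exists_theta.choose_spec f

theorem theta_sumFun : h.theta h.sumFun = 1 := by
  refine tendsto_nhds_unique (h.tendsto_theta h.sumFun) ?_
  simp only [h.sumFun_unit]
  exact tendsto_const_nhds

theorem isQuasiReflexiveWith_theta : IsQuasiReflexiveWith h.theta := by
  intro F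
  obtain ⟨y, hy⟩ := h.isBimonotone_jamesNorm.exists_coord_eq_bidual
    h.isBoundedlyComplete_jamesNorm F
  refine ⟨y, F h.sumFun - h.sumFun y, ?_⟩
  ext f
  have h1 : CauchySeq fun n => dualSum (f - h.theta f • h.sumFun) (Finset.range n) := by
    refine h.cauchySeq_dualSum_jamesNorm ?_
    have h2 := (h.tendsto_theta f).sub_const (h.theta f)
    rw [sub_self] at h2
    refine h2.congr fun n => ?_
    rw [sub_apply, smul_apply, h.sumFun_unit, smul_eq_mul, mul_one]
  have h2 := h.isBimonotone_jamesNorm.bidual_apply_eq hy h1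
  rw [map_sub, map_smul, sub_apply, smul_apply, smul_eq_mul, smul_eq_mul] at h2
  rw [add_apply, smul_apply, NormedSpace.dual_def, smul_eq_mul]
  linarith

theorem hasSmallDifferences_unit : HasSmallDifferences (unit (jamesNorm (symUnit h))) := by
  intro η hη
  obtain ⟨N, hN, hle⟩ := h.exists_symNorm_flat_sq_le (η := η / 4) (by positivity)
  refine ⟨N, hN, fun n hn => ?_⟩
  have h1 : ∑ j ∈ Finset.range N, (unit (jamesNorm (symUnit h)) (n (2 * j)) -
      unit (jamesNorm (symUnit h)) (n (2 * j + 1))) = emb _ (diffVec n N) := by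
    rw [diffVec, map_sum]
    exact Finset.sum_congr rfl fun j _ => by rw [map_sub, emb_single, emb_single]
  rw [h1, norm_emb]
  calc _ ≤ (2 * symNorm h (flat N)) ^ 2 :=
        pow_le_pow_left₀ (apply_nonneg _ _) (h.jamesNorm_diffVec_le hn N) 2
    _ = 4 * symNorm h (flat N) ^ 2 := by ring
    _ ≤ _ := by linarith

theorem propertyW_jamesSpace : PropertyW (JamesSpace (symUnit h)) :=
  propertyW_of_hasSmallDifferences h.isQuasiReflexiveWith_theta h.tendsto_theta
    h.hasSmallDifferences_unit

/-! #### The dual of `J` -/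

/-- The partial sums of the summing functional. -/
def partialSumFun (n : ℕ) : StrongDual ℝ (JamesSpace (symUnit h)) :=
  ∑ i ∈ Finset.range n, coord (jamesNorm (symUnit h)) i

theorem tendsto_partialSumFun (x : JamesSpace (symUnit h)) :
    Filter.Tendsto (fun n => h.partialSumFun n x) Filter.atTop (𝓝 (h.sumFun x)) := by
  refine ((h.sumFun.continuous.tendsto x).comp
    (h.isBimonotone_jamesNorm.tendsto_emb_trunc_range x)).congr fun n => ?_
  rw [Function.comp, emb_trunc, map_sum, partialSumFun, sum_apply]
  refine Finset.sum_congr rfl fun i _ => ?_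
  rw [map_smul, h.sumFun_unit, smul_eq_mul, mul_one]

theorem theta_partialSumFun (n : ℕ) : h.theta (h.partialSumFun n) = 0 := by
  refine tendsto_nhds_unique (h.tendsto_theta _) (tendsto_const_nhds.congr' ?_)
  filter_upwards [Filter.eventually_ge_atTop n] with m hm
  rw [partialSumFun, sum_apply]
  refine (Finset.sum_eq_zero fun i hi => ?_).symm
  have := Finset.mem_range.1 hi
  rw [h.isBimonotone_jamesNorm.coord_unit, Pi.single_eq_of_ne (by omega)]

theorem exists_tau : ∃ τ : StrongDual ℝ (StrongDual ℝ (StrongDual ℝ (JamesSpace (symUnit h)))),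
    ∀ G, Filter.Tendsto (fun n => G (h.partialSumFun n)) Filter.atTop (𝓝 (τ G)) := by
  refine exists_bidual_of_weakly_cauchy fun G => ?_
  obtain ⟨y, c, rfl⟩ := h.isQuasiReflexiveWith_theta G
  refine (Filter.Tendsto.congr (fun n => ?_) (h.tendsto_partialSumFun y)).cauchySeq
  rw [add_apply, smul_apply, NormedSpace.dual_def, h.theta_partialSumFun, smul_zero, add_zero]

/-- The weak-star limit of the partial sums of the summing functional. -/
def tau : StrongDual ℝ (StrongDual ℝ (StrongDual ℝ (JamesSpace (symUnit h)))) :=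
  h.exists_tau.choose

theorem tendsto_tau (G : StrongDual ℝ (StrongDual ℝ (JamesSpace (symUnit h)))) :
    Filter.Tendsto (fun n => G (h.partialSumFun n)) Filter.atTop (𝓝 (h.tau G)) :=
  h.exists_tau.choose_spec G

theorem tau_theta : h.tau h.theta = 0 := by
  refine tendsto_nhds_unique (h.tendsto_tau h.theta) ?_
  simp only [h.theta_partialSumFun]
  exact tendsto_const_nhds

theorem tau_inclusion (x : JamesSpace (symUnit h)) :
    h.tau (NormedSpace.inclusionInDoubleDual ℝ _ x) = h.sumFun x := by
  refine tendsto_nhds_unique (h.tendsto_tau _) ?_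
  simpa only [NormedSpace.dual_def] using h.tendsto_partialSumFun x

theorem isQuasiReflexiveWith_tau : IsQuasiReflexiveWith h.tau := by
  refine h.isQuasiReflexiveWith_theta.dual h.tau ?_
  have : h.tau.comp (NormedSpace.inclusionInDoubleDual ℝ (JamesSpace (symUnit h))) = h.sumFun := by
    ext x
    exact h.tau_inclusion x
  rw [this, h.tau_theta, h.theta_sumFun]
  exact zero_ne_one

theorem norm_sum_partialSumFun_le {n : ℕ → ℕ} (hn : StrictMono n) {N : ℕ} (hN : 1 ≤ N) :
    ‖∑ j ∈ Finset.range N, (h.partialSumFun (n (2 * j)) - h.partialSumFun (n (2 * j + 1)))‖ ≤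
      N / symNorm h (flat N) := by
  have hpos := h.symNorm_flat_pos hN
  refine ContinuousLinearMap.opNorm_le_bound _ (by positivity) fun x => ?_
  refine (denseRange_emb _).induction_on x (isClosed_le (by fun_prop) (by fun_prop)) fun a => ?_
  rw [norm_emb, div_mul_eq_mul_div, le_div_iff₀ hpos]
  have h1 : ∀ j, (h.partialSumFun (n (2 * j)) - h.partialSumFun (n (2 * j + 1))) (emb _ a) =
      -isum a (n (2 * j)) (n (2 * j + 1)) := by
    intro j
    have h2 : ∀ m, h.partialSumFun m (emb _ a) = ∑ i ∈ Finset.range m, a i := fun m => by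
      rw [partialSumFun, sum_apply]
      exact Finset.sum_congr rfl fun i _ => h.isBimonotone_jamesNorm.coord_emb i a
    rw [sub_apply, h2, h2, isum, ← Finset.sum_range_add_sum_Ico _
      (hn.monotone (show 2 * j ≤ 2 * j + 1 by omega))]
    ring
  have hinj : Function.Injective fun j => n (2 * j) := fun i j hij => by
    have := hn.injective hij
    omega
  set c : ℕ →₀ ℝ := ∑ j ∈ Finset.range N, Finsupp.single (n (2 * j))
    (isum a (n (2 * j)) (n (2 * j + 1))) with hc
  have h3 : symNorm h c ≤ jamesNorm (symUnit h) a := by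
    refine h.symNorm_isum_le (Finset.range N) (fun j => n (2 * j)) (fun j => n (2 * j + 1))
      (fun i _ j _ hij => ?_) a
    rcases lt_or_gt_of_ne hij with hlt | hlt
    · exact Or.inl (hn.monotone (by omega))
    · exact Or.inr (hn.monotone (by omega))
  have h4 := h.sum_abs_mul_symNorm_flat_le ((Finset.range N).image fun j => n (2 * j)) c
  rw [Finset.card_image_of_injective _ hinj, Finset.card_range,
    Finset.sum_image fun _ _ _ _ hij => hinj hij] at h4
  refine le_trans (mul_le_mul_of_nonneg_right ?_ hpos.le)
    (h4.trans (mul_le_mul_of_nonneg_left h3 (Nat.cast_nonneg N)))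
  rw [sum_apply, Real.norm_eq_abs]
  refine (Finset.abs_sum_le_sum_abs _ _).trans (Finset.sum_le_sum fun j hj => ?_)
  rw [h1, abs_neg, hc, sum_single_apply_of_unique (f := fun j => n (2 * j))
    (g := fun j => isum a (n (2 * j)) (n (2 * j + 1))) hj fun i _ hij he => absurd (hinj he) hij]

theorem hasSmallDifferences_partialSumFun : HasSmallDifferences h.partialSumFun := by
  intro η hη
  obtain ⟨m, hm⟩ := exists_nat_gt (1 / η)
  rw [div_lt_iff₀ hη] at hm
  have hk := h.cast_k_pos m
  refine ⟨k m, h.one_le_k m, fun n hn => ?_⟩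
  have hpos := h.symNorm_flat_pos (h.one_le_k m)
  have h1 := h.sqrt_le_symNorm_flat m
  rw [Real.sqrt_le_left hpos.le] at h1
  calc _ ≤ ((k m : ℝ) / symNorm h (flat (k m))) ^ 2 :=
        pow_le_pow_left₀ (norm_nonneg _) (h.norm_sum_partialSumFun_le hn (h.one_le_k m)) 2
    _ ≤ η * k m := by
        rw [div_pow, div_le_iff₀ (by positivity)]
        calc (k m : ℝ) ^ 2 ≤ (m * η) * (k m : ℝ) ^ 2 := le_mul_of_one_le_left (by positivity) hm.le
          _ ≤ η * k m * ((m + 1) * k m) := by nlinarith [mul_pos hη (pow_pos hk 2)]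
          _ ≤ _ := mul_le_mul_of_nonneg_left h1 (by positivity)

theorem propertyW_dual_jamesSpace : PropertyW (StrongDual ℝ (JamesSpace (symUnit h))) :=
  propertyW_of_hasSmallDifferences h.isQuasiReflexiveWith_tau h.tendsto_tau
    h.hasSmallDifferences_partialSumFun

theorem not_weaklySequentiallyComplete_dual :
    ¬ WeaklySequentiallyComplete (StrongDual ℝ (JamesSpace (symUnit h))) := by
  intro hw
  obtain ⟨y, hy⟩ := hw h.partialSumFun fun G => (h.tendsto_tau G).cauchySeq
  have h1 : y = h.sumFun := by
    ext x
    refine tendsto_nhds_unique (hy (NormedSpace.inclusionInDoubleDual ℝ _ x)) ?_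
    simpa only [NormedSpace.dual_def] using h.tendsto_partialSumFun x
  have h2 := tendsto_nhds_unique (hy h.theta) (h.tendsto_tau h.theta)
  rw [h1, h.theta_sumFun, h.tau_theta] at h2
  exact one_ne_zero h2

theorem not_weaklySequentiallyComplete_bidual :
    ¬ WeaklySequentiallyComplete (StrongDual ℝ (StrongDual ℝ (JamesSpace (symUnit h)))) := by
  intro hw
  set ι := NormedSpace.inclusionInDoubleDual ℝ (JamesSpace (symUnit h)) with hι
  obtain ⟨Y, hY⟩ := hw (fun n => ι (unit _ n)) fun Φ => (h.tendsto_theta (Φ.comp ι)).cauchySeq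
  have h1 : Y = h.theta := by
    ext f
    exact tendsto_nhds_unique (hY (NormedSpace.inclusionInDoubleDual ℝ _ f)) (h.tendsto_theta f)
  have h2 := hY h.tau
  simp only [hι, h.tau_inclusion, h.sumFun_unit] at h2
  have h3 := tendsto_nhds_unique h2 tendsto_const_nhds
  rw [h1, h.tau_theta] at h3
  exact zero_ne_one h3

end Admissible

end

theorem mainTheorem4 (p r : ℝ) (k : ℕ → ℕ) (h : Admissible p r k) :
    (IsReflexiveSpace (SymSpace h) ∧
      ∃ b : SchauderBasis ℝ (SymSpace h),
        (∀ i, b i = symUnit h i) ∧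
        (∀ i, ‖b i‖ = 1) ∧
        IsSymmetricBasis b ∧
        IsSubsymmetricBasis b ∧
        UpperEstimate b p ∧
        ¬ Dominates (fun i => b.coord i) (fun i => b i) ∧
        ¬ Dominates (lpUnit p) (fun i => b.coord i)) ∧
    PropertyW (JamesSpace (symUnit h)) ∧
    PropertyW (StrongDual ℝ (JamesSpace (symUnit h))) ∧
    ¬ WeaklySequentiallyComplete (StrongDual ℝ (JamesSpace (symUnit h))) ∧
    ¬ WeaklySequentiallyComplete (StrongDual ℝ (StrongDual ℝ (JamesSpace (symUnit h)))) := by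
  exact ⟨⟨h.isReflexiveSpace_symSpace, h.symBasis, h.symBasis_apply, h.norm_symUnit,
    h.isSymmetricBasis_symBasis, h.isSubsymmetricBasis_symBasis, h.upperEstimate_symBasis,
    h.not_dominates_coord_symBasis, h.not_dominates_lpUnit_coord⟩,
    h.propertyW_jamesSpace, h.propertyW_dual_jamesSpace,
    h.not_weaklySequentiallyComplete_dual, h.not_weaklySequentiallyComplete_bidual⟩
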